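/- Setting. Let $(\Omega,\mathcal F,\mathbb P)$ be a probability space, $\Xi\subset\mathbb R$ a Borel set, and $\xi:\Omega\to\Xi$ a random variable with density $w_\xi$; all norms over $\Xi$ are taken with respect to the law of $\xi$ and carry the index $\xi$. Let $\mathcal U\subset\mathbb R^m$ be open, $f\in C^2(\mathcal U;\mathbb R^m)$ a flux whose Jacobian has $m$ distinct real eigenvalues at every state, and $(\eta,q)$ a pair of $C^2$ functions on $\mathcal U$ with $\eta$ strictly convex and $D\eta\,Df=Dq$. Let $T>0$ and let $u$ be a random entropy solution of $$\partial_t u(t,x,y)+\partial_x f(u(t,x,y))=0,\quad (t,x,y)\in(0,T)\times\mathbb R\times\Xi,\qquad u(0,x,y)=u^0(x,y),$$ that is, $u\in L^1_\xi(\Xi;L^1((0,T)\times\mathbb R;\mathcal U))$ and for almost every $y$ the path $u(\cdot,\cdot,y)$ is a locally bounded weak solution satisfying the entropy inequality for $(\eta,q)$ in the weak sense (with Lipschitz, compactly supported test functions on $[0,T)\times\mathbb R$), normalized so that $t\mapsto u(t,\cdot,y)$ is weakly continuous on $[0,T]$. Discretization. Let $\{\Psi_i\}_{i\ge 0}$ be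 an orthonormal basis of $L^2_\xi(\Xi)$, let $y_0,\dots,y_R\in\Xi$ and $w_0,\dots,w_R\in\mathbb R$ be quadrature points and weights, let $M\ge 0$, and let $0\le t_0<\dots<t_N\le T$. Fix a uniform mesh of $\mathbb R$ and let $V_p$ be the functions that are polynomials of degree at most $p$ on each cell. For each $l$ let $u_h^n(\cdot,y_l)\in V_p$, $n=0,\dots,N$, be the numerical solution at $y_l$, and let $\hat u^{st}(y_l):[0,T]\times\mathbb R\to\mathbb R^m$ be a space-time reconstruction: Lipschitz continuous, with $\hat u^{st}(y_l)(t,\cdot)\in V_{p+1}$ for all $t$. Put $$u_h^n(x,y)=\sum_{i=0}^M\Big(\sum_{l=0}^R u_h^n(x,y_l)\Psi_i(y_l)w_l\Big)\Psi_i(y),\qquad \hat u^{sts}(t,x,y)=\sum_{i=0}^M\Big(\sum_{l=0}^R \hat u^{st}(y_l)(t,x)\Psi_i(y_l)w_l\Big)\Psi_i(y),$$ and $\mathcal R^{sts}=\partial_t\hat u^{sts}+\partial_x f(\hat u^{sts})$. Let $\mathcal C\subset\mathcal U$ be convex and compact such that, for almost every $y$, $u(\cdot,\cdot,y)$ takes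 values in $\mathcal C$ almost everywhere and $\hat u^{sts}(\cdot,\cdot,y)$ takes values in $\mathcal C$. Let $C_f\ge 0$ and $0<\underline\eta\le\overline\eta$ satisfy $$|v^\top Hf(a)v|\le C_f|v|^2,\qquad \underline\eta|v|^2\le v^\top H\eta(a)v\le\overline\eta|v|^2\qquad\text{for all } v\in\mathbb R^m,\ a\in\mathcal C,$$ where $H$ denotes second derivatives. Theorem. For every $n=0,\dots,N$, $$\begin{aligned}\|u(t_n,\cdot,\cdot)-u_h^n\|^2_{L^2_\xi(\Xi;L^2(\mathbb R))}\le{}& 2\|\hat u^{sts}(t_n,\cdot,\cdot)-u_h^n\|^2_{L^2_\xi(\Xi;L^2(\mathbb R))}+2\underline\eta^{-1}\big(\mathcal E^{sts}(t_n)+\overline\eta\,\mathcal E_0^{sts}\big)\\ &\times\exp\Big(\underline\eta^{-1}\int_0^{t_n}\big(\overline\eta\,C_f\,\|\partial_x\hat u^{sts}(t,\cdot,\cdot)\|_{L^\infty_\xi(\Xi;L^\infty(\mathbb R))}+\overline\eta^{\,2}\big)\,dt\Big),\end{aligned}$$ where $\mathcal E^{sts}(t_n)=\|\mathcal R^{sts}\|^2_{L^2_\xi(\Xi;L^2((0,t_n)\times\mathbb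 R))}$ and $\mathcal E^{sts}_0=\|u^0-\hat u^{sts}(0,\cdot,\cdot)\|^2_{L^2_\xi(\Xi;L^2(\mathbb R))}$. The norms may be infinite; the inequality is understood in $[0,\infty]$, with $0\cdot\infty=0$. -/

import Mathlib

open MeasureTheory Set
open scoped ENNReal NNReal

noncomputable section

/-- Phase space `ℝ^m` with its Euclidean norm. -/
abbrev Vec (m : ℕ) : Type := EuclideanSpace ℝ (Fin m)

/-- The open space-time strip `(0, τ) × ℝ`. -/
def strip (τ : ℝ) : Set (ℝ × ℝ) := Ioo 0 τ ×ˢ univ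

/-- Strict hyperbolicity on the state space `U`: at each state the Jacobian of the flux has `m`
distinct real eigenvalues. -/
def StrictlyHyperbolic {m : ℕ} (U : Set (Vec m)) (f : Vec m → Vec m) : Prop :=
  ∀ a ∈ U, ∃ ev : Fin m → ℝ, Function.Injective ev ∧
    ∀ i, Module.End.HasEigenvalue (fderiv ℝ f a : Vec m →ₗ[ℝ] Vec m) (ev i)

/-- `(η, q)` is an entropy/entropy-flux pair of class `C²` for the flux `f` on the open set `U`:
`η` is strictly convex (on each convex part of `U`, since `U` itself need not be convex) and
`Dη Df = Dq`. -/
structure IsEntropyPair {m : ℕ} (U : Set (Vec m)) (f : Vec m → Vec m) (η q : Vec m → ℝ) :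
    Prop where
  contDiff_entropy : ContDiffOn ℝ 2 η U
  contDiff_flux : ContDiffOn ℝ 2 q U
  strictConvex : ∀ K ⊆ U, Convex ℝ K → StrictConvexOn ℝ K η
  compatible : ∀ a ∈ U, (fderiv ℝ η a).comp (fderiv ℝ f a) = fderiv ℝ q a

/-- Lipschitz continuous test functions with compact support in `[0, T) × ℝ` (restrictions to
`t ≥ 0` of Lipschitz functions on the plane with compact support in `(-∞, T) × ℝ`).  Their partial
derivatives exist almost everywhere and are bounded. -/
structure IsTestFunction (T : ℝ) (φ : ℝ → ℝ → ℝ) : Prop where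
  lipschitz : ∃ L : ℝ≥0, LipschitzWith L (fun p : ℝ × ℝ => φ p.1 p.2)
  compact : HasCompactSupport (fun p : ℝ × ℝ => φ p.1 p.2)
  support : tsupport (fun p : ℝ × ℝ => φ p.1 p.2) ⊆ Iio T ×ˢ univ

/-- `u` is an entropy admissible weak solution (for the entropy pair `(η, q)`) of
`∂ₜ u + ∂ₓ f(u) = 0` on `(0, T) × ℝ`, `u(0, ·) = u₀`: a locally bounded function with values in
`U` that satisfies the equation and the entropy inequality `∂ₜ η(u) + ∂ₓ q(u) ≤ 0` weakly, the
initial datum being attained through the boundary terms at `t = 0`.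
As usual `u` is normalized on null sets so that `t ↦ u(t, ·)` is weakly continuous on `[0, T]`,
which is what gives a meaning to `u(t, ·)` at an individual time `t`. -/
structure IsEntropySolution {m : ℕ} (U : Set (Vec m)) (f : Vec m → Vec m) (η q : Vec m → ℝ)
    (T : ℝ) (u₀ : ℝ → Vec m) (u : ℝ → ℝ → Vec m) : Prop where
  mem_init : ∀ᵐ x : ℝ, u₀ x ∈ U
  mem : ∀ᵐ p ∂(volume.restrict (strip T)), u p.1 p.2 ∈ U
  locBounded : ∀ K : Set (ℝ × ℝ), IsCompact K → K ⊆ Ico 0 T ×ˢ univ →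
    ∃ B : ℝ, ∀ᵐ p ∂(volume.restrict K), ‖u p.1 p.2‖ ≤ B
  locInt_init : LocallyIntegrable u₀
  locInt_entropy_init : LocallyIntegrable (fun x => η (u₀ x))
  locInt : LocallyIntegrableOn (fun p : ℝ × ℝ => u p.1 p.2) (Ico 0 T ×ˢ univ)
  locInt_flux : LocallyIntegrableOn (fun p : ℝ × ℝ => f (u p.1 p.2)) (Ico 0 T ×ˢ univ)
  locInt_entropy : LocallyIntegrableOn (fun p : ℝ × ℝ => η (u p.1 p.2)) (Ico 0 T ×ˢ univ)
  locInt_entropyFlux : LocallyIntegrableOn (fun p : ℝ × ℝ => q (u p.1 p.2)) (Ico 0 T ×ˢ univ)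
  weak : ∀ φ : ℝ → ℝ → ℝ, IsTestFunction T φ →
    (∫ p in strip T, (deriv (fun s => φ s p.2) p.1 • u p.1 p.2
        + deriv (fun z => φ p.1 z) p.2 • f (u p.1 p.2)))
      + ∫ x, φ 0 x • u₀ x = 0
  entropy : ∀ φ : ℝ → ℝ → ℝ, IsTestFunction T φ → (∀ t x, 0 ≤ φ t x) →
    0 ≤ (∫ p in strip T, (deriv (fun s => φ s p.2) p.1 * η (u p.1 p.2)
        + deriv (fun z => φ p.1 z) p.2 * q (u p.1 p.2)))
      + ∫ x, φ 0 x * η (u₀ x)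
  locInt_slice : ∀ t ∈ Icc 0 T, LocallyIntegrable (u t)
  weakCont : ∀ g : ℝ → ℝ, Continuous g → HasCompactSupport g →
    ContinuousOn (fun t => ∫ x, g x • u t x) (Icc 0 T)

/-- Random entropy solution: an element of `L¹(Ξ; L¹((0, T) × ℝ))` (with respect to the law `μ`)
whose paths are entropy solutions almost surely.  The arguments of `u` are `t, x, y`. -/
structure IsRandomEntropySolution {m : ℕ} (μ : Measure ℝ) (U : Set (Vec m))
    (f : Vec m → Vec m) (η q : Vec m → ℝ) (T : ℝ) (u₀ : ℝ → ℝ → Vec m)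
    (u : ℝ → ℝ → ℝ → Vec m) : Prop where
  measurable_init : Measurable (fun p : ℝ × ℝ => u₀ p.1 p.2)
  measurable : Measurable (fun p : ℝ × ℝ × ℝ => u p.1 p.2.1 p.2.2)
  integrable : Integrable (fun p : (ℝ × ℝ) × ℝ => u p.1.1 p.1.2 p.2)
    ((volume.restrict (strip T)).prod μ)
  path : ∀ᵐ y ∂μ, IsEntropySolution U f η q T (fun x => u₀ x y) (fun t x => u t x y)

/-- `Ψ₀, Ψ₁, …` is an orthonormal basis of `L²(μ)`. -/
structure IsOrthonormalBasisL2 (μ : Measure ℝ) (Ψ : ℕ → ℝ → ℝ) : Prop where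
  measurable : ∀ i, Measurable (Ψ i)
  memLp : ∀ i, MemLp (Ψ i) 2 μ
  orthonormal : ∀ i j, ∫ y, Ψ i y * Ψ j y ∂μ = if i = j then 1 else 0
  complete : ∀ g : ℝ → ℝ, MemLp g 2 μ → (∀ i, ∫ y, g y * Ψ i y ∂μ = 0) → g =ᵐ[μ] 0

/-- The discontinuous Galerkin space of degree `p` on the uniform mesh of `ℝ` with cells
`(x₀ + j h, x₀ + (j + 1) h)`, `j ∈ ℤ`: the restriction to each cell is a polynomial of degree at
most `p` in each component. -/
def IsDG {m : ℕ} (x₀ h : ℝ) (p : ℕ) (v : ℝ → Vec m) : Prop :=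
  ∀ j : ℤ, ∃ P : Fin m → Polynomial ℝ, (∀ i, (P i).natDegree ≤ p) ∧
    ∀ x ∈ Ioo (x₀ + j * h) (x₀ + (j + 1) * h), ∀ i, v x i = (P i).eval x

/-- The regularity class of the space-time reconstructions: Lipschitz continuous in space and time
on `[0, T] × ℝ`, with piecewise polynomial slices of degree `p`. -/
structure IsReconstruction {m : ℕ} (T x₀ h : ℝ) (p : ℕ) (v : ℝ → ℝ → Vec m) : Prop where
  lipschitz : ∃ L : ℝ≥0, LipschitzOnWith L (fun z : ℝ × ℝ => v z.1 z.2) (Icc 0 T ×ˢ univ)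
  isDG : ∀ t ∈ Icc 0 T, IsDG x₀ h p (v t)

/-- The `i`-th mode from the values `v l` at the quadrature points `yq l` with weights `wq l`:
`∑ₗ v(yₗ) Ψᵢ(yₗ) wₗ`. -/
def nispMode {m R : ℕ} (Ψ : ℕ → ℝ → ℝ) (yq wq : Fin (R + 1) → ℝ) (v : Fin (R + 1) → Vec m)
    (i : ℕ) : Vec m :=
  ∑ l, (Ψ i (yq l) * wq l) • v l

/-- The truncated expansion `∑_{i = 0}^M (i-th mode) Ψᵢ(y)`. -/
def nispExpansion {m R : ℕ} (M : ℕ) (Ψ : ℕ → ℝ → ℝ) (yq wq : Fin (R + 1) → ℝ)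
    (v : Fin (R + 1) → Vec m) (y : ℝ) : Vec m :=
  ∑ i ∈ Finset.range (M + 1), Ψ i y • nispMode Ψ yq wq v i

/-- The space-time-stochastic reconstruction built from the space-time reconstructions `v l` at the
quadrature points; arguments `t, x, y`. -/
def stsReconstruction {m R : ℕ} (M : ℕ) (Ψ : ℕ → ℝ → ℝ) (yq wq : Fin (R + 1) → ℝ)
    (v : Fin (R + 1) → ℝ → ℝ → Vec m) (t x y : ℝ) : Vec m :=
  nispExpansion M Ψ yq wq (fun l => v l t x) y

/-- The numerical solution at the `n`-th time level built from the numerical solutions `uh l n` at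
the quadrature points; arguments `x, y`. -/
def numSolution {m R N : ℕ} (M : ℕ) (Ψ : ℕ → ℝ → ℝ) (yq wq : Fin (R + 1) → ℝ)
    (uh : Fin (R + 1) → Fin (N + 1) → ℝ → Vec m) (n : Fin (N + 1)) (x y : ℝ) : Vec m :=
  nispExpansion M Ψ yq wq (fun l => uh l n x) y

/-- The residual `∂ₜ v + ∂ₓ f(v)` at `(t, x, y)`.  It is used for `v` Lipschitz in `(t, x)`, where
the classical derivatives exist almost everywhere and agree with the weak ones. -/
def stsResidual {m : ℕ} (f : Vec m → Vec m) (v : ℝ → ℝ → ℝ → Vec m) (t x y : ℝ) : Vec m :=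
  deriv (fun s => v s x y) t + deriv (fun z => f (v t z y)) x

/-- The squared norm `∫_Ξ ∫ |g(z, y)|² dν(z) dμ(y)` of `L²(μ; L²(ν))`, possibly infinite. -/
def sqNormL2 {α : Type*} [MeasurableSpace α] {m : ℕ} (μ : Measure ℝ) (ν : Measure α)
    (g : α → ℝ → Vec m) : ℝ≥0∞ :=
  ∫⁻ y, ∫⁻ z, ‖g z y‖ₑ ^ 2 ∂ν ∂μ

/-- The norm of `L^∞(μ; L^∞(ℝ))`, possibly infinite. -/
def normLinfty {m : ℕ} (μ : Measure ℝ) (g : ℝ → ℝ → Vec m) : ℝ≥0∞ :=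
  essSup (fun y => essSup (fun x => ‖g x y‖ₑ) volume) μ

end

/-!
The theorem is an instance of the relative entropy method.  For almost every `y` the reconstruction
`v = û^{sts}(·, ·, y)` is a Lipschitz function with values in the convex compact set `C`, and it
solves the system up to the residual `r = ∂ₜ v + ∂ₓ f(v)`.  Testing the entropy inequality for `u`
with `φ`, the weak formulation for `u` with `φ Dη(v)`, and integrating the divergence of
`φ (η(v) - Dη(v) v, q(v) - Dη(v) f(v))` gives an inequality for the relative entropy
`η(u | v) = η(u) - η(v) - Dη(v)(u - v)` (`IsEntropySolution.relEntropy_inequality`).  Since `Df(v)`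
is symmetric with respect to `D²η(v)`, its production terms are `-D²η(v)(r, u - v)` and
`-D²η(v)(∂ₓ v, f(u | v))` with the relative flux `f(u | v)`.  They are bounded by
`|r|² + (ηup Cf |∂ₓ v| + ηup²) |u - v|²` up to the factor `1/2`, and `|u - v|²` is comparable to
`η(u | v)` (`IsStateSet.production_le`, `IsStateSet.relEntropy_bounds`).

Gronwall's lemma and the localization in space are built into the test function, which is the
product of a cut-off in time, of `exp(-∫₀ᵗ a)` with the growth rate `a`, and of a backward cone
weight.  The derivative of the exponential absorbs the growth terms; the derivative of the cone
weight absorbs the flux of the relative entropy, which is at most a multiple of `η(u | v)`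
(`IsStateSet.exists_relEntropyFlux_le`, `pointwise_stability`).  What is left is a bound for averages
in time over intervals to the left of `τ` (`IsEntropySolution.averaged_stability`).

To reach every time, and not only almost every one, `|u - v|²` is bounded below by
`2 ⟨u - v, g⟩ - |g|²` with a continuous compactly supported `g`: the integral of this expression is
continuous in time by weak continuity of `u`, so that the averages can be replaced by the value at
`τ`, and the supremum over `g` is the squared `L²` norm (`IsEntropySolution.stability`).  The weakly
continuous representative takes its values in `C` at every time and attains the initial datum
(`IsEntropySolution.slice_mem`, `IsEntropySolution.init_eq`).

The estimate for fixed `y` holds with any measurable bound `g(t)` of `|∂ₓ v(t, ·)|`, in particular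
with the norm in `L^∞_ξ(Ξ; L^∞(ℝ))` (`IsEntropySolution.stability_ennreal`,
`ae_le_essSup_essSup`).  Its integral over `y`, together with the triangle inequality, is the claim.
-/

noncomputable section

/-! ### Relative entropy on the set of states -/

/-- The data of the relative entropy method: a convex compact set `C` of states inside the open
domain `U` of a flux `f` with entropy pair `(η, q)`, and the bounds on `C` for the second
derivatives of `f` and `η`. -/
structure IsStateSet {m : ℕ} (U : Set (Vec m)) (f : Vec m → Vec m) (η q : Vec m → ℝ)
    (C : Set (Vec m)) (Cf ηlow ηup : ℝ) : Prop where
  isOpen : IsOpen U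
  contDiff : ContDiffOn ℝ 2 f U
  entropyPair : IsEntropyPair U f η q
  subset : C ⊆ U
  convex : Convex ℝ C
  compact : IsCompact C
  Cf_nonneg : 0 ≤ Cf
  low_pos : 0 < ηlow
  low_le_up : ηlow ≤ ηup
  flux_bound : ∀ a ∈ C, ∀ v, ‖fderiv ℝ (fderiv ℝ f) a v v‖ ≤ Cf * ‖v‖ ^ 2
  lower : ∀ a ∈ C, ∀ v, ηlow * ‖v‖ ^ 2 ≤ fderiv ℝ (fderiv ℝ η) a v v
  upper : ∀ a ∈ C, ∀ v, fderiv ℝ (fderiv ℝ η) a v v ≤ ηup * ‖v‖ ^ 2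

/-- The relative entropy `η(a | b) = η(a) - η(b) - Dη(b)(a - b)`. -/
def relEntropy {m : ℕ} (η : Vec m → ℝ) (a b : Vec m) : ℝ := η a - η b - fderiv ℝ η b (a - b)

/-- The relative flux `f(a | b) = f(a) - f(b) - Df(b)(a - b)`. -/
def relFlux {m : ℕ} (f : Vec m → Vec m) (a b : Vec m) : Vec m := f a - f b - fderiv ℝ f b (a - b)

/-- The flux `q(a) - q(b) - Dη(b)(f(a) - f(b))` of the relative entropy. -/
def relEntropyFlux {m : ℕ} (f : Vec m → Vec m) (η q : Vec m → ℝ) (a b : Vec m) : ℝ :=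
  q a - q b - fderiv ℝ η b (f a - f b)

/-- Second order Taylor estimate on `[0, 1]` for vector valued functions. -/
theorem norm_taylor_two_le {E : Type*} [NormedAddCommGroup E] [NormedSpace ℝ E]
    {g g' g'' : ℝ → E} {K : ℝ}
    (hg : ∀ θ ∈ Icc (0 : ℝ) 1, HasDerivAt g (g' θ) θ)
    (hg' : ∀ θ ∈ Icc (0 : ℝ) 1, HasDerivAt g' (g'' θ) θ)
    (hK : ∀ θ ∈ Icc (0 : ℝ) 1, ‖g'' θ‖ ≤ K) :
    ‖g 1 - g 0 - g' 0‖ ≤ K / 2 := by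
  have h1 : ∀ θ ∈ Icc (0 : ℝ) 1, ‖g' θ - g' 0‖ ≤ K * (θ - 0) := by
    apply norm_image_sub_le_of_norm_deriv_le_segment'
    · intro θ hθ
      exact (hg' θ hθ).hasDerivWithinAt
    · intro θ hθ
      exact hK θ (Ico_subset_Icc_self hθ)
  have h2 : ∀ θ ∈ Icc (0 : ℝ) 1, ‖g θ - g 0 - θ • g' 0‖ ≤ K / 2 * θ ^ 2 := by
    intro θ hθ
    refine image_norm_le_of_norm_deriv_right_le_deriv_boundary (a := 0) (b := 1)
      (f := fun θ => g θ - g 0 - θ • g' 0) (f' := fun θ => g' θ - g' 0)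
      (B := fun θ => K / 2 * θ ^ 2) (B' := fun θ => K * θ) ?_ ?_ ?_ ?_ ?_ hθ
    · intro θ hθ
      exact (((hg θ hθ).continuousAt.sub continuousAt_const).sub
        (continuousAt_id.smul continuousAt_const)).continuousWithinAt
    · intro θ hθ
      have := (((hg θ (Ico_subset_Icc_self hθ)).sub_const (g 0)).fun_sub
        ((hasDerivAt_id θ).smul_const (g' 0))).hasDerivWithinAt (s := Ici θ)
      simpa using this
    · simp
    · intro θ
      have := ((hasDerivAt_id θ).pow 2).const_mul (K / 2)
      refine this.congr_deriv ?_
      simp only [Nat.cast_ofNat, Nat.add_one_sub_one, id, pow_one, mul_one]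
      ring
    · intro θ hθ
      simpa using h1 θ (Ico_subset_Icc_self hθ)
  simpa using h2 1 (by simp)

namespace IsStateSet

variable {m : ℕ} {U : Set (Vec m)} {f : Vec m → Vec m} {η q : Vec m → ℝ} {C : Set (Vec m)}
  {Cf ηlow ηup : ℝ}

theorem up_pos (S : IsStateSet U f η q C Cf ηlow ηup) : 0 < ηup :=
  S.low_pos.trans_le S.low_le_up

theorem segment_mem (S : IsStateSet U f η q C Cf ηlow ηup) {a b : Vec m} (ha : a ∈ C)
    (hb : b ∈ C) {θ : ℝ} (hθ : θ ∈ Icc (0 : ℝ) 1) : b + θ • (a - b) ∈ C :=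
  S.convex.add_smul_sub_mem hb ha hθ

theorem contDiffAt_flux (S : IsStateSet U f η q C Cf ηlow ηup) {a : Vec m} (ha : a ∈ C) :
    ContDiffAt ℝ 2 f a :=
  S.contDiff.contDiffAt (S.isOpen.mem_nhds (S.subset ha))

theorem contDiffAt_entropy (S : IsStateSet U f η q C Cf ηlow ηup) {a : Vec m} (ha : a ∈ C) :
    ContDiffAt ℝ 2 η a :=
  S.entropyPair.contDiff_entropy.contDiffAt (S.isOpen.mem_nhds (S.subset ha))

theorem contDiffAt_entropyFlux (S : IsStateSet U f η q C Cf ηlow ηup) {a : Vec m} (ha : a ∈ C) :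
    ContDiffAt ℝ 2 q a :=
  S.entropyPair.contDiff_flux.contDiffAt (S.isOpen.mem_nhds (S.subset ha))

theorem differentiableAt_fderiv {E F : Type*} [NormedAddCommGroup E] [NormedSpace ℝ E]
    [NormedAddCommGroup F] [NormedSpace ℝ F] {g : E → F} {a : E} (hg : ContDiffAt ℝ 2 g a) :
    DifferentiableAt ℝ (fderiv ℝ g) a :=
  (hg.fderiv_right (m := 1) (by norm_num)).differentiableAt (by norm_num)

/-- Taylor estimate along the segment from `b` to `a`. -/
theorem norm_taylor_segment_le {F : Type*} [NormedAddCommGroup F] [NormedSpace ℝ F]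
    (S : IsStateSet U f η q C Cf ηlow ηup) {g : Vec m → F}
    (hg : ∀ c ∈ C, ContDiffAt ℝ 2 g c) {a b : Vec m} (ha : a ∈ C) (hb : b ∈ C) {κ : F} {K : ℝ}
    (hK : ∀ c ∈ C, ‖fderiv ℝ (fderiv ℝ g) c (a - b) (a - b) - κ‖ ≤ K) :
    ‖g a - g b - fderiv ℝ g b (a - b) - (1 / 2 : ℝ) • κ‖ ≤ K / 2 := by
  set d := a - b with hd
  have hline : ∀ θ : ℝ, HasDerivAt (fun θ : ℝ => b + θ • d) d θ := fun θ => by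
    simpa using ((hasDerivAt_id θ).smul_const d).const_add b
  have h0 : ∀ θ ∈ Icc (0 : ℝ) 1, b + θ • d ∈ C := fun θ hθ => S.segment_mem ha hb hθ
  have key := norm_taylor_two_le (g := fun θ => g (b + θ • d) - (θ ^ 2 / 2) • κ)
    (g' := fun θ => fderiv ℝ g (b + θ • d) d - θ • κ)
    (g'' := fun θ => fderiv ℝ (fderiv ℝ g) (b + θ • d) d d - κ) (K := K) ?_ ?_ ?_
  · have hab : b + (1 : ℝ) • d = a := by simp [hd]
    simp only [hab] at key
    convert key using 2
    simp
    abel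
  · intro θ hθ
    have h1 : HasFDerivAt g (fderiv ℝ g (b + θ • d)) (b + θ • d) :=
      ((hg _ (h0 θ hθ)).differentiableAt (by norm_num)).hasFDerivAt
    have h2 : HasDerivAt (fun θ : ℝ => θ ^ 2 / 2) θ θ := by
      have := ((hasDerivAt_id θ).pow 2).div_const 2
      simpa using this
    exact (h1.comp_hasDerivAt θ (hline θ)).sub (h2.smul_const κ)
  · intro θ hθ
    have h1 := (differentiableAt_fderiv (hg _ (h0 θ hθ))).hasFDerivAt.comp_hasDerivAt θ (hline θ)
    have h2 := (h1.clm_apply (hasDerivAt_const θ d)).fun_sub ((hasDerivAt_id θ).smul_const κ)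
    simpa using h2
  · intro θ hθ
    exact hK _ (h0 θ hθ)

theorem norm_relFlux_le (S : IsStateSet U f η q C Cf ηlow ηup) {a b : Vec m} (ha : a ∈ C)
    (hb : b ∈ C) : ‖relFlux f a b‖ ≤ Cf / 2 * ‖a - b‖ ^ 2 := by
  have := S.norm_taylor_segment_le (fun c hc => S.contDiffAt_flux hc) ha hb (κ := 0)
    (K := Cf * ‖a - b‖ ^ 2) (fun c hc => by simpa using S.flux_bound c hc (a - b))
  rw [smul_zero, sub_zero] at this
  unfold relFlux
  linarith

theorem relEntropy_bounds (S : IsStateSet U f η q C Cf ηlow ηup) {a b : Vec m} (ha : a ∈ C)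
    (hb : b ∈ C) : ηlow / 2 * ‖a - b‖ ^ 2 ≤ relEntropy η a b ∧
      relEntropy η a b ≤ ηup / 2 * ‖a - b‖ ^ 2 := by
  -- compare with the midpoint of the range of the second derivative
  have := S.norm_taylor_segment_le (fun c hc => S.contDiffAt_entropy hc) ha hb
    (κ := (ηlow + ηup) / 2 * ‖a - b‖ ^ 2)
    (K := (ηup - ηlow) / 2 * ‖a - b‖ ^ 2) (fun c hc => by
      have h1 := S.lower c hc (a - b)
      have h2 := S.upper c hc (a - b)
      rw [Real.norm_eq_abs, abs_le]
      constructor <;> linarith)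
  rw [Real.norm_eq_abs, abs_le] at this
  unfold relEntropy
  simp only [smul_eq_mul] at this
  constructor <;> linarith [this.1, this.2]

theorem entropy_symm (S : IsStateSet U f η q C Cf ηlow ηup) {b : Vec m} (hb : b ∈ C)
    (x y : Vec m) : fderiv ℝ (fderiv ℝ η) b x y = fderiv ℝ (fderiv ℝ η) b y x :=
  ((S.contDiffAt_entropy hb).isSymmSndFDerivAt (by simp)) x y

/-- Cauchy–Schwarz inequality for the positive definite form `D²η(b)`. -/
theorem abs_hessian_le (S : IsStateSet U f η q C Cf ηlow ηup) {b : Vec m} (hb : b ∈ C)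
    (x y : Vec m) : |fderiv ℝ (fderiv ℝ η) b x y| ≤ ηup * ‖x‖ * ‖y‖ := by
  set B := fderiv ℝ (fderiv ℝ η) b with hB
  have hs : B y x = B x y := S.entropy_symm hb y x
  have hpos : ∀ v, 0 ≤ B v v := fun v =>
    le_trans (mul_nonneg S.low_pos.le (sq_nonneg _)) (S.lower b hb v)
  have hcs : (B x y) ^ 2 ≤ B x x * B y y := by
    have h : ∀ r : ℝ, 0 ≤ B x x * (r * r) + (2 * B x y) * r + B y y := fun r => by
      have := hpos (r • x + y)
      simp only [map_add, map_smul, add_apply, smul_eq_mul, smul_apply, hs] at this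
      linarith
    have := discrim_le_zero h
    unfold discrim at this
    linarith
  have hx := S.upper b hb x
  have hy := S.upper b hb y
  apply abs_le_of_sq_le_sq
  · calc (B x y) ^ 2 ≤ B x x * B y y := hcs
      _ ≤ (ηup * ‖x‖ ^ 2) * (ηup * ‖y‖ ^ 2) :=
        mul_le_mul hx hy (hpos y) (mul_nonneg S.up_pos.le (sq_nonneg _))
      _ = _ := by ring
  · have := S.up_pos
    positivity

theorem norm_hessian_le (S : IsStateSet U f η q C Cf ηlow ηup) {b : Vec m} (hb : b ∈ C) :
    ‖fderiv ℝ (fderiv ℝ η) b‖ ≤ ηup := by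
  refine ContinuousLinearMap.opNorm_le_bound₂ _ S.up_pos.le fun x y => ?_
  simpa using S.abs_hessian_le hb x y

theorem lipschitzOn_fderiv_entropy (S : IsStateSet U f η q C Cf ηlow ηup) {a b : Vec m}
    (ha : a ∈ C) (hb : b ∈ C) : ‖fderiv ℝ η a - fderiv ℝ η b‖ ≤ ηup * ‖a - b‖ :=
  S.convex.norm_image_sub_le_of_norm_fderiv_le
    (fun _ hc => differentiableAt_fderiv (S.contDiffAt_entropy hc))
    (fun _ hc => S.norm_hessian_le hc) hb ha

/-- A function of class `C²` near the points of `C` has bounded first derivative on `C`. -/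
theorem exists_norm_fderiv_le {F : Type*} [NormedAddCommGroup F] [NormedSpace ℝ F]
    (S : IsStateSet U f η q C Cf ηlow ηup) {g : Vec m → F}
    (hg : ∀ c ∈ C, ContDiffAt ℝ 2 g c) : ∃ K : ℝ, 0 ≤ K ∧ ∀ c ∈ C, ‖fderiv ℝ g c‖ ≤ K := by
  have hc : ContinuousOn (fderiv ℝ g) C := fun c hc =>
    (differentiableAt_fderiv (hg c hc)).continuousAt.continuousWithinAt
  obtain ⟨K, hK⟩ := S.compact.exists_bound_of_continuousOn hc
  exact ⟨max K 0, le_max_right _ _, fun c hc => (hK c hc).trans (le_max_left _ _)⟩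

theorem exists_lipschitzOn {F : Type*} [NormedAddCommGroup F] [NormedSpace ℝ F]
    (S : IsStateSet U f η q C Cf ηlow ηup) {g : Vec m → F}
    (hg : ∀ c ∈ C, ContDiffAt ℝ 2 g c) :
    ∃ K : ℝ≥0, LipschitzOnWith K g C := by
  obtain ⟨K, hK0, hK⟩ := S.exists_norm_fderiv_le hg
  refine ⟨⟨K, hK0⟩, LipschitzOnWith.of_dist_le_mul fun a ha b hb => ?_⟩
  rw [dist_eq_norm, dist_eq_norm]
  exact S.convex.norm_image_sub_le_of_norm_fderiv_le
    (fun c hc => (hg c hc).differentiableAt (by norm_num)) hK hb ha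

/-- Finite speed of propagation: the flux of the relative entropy is quadratically small. -/
theorem exists_relEntropyFlux_le (S : IsStateSet U f η q C Cf ηlow ηup) :
    ∃ s : ℝ, 0 ≤ s ∧ ∀ a ∈ C, ∀ b ∈ C, |relEntropyFlux f η q a b| ≤ s * relEntropy η a b := by
  obtain ⟨K, hK0, hK⟩ := S.exists_norm_fderiv_le (fun c hc => S.contDiffAt_flux hc)
  have hup := S.up_pos
  have hlow := S.low_pos
  refine ⟨ηup * K * (2 / ηlow), by positivity, fun a ha b hb => ?_⟩
  have key : |relEntropyFlux f η q a b| ≤ ηup * K * ‖a - b‖ ^ 2 := by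
    have hseg : segment ℝ b a ⊆ C := S.convex.segment_subset hb ha
    have h1 := (convex_segment b a).norm_image_sub_le_of_norm_hasFDerivWithin_le
      (f := fun c => q c - fderiv ℝ η b (f c))
      (f' := fun c => fderiv ℝ q c - (fderiv ℝ η b).comp (fderiv ℝ f c))
      (C := ηup * K * ‖a - b‖) (x := b) (y := a) ?_ ?_ (left_mem_segment ℝ b a)
      (right_mem_segment ℝ b a)
    · rw [Real.norm_eq_abs] at h1
      have e : relEntropyFlux f η q a b
          = q a - fderiv ℝ η b (f a) - (q b - fderiv ℝ η b (f b)) := by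
        unfold relEntropyFlux
        rw [map_sub]
        ring
      rw [e]
      linarith
    · intro c hc
      have hc' := hseg hc
      have hq := ((S.contDiffAt_entropyFlux hc').differentiableAt (by norm_num)).hasFDerivAt
      have hf := ((S.contDiffAt_flux hc').differentiableAt (by norm_num)).hasFDerivAt
      exact (hq.sub ((fderiv ℝ η b).hasFDerivAt.comp c hf)).hasFDerivWithinAt
    · intro c hc
      have hc' := hseg hc
      rw [← S.entropyPair.compatible c (S.subset hc'), ← ContinuousLinearMap.sub_comp]
      have hcb : ‖c - b‖ ≤ ‖a - b‖ := by
        obtain ⟨θ, hθ, rfl⟩ := (segment_eq_image' ℝ b a ▸ hc :)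
        rw [add_sub_cancel_left, norm_smul, Real.norm_eq_abs, abs_of_nonneg hθ.1]
        exact mul_le_of_le_one_left (norm_nonneg _) hθ.2
      calc _ ≤ ‖fderiv ℝ η c - fderiv ℝ η b‖ * ‖fderiv ℝ f c‖ :=
            ContinuousLinearMap.opNorm_comp_le _ _
        _ ≤ (ηup * ‖c - b‖) * K := by
            gcongr
            · exact S.lipschitzOn_fderiv_entropy hc' hb
            · exact hK c hc'
        _ ≤ (ηup * ‖a - b‖) * K := by gcongr
        _ = _ := by ring
  have h2 := (S.relEntropy_bounds ha hb).1
  calc _ ≤ ηup * K * ‖a - b‖ ^ 2 := key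
    _ = ηup * K * (2 / ηlow) * (ηlow / 2 * ‖a - b‖ ^ 2) := by field_simp
    _ ≤ _ := by gcongr

/-- Compatibility of the entropy with the flux: the Jacobian `Df(b)` is symmetric with respect to
the form `D²η(b)`.  It follows from the symmetry of the second derivatives of `f` and `q` by
differentiating `Dη Df = Dq`. -/
theorem hessian_flux_symm (S : IsStateSet U f η q C Cf ηlow ηup) {b : Vec m} (hb : b ∈ C)
    (x y : Vec m) : fderiv ℝ (fderiv ℝ η) b (fderiv ℝ f b x) y
      = fderiv ℝ (fderiv ℝ η) b x (fderiv ℝ f b y) := by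
  have hη := (differentiableAt_fderiv (S.contDiffAt_entropy hb)).hasFDerivAt
  have hf := (differentiableAt_fderiv (S.contDiffAt_flux hb)).hasFDerivAt
  have hq := (differentiableAt_fderiv (S.contDiffAt_entropyFlux hb)).hasFDerivAt
  have heq : fderiv ℝ q =ᶠ[nhds b] fun a => (fderiv ℝ η a).comp (fderiv ℝ f a) := by
    filter_upwards [S.isOpen.mem_nhds (S.subset hb)] with a ha
    exact (S.entropyPair.compatible a ha).symm
  have hu := hq.unique ((hη.clm_comp hf).congr_of_eventuallyEq heq)
  have e : ∀ x y, fderiv ℝ (fderiv ℝ q) b x y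
      = fderiv ℝ η b (fderiv ℝ (fderiv ℝ f) b x y)
        + fderiv ℝ (fderiv ℝ η) b x (fderiv ℝ f b y) := fun x y => by
    rw [hu]
    simp
  have hqs := ((S.contDiffAt_entropyFlux hb).isSymmSndFDerivAt (by simp)) x y
  have hfs := ((S.contDiffAt_flux hb).isSymmSndFDerivAt (by simp)) x y
  rw [e, e, hfs] at hqs
  rw [S.entropy_symm hb (fderiv ℝ f b x) y]
  linarith

end IsStateSet

/-! ### Partial derivatives of Lipschitz functions and test functions on the strip -/

/-- The partial derivative `∂ₜ g` at `p = (t, x)`. -/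
abbrev timeDeriv {F : Type*} [NormedAddCommGroup F] [NormedSpace ℝ F] (g : ℝ → ℝ → F)
    (p : ℝ × ℝ) : F := deriv (fun s => g s p.2) p.1

/-- The partial derivative `∂ₓ g` at `p = (t, x)`. -/
abbrev spaceDeriv {F : Type*} [NormedAddCommGroup F] [NormedSpace ℝ F] (g : ℝ → ℝ → F)
    (p : ℝ × ℝ) : F := deriv (fun z => g p.1 z) p.2

section PartialDerivatives

variable {F : Type*} [NormedAddCommGroup F] {g : ℝ → ℝ → F}

theorem lipschitzWith_time {L : ℝ≥0} (h : LipschitzWith L (fun p : ℝ × ℝ => g p.1 p.2)) (x : ℝ) :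
    LipschitzWith L (fun s => g s x) := by
  have := h.comp (LipschitzWith.of_dist_le_mul (K := 1) (f := fun s : ℝ => ((s, x) : ℝ × ℝ))
    (fun a b => by simp [Prod.dist_eq]))
  rwa [mul_one] at this

theorem lipschitzWith_space {L : ℝ≥0} (h : LipschitzWith L (fun p : ℝ × ℝ => g p.1 p.2))
    (t : ℝ) : LipschitzWith L (fun z => g t z) := by
  have := h.comp (LipschitzWith.of_dist_le_mul (K := 1) (f := fun z : ℝ => ((t, z) : ℝ × ℝ))
    (fun a b => by simp [Prod.dist_eq]))
  rwa [mul_one] at this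

variable [NormedSpace ℝ F]

theorem hasDerivAt_timeDeriv {p : ℝ × ℝ}
    (h : DifferentiableAt ℝ (fun p : ℝ × ℝ => g p.1 p.2) p) :
    HasDerivAt (fun s => g s p.2) (timeDeriv g p) p.1 := by
  have h1 : DifferentiableAt ℝ (fun s : ℝ => ((s, p.2) : ℝ × ℝ)) p.1 := by fun_prop
  exact (DifferentiableAt.comp (g := fun p : ℝ × ℝ => g p.1 p.2) p.1 h h1).hasDerivAt

theorem hasDerivAt_spaceDeriv {p : ℝ × ℝ}
    (h : DifferentiableAt ℝ (fun p : ℝ × ℝ => g p.1 p.2) p) :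
    HasDerivAt (fun z => g p.1 z) (spaceDeriv g p) p.2 := by
  have h1 : DifferentiableAt ℝ (fun z : ℝ => ((p.1, z) : ℝ × ℝ)) p.2 := by fun_prop
  exact (DifferentiableAt.comp (g := fun p : ℝ × ℝ => g p.1 p.2) p.2 h h1).hasDerivAt

theorem norm_timeDeriv_le {L : ℝ≥0} (h : LipschitzWith L (fun p : ℝ × ℝ => g p.1 p.2))
    (p : ℝ × ℝ) : ‖timeDeriv g p‖ ≤ L :=
  norm_deriv_le_of_lipschitz (lipschitzWith_time h p.2)

theorem norm_spaceDeriv_le {L : ℝ≥0} (h : LipschitzWith L (fun p : ℝ × ℝ => g p.1 p.2))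
    (p : ℝ × ℝ) : ‖spaceDeriv g p‖ ≤ L :=
  norm_deriv_le_of_lipschitz (lipschitzWith_space h p.1)

theorem measurable_timeDeriv [CompleteSpace F] [MeasurableSpace F] [BorelSpace F]
    (h : Continuous (fun p : ℝ × ℝ => g p.1 p.2)) : Measurable (timeDeriv g) := by
  have := measurable_deriv_with_param (f := fun x s => g s x)
    (by exact h.comp continuous_swap)
  exact this.comp measurable_swap

theorem measurable_spaceDeriv [CompleteSpace F] [MeasurableSpace F] [BorelSpace F]
    (h : Continuous (fun p : ℝ × ℝ => g p.1 p.2)) : Measurable (spaceDeriv g) :=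
  measurable_deriv_with_param (f := fun s x => g s x) h

theorem timeDeriv_eq_zero {p : ℝ × ℝ} (hp : p ∉ tsupport (fun p : ℝ × ℝ => g p.1 p.2)) :
    timeDeriv g p = 0 := by
  have h := notMem_tsupport_iff_eventuallyEq.1 hp
  have hc : ContinuousAt (fun s : ℝ => ((s, p.2) : ℝ × ℝ)) p.1 := by fun_prop
  have h2 : (fun s => g s p.2) =ᶠ[nhds p.1] fun _ => 0 := hc.eventually h
  rw [timeDeriv, h2.deriv_eq, deriv_const]

theorem spaceDeriv_eq_zero {p : ℝ × ℝ} (hp : p ∉ tsupport (fun p : ℝ × ℝ => g p.1 p.2)) :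
    spaceDeriv g p = 0 := by
  have h := notMem_tsupport_iff_eventuallyEq.1 hp
  have hc : ContinuousAt (fun z : ℝ => ((p.1, z) : ℝ × ℝ)) p.2 := by fun_prop
  have h2 : (fun z => g p.1 z) =ᶠ[nhds p.2] fun _ => 0 := hc.eventually h
  rw [spaceDeriv, h2.deriv_eq, deriv_const]

end PartialDerivatives

theorem lipschitzWith_mul_of_bounded {α : Type*} [PseudoMetricSpace α] {g h : α → ℝ} {K L : ℝ≥0}
    (hg : LipschitzWith K g) (hh : LipschitzWith L h) {A B : ℝ≥0} (hA : ∀ a, |g a| ≤ A)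
    (hB : ∀ a, |h a| ≤ B) : LipschitzWith (A * L + B * K) (fun a => g a * h a) := by
  refine LipschitzWith.of_dist_le_mul fun a b => ?_
  have h1 := hg.dist_le_mul a b
  have h2 := hh.dist_le_mul a b
  rw [Real.dist_eq] at h1 h2 ⊢
  calc |g a * h a - g b * h b| = |g a * (h a - h b) + h b * (g a - g b)| := by ring_nf
    _ ≤ |g a| * |h a - h b| + |h b| * |g a - g b| := by
      rw [← abs_mul, ← abs_mul]
      exact abs_add_le _ _
    _ ≤ A * (L * dist a b) + B * (K * dist a b) := by
      gcongr
      · exact hA a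
      · exact hB b
    _ = _ := by
      push_cast
      ring

theorem restrict_strip (T : ℝ) : (volume : Measure (ℝ × ℝ)).restrict (strip T)
    = (volume.restrict (Ioo 0 T)).prod volume := by
  rw [strip, Measure.volume_eq_prod, ← Measure.prod_restrict, Measure.restrict_univ]

namespace IsTestFunction

variable {T : ℝ} {φ : ℝ → ℝ → ℝ}

theorem continuous (h : IsTestFunction T φ) : Continuous (fun p : ℝ × ℝ => φ p.1 p.2) :=
  h.lipschitz.choose_spec.continuous

theorem exists_abs_le (h : IsTestFunction T φ) : ∃ A : ℝ≥0, ∀ p : ℝ × ℝ, |φ p.1 p.2| ≤ A := by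
  obtain ⟨A, hA⟩ := h.compact.exists_bound_of_continuous h.continuous
  exact ⟨⟨max A 0, le_max_right _ _⟩, fun p => (hA p).trans (le_max_left _ _)⟩

theorem mul (h : IsTestFunction T φ) {g : ℝ → ℝ → ℝ} {K B : ℝ≥0}
    (hg : LipschitzWith K (fun p : ℝ × ℝ => g p.1 p.2)) (hB : ∀ t x, |g t x| ≤ B) :
    IsTestFunction T (fun t x => φ t x * g t x) := by
  obtain ⟨L, hL⟩ := h.lipschitz
  obtain ⟨A, hA⟩ := h.exists_abs_le
  exact ⟨⟨_, lipschitzWith_mul_of_bounded hL hg hA fun p => hB p.1 p.2⟩, h.compact.mul_right,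
    (tsupport_mul_subset_left).trans h.support⟩

theorem exists_radius (h : IsTestFunction T φ) :
    ∃ r : ℝ, 0 ≤ r ∧ ∀ t x, r < |x| → φ t x = 0 := by
  obtain ⟨r, hr⟩ := h.compact.isBounded.subset_closedBall 0
  refine ⟨max r 0, le_max_right _ _, fun t x hx => ?_⟩
  by_contra hne
  have := hr (subset_tsupport _ (show (t, x) ∈ Function.support _ from hne))
  rw [mem_closedBall_zero_iff, Prod.norm_def, Real.norm_eq_abs, Real.norm_eq_abs] at this
  exact absurd ((le_max_right _ _).trans this) (not_le.2 ((le_max_left _ _).trans_lt hx))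

theorem eq_zero_of_le (h : IsTestFunction T φ) {t : ℝ} (ht : T ≤ t) (x : ℝ) : φ t x = 0 := by
  by_contra hne
  have := (h.support (subset_tsupport _ (show (t, x) ∈ Function.support _ from hne))).1
  exact absurd this (not_lt.2 ht)

theorem hasCompactSupport_slice (h : IsTestFunction T φ) (t : ℝ) :
    HasCompactSupport (fun x => φ t x) := by
  obtain ⟨r, -, hr⟩ := h.exists_radius
  refine HasCompactSupport.intro (isCompact_Icc (a := -r) (b := r)) fun x hx => hr t x ?_
  by_contra hle
  exact hx (abs_le.1 (not_lt.1 hle))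

theorem continuous_slice (h : IsTestFunction T φ) (t : ℝ) : Continuous (fun x => φ t x) :=
  h.continuous.comp (by fun_prop : Continuous fun x : ℝ => ((t, x) : ℝ × ℝ))

theorem integrable_of_bounded (h : IsTestFunction T φ) {b : ℝ × ℝ → ℝ} (hb : Measurable b) {L : ℝ}
    (hL : ∀ p, |b p| ≤ L) (h0 : ∀ p ∉ tsupport (fun p : ℝ × ℝ => φ p.1 p.2), b p = 0) :
    Integrable b := by
  have hs : Function.support b ⊆ tsupport (fun p : ℝ × ℝ => φ p.1 p.2) := fun p hp => by
    by_contra hne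
    exact hp (h0 p hne)
  rw [← integrableOn_iff_integrable_of_support_subset hs]
  exact Measure.integrableOn_of_bounded h.compact.measure_lt_top.ne hb.aestronglyMeasurable
    (Filter.Eventually.of_forall hL)

theorem integrable_timeDeriv (h : IsTestFunction T φ) : Integrable (timeDeriv φ) := by
  obtain ⟨L, hL⟩ := h.lipschitz
  exact h.integrable_of_bounded (measurable_timeDeriv h.continuous) (norm_timeDeriv_le hL)
    fun p hp => timeDeriv_eq_zero hp

theorem integrable_spaceDeriv (h : IsTestFunction T φ) : Integrable (spaceDeriv φ) := by
  obtain ⟨L, hL⟩ := h.lipschitz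
  exact h.integrable_of_bounded (measurable_spaceDeriv h.continuous) (norm_spaceDeriv_le hL)
    fun p hp => spaceDeriv_eq_zero hp

end IsTestFunction

theorem integrable_smul_of_ae_bounded {α F : Type*} [MeasurableSpace α] [NormedAddCommGroup F]
    [NormedSpace ℝ F] {μ : Measure α} {b : α → ℝ} {g : α → F} (hb : Integrable b μ)
    (hg : AEStronglyMeasurable g μ) {B : ℝ} (hB : ∀ᵐ a ∂μ, ‖g a‖ ≤ B) :
    Integrable (fun a => b a • g a) μ := by
  refine (hb.norm.mul_const B).mono' (hb.1.smul hg) ?_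
  filter_upwards [hB] with a ha
  rw [norm_smul]
  gcongr

theorem integral_deriv_of_lipschitz {g : ℝ → ℝ} {L : ℝ≥0} (hg : LipschitzWith L g) (a b : ℝ) :
    ∫ s in a..b, deriv g s = g b - g a :=
  (hg.lipschitzOnWith.absolutelyContinuousOnInterval).integral_deriv_eq_sub

theorem IsTestFunction.setIntegral_timeDeriv {T : ℝ} (hT : 0 < T) {φ : ℝ → ℝ → ℝ}
    (h : IsTestFunction T φ) : ∫ p in strip T, timeDeriv φ p = -∫ x, φ 0 x := by
  obtain ⟨L, hL⟩ := h.lipschitz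
  have hi : Integrable (timeDeriv φ) (volume.restrict (strip T)) := h.integrable_timeDeriv.restrict
  rw [restrict_strip] at hi ⊢
  rw [integral_prod_symm _ hi, ← integral_neg]
  congr 1
  ext x
  have := integral_deriv_of_lipschitz (lipschitzWith_time hL x) 0 T
  rw [intervalIntegral.integral_of_le hT.le, integral_Ioc_eq_integral_Ioo] at this
  rw [show (fun t => timeDeriv φ (t, x)) = deriv (fun s => φ s x) from rfl, this,
    h.eq_zero_of_le le_rfl]
  ring

theorem IsTestFunction.setIntegral_spaceDeriv {T : ℝ} {φ : ℝ → ℝ → ℝ}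
    (h : IsTestFunction T φ) : ∫ p in strip T, spaceDeriv φ p = 0 := by
  obtain ⟨L, hL⟩ := h.lipschitz
  obtain ⟨r, hr0, hr⟩ := h.exists_radius
  have hi : Integrable (spaceDeriv φ) (volume.restrict (strip T)) :=
    h.integrable_spaceDeriv.restrict
  rw [restrict_strip] at hi ⊢
  rw [integral_prod _ hi]
  refine integral_eq_zero_of_ae (Filter.Eventually.of_forall fun t => ?_)
  have h1 := integral_deriv_of_lipschitz (lipschitzWith_space hL t) (-(r + 1)) (r + 1)
  rw [intervalIntegral.integral_of_le (by linarith), hr t (r + 1) (lt_abs.2 (by simp)),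
    hr t (-(r + 1)) (by rw [abs_neg]; exact lt_abs.2 (by simp)), sub_zero] at h1
  change ∫ x, deriv (fun z => φ t z) x = 0
  rw [← h1]
  symm
  refine setIntegral_eq_integral_of_forall_compl_eq_zero fun x hx => ?_
  refine spaceDeriv_eq_zero (g := φ) (p := (t, x)) ?_
  rw [notMem_tsupport_iff_eventuallyEq]
  have hx' : r < |x| := by
    by_contra hle
    obtain ⟨h1, h2⟩ := abs_le.1 (not_lt.1 hle)
    exact hx ⟨by linarith, by linarith⟩
  have : ∀ᶠ p : ℝ × ℝ in nhds (t, x), r < |p.2| :=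
    (continuous_snd.abs.tendsto (t, x)).eventually (lt_mem_nhds hx')
  filter_upwards [this] with p hp
  exact hr _ _ hp

/-! ### The relative entropy inequality -/

namespace IsStateSet

variable {m : ℕ} {U : Set (Vec m)} {f : Vec m → Vec m} {η q : Vec m → ℝ} {C : Set (Vec m)}
  {Cf ηlow ηup : ℝ}

/-- Lipschitz continuity and boundedness of a composition `G ∘ v`, where `v` is Lipschitz with
values in `C` and `G` is Lipschitz on `C`. -/
theorem comp_lipschitz (S : IsStateSet U f η q C Cf ηlow ηup) {v : ℝ → ℝ → Vec m} {L : ℝ≥0}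
    (hv : LipschitzWith L (fun p : ℝ × ℝ => v p.1 p.2)) (hvC : ∀ t x, v t x ∈ C) {G : Vec m → ℝ}
    {K : ℝ≥0} (hG : LipschitzOnWith K G C) :
    ∃ K' B : ℝ≥0, LipschitzWith K' (fun p : ℝ × ℝ => G (v p.1 p.2)) ∧
      ∀ t x, |G (v t x)| ≤ B := by
  obtain ⟨B, hB⟩ := S.compact.exists_bound_of_continuousOn hG.continuousOn
  refine ⟨K * L, ⟨max B 0, le_max_right _ _⟩, ?_, fun t x =>
    (hB _ (hvC t x)).trans (le_max_left _ _)⟩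
  rw [← lipschitzOnWith_univ] at hv ⊢
  exact hG.comp hv fun p _ => hvC p.1 p.2

theorem exists_lipschitzOn_mul (S : IsStateSet U f η q C Cf ηlow ηup) {G H : Vec m → ℝ}
    (hG : ∃ K : ℝ≥0, LipschitzOnWith K G C) (hH : ∃ K : ℝ≥0, LipschitzOnWith K H C) :
    ∃ K : ℝ≥0, LipschitzOnWith K (fun a => G a * H a) C := by
  obtain ⟨K, hK⟩ := hG
  obtain ⟨L, hL⟩ := hH
  obtain ⟨A, hA⟩ := S.compact.exists_bound_of_continuousOn hK.continuousOn
  obtain ⟨B, hB⟩ := S.compact.exists_bound_of_continuousOn hL.continuousOn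
  rw [lipschitzOnWith_iff_restrict] at hK hL
  exact ⟨_, lipschitzOnWith_iff_restrict.2 (lipschitzWith_mul_of_bounded hK hL
    (A := ⟨max A 0, le_max_right _ _⟩) (B := ⟨max B 0, le_max_right _ _⟩)
    (fun a => (hA a a.2).trans (le_max_left _ _)) (fun a => (hB a a.2).trans (le_max_left _ _)))⟩

theorem exists_lipschitzOn_fderiv_apply (S : IsStateSet U f η q C Cf ηlow ηup) (e : Vec m) :
    ∃ K : ℝ≥0, LipschitzOnWith K (fun a => fderiv ℝ η a e) C := by
  have := S.up_pos
  refine ⟨⟨ηup * ‖e‖, by positivity⟩, LipschitzOnWith.of_dist_le_mul fun a ha b hb => ?_⟩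
  rw [Real.dist_eq, dist_eq_norm, ← sub_apply]
  calc _ ≤ ‖fderiv ℝ η a - fderiv ℝ η b‖ * ‖e‖ := ContinuousLinearMap.le_opNorm _ _
    _ ≤ ηup * ‖a - b‖ * ‖e‖ := by
      gcongr
      exact S.lipschitzOn_fderiv_entropy ha hb
    _ = ηup * ‖e‖ * ‖a - b‖ := by ring

end IsStateSet

/-- A functional on `ℝ^m` in coordinates. -/
theorem sum_apply_single {m : ℕ} (l : Vec m →L[ℝ] ℝ) (a : Vec m) :
    ∑ i, l (EuclideanSpace.single i 1) * a i = l a := by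
  have h : a = ∑ i, a i • EuclideanSpace.single i (1 : ℝ) := by
    ext j
    simp [Pi.single_apply]
  conv_rhs => rw [h]
  rw [map_sum]
  simp [mul_comm]

namespace IsStateSet

variable {m : ℕ} {U : Set (Vec m)} {f : Vec m → Vec m} {η q : Vec m → ℝ} {C : Set (Vec m)}
  {Cf ηlow ηup : ℝ}

theorem exists_lipschitzOn_fderiv_comp (S : IsStateSet U f η q C Cf ηlow ηup)
    {G : Vec m → Vec m} (hG : ∃ K : ℝ≥0, LipschitzOnWith K G C) :
    ∃ K : ℝ≥0, LipschitzOnWith K (fun a => fderiv ℝ η a (G a)) C := by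
  have h1 : ∀ i, ∃ K : ℝ≥0, LipschitzOnWith K
      (fun a => fderiv ℝ η a (EuclideanSpace.single i 1) * G a i) C := fun i => by
    obtain ⟨K, hK⟩ := hG
    refine S.exists_lipschitzOn_mul (S.exists_lipschitzOn_fderiv_apply _) ⟨K, ?_⟩
    refine LipschitzOnWith.of_dist_le_mul fun a ha b hb => le_trans ?_ (hK.dist_le_mul a ha b hb)
    rw [dist_eq_norm, dist_eq_norm]
    exact PiLp.norm_apply_le (G a - G b) i
  choose K hK using h1
  refine ⟨∑ i, K i, LipschitzOnWith.of_dist_le_mul fun a ha b hb => ?_⟩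
  simp_rw [← sum_apply_single (fderiv ℝ η _) (G _)]
  refine (dist_sum_sum_le _ _ _).trans ?_
  rw [NNReal.coe_sum, Finset.sum_mul]
  exact Finset.sum_le_sum fun i _ => (hK i).dist_le_mul a ha b hb

/-- Derivative of `θ (h ∘ γ - Dη(γ) g(γ))` along a curve `γ`, for pairs `(g, h)` with
`Dh = Dη Dg`, such as `(id, η)` and `(f, q)`. -/
theorem hasDerivAt_mul_sub (S : IsStateSet U f η q C Cf ηlow ηup) {γ : ℝ → Vec m} {θ : ℝ → ℝ}
    {t a : ℝ} {w : Vec m} (hγ : HasDerivAt γ w t) (hθ : HasDerivAt θ a t) (hC : γ t ∈ C)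
    {g : Vec m → Vec m} {h : Vec m → ℝ} {g' : Vec m →L[ℝ] Vec m} (hg : HasFDerivAt g g' (γ t))
    (hh : HasFDerivAt h ((fderiv ℝ η (γ t)).comp g') (γ t)) :
    HasDerivAt (fun s => θ s * (h (γ s) - fderiv ℝ η (γ s) (g (γ s))))
      (a * (h (γ t) - fderiv ℝ η (γ t) (g (γ t)))
        - θ t * fderiv ℝ (fderiv ℝ η) (γ t) w (g (γ t))) t := by
  have h1 := (differentiableAt_fderiv (S.contDiffAt_entropy hC)).hasFDerivAt.comp_hasDerivAt t hγ
  have h2 := hg.comp_hasDerivAt t hγ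
  have h3 := hh.comp_hasDerivAt t hγ
  refine (hθ.mul (h3.fun_sub (h1.clm_apply h2))).congr_deriv ?_
  simp only [Function.comp_apply, ContinuousLinearMap.comp_apply]
  ring

theorem hasDerivAt_mul_fderiv (S : IsStateSet U f η q C Cf ηlow ηup) {γ : ℝ → Vec m} {θ : ℝ → ℝ}
    {t a : ℝ} {w : Vec m} (hγ : HasDerivAt γ w t) (hθ : HasDerivAt θ a t) (hC : γ t ∈ C)
    (e : Vec m) :
    HasDerivAt (fun s => θ s * fderiv ℝ η (γ s) e)
      (a * fderiv ℝ η (γ t) e + θ t * fderiv ℝ (fderiv ℝ η) (γ t) w e) t := by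
  have h1 := (differentiableAt_fderiv (S.contDiffAt_entropy hC)).hasFDerivAt.comp_hasDerivAt t hγ
  refine (hθ.mul (h1.clm_apply (hasDerivAt_const t e))).congr_deriv ?_
  simp

theorem hasDerivAt_mul_entropy (S : IsStateSet U f η q C Cf ηlow ηup) {γ : ℝ → Vec m}
    {θ : ℝ → ℝ} {t a : ℝ} {w : Vec m} (hγ : HasDerivAt γ w t) (hθ : HasDerivAt θ a t)
    (hC : γ t ∈ C) :
    HasDerivAt (fun s => θ s * (η (γ s) - fderiv ℝ η (γ s) (γ s)))
      (a * (η (γ t) - fderiv ℝ η (γ t) (γ t)) - θ t * fderiv ℝ (fderiv ℝ η) (γ t) w (γ t)) t :=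
  S.hasDerivAt_mul_sub hγ hθ hC (g := id) (hasFDerivAt_id _)
    (((S.contDiffAt_entropy hC).differentiableAt (by norm_num)).hasFDerivAt)

theorem hasDerivAt_mul_entropyFlux (S : IsStateSet U f η q C Cf ηlow ηup) {γ : ℝ → Vec m}
    {θ : ℝ → ℝ} {t a : ℝ} {w : Vec m} (hγ : HasDerivAt γ w t) (hθ : HasDerivAt θ a t)
    (hC : γ t ∈ C) :
    HasDerivAt (fun s => θ s * (q (γ s) - fderiv ℝ η (γ s) (f (γ s))))
      (a * (q (γ t) - fderiv ℝ η (γ t) (f (γ t)))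
        - θ t * fderiv ℝ (fderiv ℝ η) (γ t) w (f (γ t))) t := by
  refine S.hasDerivAt_mul_sub hγ hθ hC
    ((S.contDiffAt_flux hC).differentiableAt (by norm_num)).hasFDerivAt ?_
  rw [S.entropyPair.compatible _ (S.subset hC)]
  exact ((S.contDiffAt_entropyFlux hC).differentiableAt (by norm_num)).hasFDerivAt

end IsStateSet

section RelativeEntropyInequality

variable {m : ℕ} {U : Set (Vec m)} {f : Vec m → Vec m} {η q : Vec m → ℝ} {C : Set (Vec m)}
  {Cf ηlow ηup T : ℝ} {u₀ : ℝ → Vec m} {u : ℝ → ℝ → Vec m}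

theorem strip_subset (T : ℝ) : strip T ⊆ Ico 0 T ×ˢ univ :=
  prod_mono Ioo_subset_Ico_self subset_rfl

namespace IsEntropySolution

theorem aestronglyMeasurable (hu : IsEntropySolution U f η q T u₀ u) :
    AEStronglyMeasurable (fun p : ℝ × ℝ => u p.1 p.2) (volume.restrict (strip T)) :=
  hu.locInt.aestronglyMeasurable.mono_measure (Measure.restrict_mono (strip_subset T) le_rfl)

theorem aestronglyMeasurable_flux (hu : IsEntropySolution U f η q T u₀ u) :
    AEStronglyMeasurable (fun p : ℝ × ℝ => f (u p.1 p.2)) (volume.restrict (strip T)) :=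
  hu.locInt_flux.aestronglyMeasurable.mono_measure (Measure.restrict_mono (strip_subset T) le_rfl)

theorem aestronglyMeasurable_entropy (hu : IsEntropySolution U f η q T u₀ u) :
    AEStronglyMeasurable (fun p : ℝ × ℝ => η (u p.1 p.2)) (volume.restrict (strip T)) :=
  hu.locInt_entropy.aestronglyMeasurable.mono_measure
    (Measure.restrict_mono (strip_subset T) le_rfl)

theorem aestronglyMeasurable_entropyFlux (hu : IsEntropySolution U f η q T u₀ u) :
    AEStronglyMeasurable (fun p : ℝ × ℝ => q (u p.1 p.2)) (volume.restrict (strip T)) :=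
  hu.locInt_entropyFlux.aestronglyMeasurable.mono_measure
    (Measure.restrict_mono (strip_subset T) le_rfl)

end IsEntropySolution

theorem ae_bounded_comp {α F : Type*} [MeasurableSpace α] [NormedAddCommGroup F]
    [NormedSpace ℝ F] {μ : Measure α} (S : IsStateSet U f η q C Cf ηlow ηup) {g : Vec m → F}
    (hg : ContinuousOn g C) {w : α → Vec m} (hw : ∀ᵐ a ∂μ, w a ∈ C) :
    ∃ B : ℝ, ∀ᵐ a ∂μ, ‖g (w a)‖ ≤ B := by
  obtain ⟨B, hB⟩ := S.compact.exists_bound_of_continuousOn hg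
  exact ⟨B, hw.mono fun a ha => hB _ ha⟩

variable {v : ℝ → ℝ → Vec m} {L : ℝ≥0} {φ : ℝ → ℝ → ℝ}

/-- The weak formulation tested with the covector field `φ Dη(v)`. -/
theorem IsEntropySolution.weak_covector (S : IsStateSet U f η q C Cf ηlow ηup)
    (hu : IsEntropySolution U f η q T u₀ u)
    (huC : ∀ᵐ p ∂(volume.restrict (strip T)), u p.1 p.2 ∈ C) (hu₀C : ∀ᵐ x, u₀ x ∈ C)
    (hv : LipschitzWith L (fun p : ℝ × ℝ => v p.1 p.2)) (hvC : ∀ t x, v t x ∈ C)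
    (hφ : IsTestFunction T φ) :
    Integrable (fun p : ℝ × ℝ =>
        timeDeriv φ p * fderiv ℝ η (v p.1 p.2) (u p.1 p.2)
          + φ p.1 p.2 * fderiv ℝ (fderiv ℝ η) (v p.1 p.2) (timeDeriv v p) (u p.1 p.2)
          + (spaceDeriv φ p * fderiv ℝ η (v p.1 p.2) (f (u p.1 p.2))
          + φ p.1 p.2 * fderiv ℝ (fderiv ℝ η) (v p.1 p.2) (spaceDeriv v p) (f (u p.1 p.2))))
        (volume.restrict (strip T)) ∧
    Integrable (fun x => φ 0 x * fderiv ℝ η (v 0 x) (u₀ x)) ∧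
    (∫ p in strip T,
        (timeDeriv φ p * fderiv ℝ η (v p.1 p.2) (u p.1 p.2)
          + φ p.1 p.2 * fderiv ℝ (fderiv ℝ η) (v p.1 p.2) (timeDeriv v p) (u p.1 p.2)
          + (spaceDeriv φ p * fderiv ℝ η (v p.1 p.2) (f (u p.1 p.2))
          + φ p.1 p.2 * fderiv ℝ (fderiv ℝ η) (v p.1 p.2) (spaceDeriv v p) (f (u p.1 p.2)))))
      + ∫ x, φ 0 x * fderiv ℝ η (v 0 x) (u₀ x) = 0 := by
  obtain ⟨Lφ, hLφ⟩ := hφ.lipschitz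
  set e : Fin m → Vec m := fun i => EuclideanSpace.single i 1 with he
  set Φ : Fin m → ℝ → ℝ → ℝ := fun i t x => φ t x * fderiv ℝ η (v t x) (e i) with hΦdef
  have hΦ : ∀ i, IsTestFunction T (Φ i) := fun i => by
    obtain ⟨K, hK⟩ := S.exists_lipschitzOn_fderiv_apply (e i)
    obtain ⟨K', B, hK', hB⟩ := S.comp_lipschitz hv hvC hK
    exact hφ.mul hK' hB
  obtain ⟨B₁, hB₁⟩ := ae_bounded_comp S (g := id) continuousOn_id huC
  obtain ⟨B₂, hB₂⟩ := ae_bounded_comp S (g := f)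
    (fun c hc => (S.contDiffAt_flux hc).continuousAt.continuousWithinAt) huC
  obtain ⟨B₃, hB₃⟩ := ae_bounded_comp S (g := id) continuousOn_id hu₀C
  have hi₁ : ∀ i, Integrable (fun p : ℝ × ℝ => timeDeriv (Φ i) p • u p.1 p.2
      + spaceDeriv (Φ i) p • f (u p.1 p.2)) (volume.restrict (strip T)) := fun i =>
    (integrable_smul_of_ae_bounded (hΦ i).integrable_timeDeriv.restrict
      hu.aestronglyMeasurable hB₁).add
    (integrable_smul_of_ae_bounded (hΦ i).integrable_spaceDeriv.restrict
      hu.aestronglyMeasurable_flux hB₂)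
  have hi₂ : ∀ i, Integrable (fun x => Φ i 0 x • u₀ x) := fun i =>
    integrable_smul_of_ae_bounded (((hΦ i).continuous_slice 0).integrable_of_hasCompactSupport
      ((hΦ i).hasCompactSupport_slice 0)) hu.locInt_init.aestronglyMeasurable hB₃
  have hpr : ∀ (i : Fin m) (a : Vec m), EuclideanSpace.proj (𝕜 := ℝ) i a = a i := fun _ _ => rfl
  have hj₁ : ∀ i, Integrable (fun p : ℝ × ℝ => timeDeriv (Φ i) p * u p.1 p.2 i
      + spaceDeriv (Φ i) p * f (u p.1 p.2) i) (volume.restrict (strip T)) := fun i => by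
    simpa [hpr] using (EuclideanSpace.proj (𝕜 := ℝ) i).integrable_comp (hi₁ i)
  have hj₂ : ∀ i, Integrable (fun x => Φ i 0 x * u₀ x i) := fun i => by
    simpa [hpr] using (EuclideanSpace.proj (𝕜 := ℝ) i).integrable_comp (hi₂ i)
  have hw : ∀ i, (∫ p in strip T, (timeDeriv (Φ i) p * u p.1 p.2 i
      + spaceDeriv (Φ i) p * f (u p.1 p.2) i)) + ∫ x, Φ i 0 x * u₀ x i = 0 := fun i => by
    have h1 := congrArg (EuclideanSpace.proj (𝕜 := ℝ) i) (hu.weak (Φ i) (hΦ i))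
    rw [map_add, ← ContinuousLinearMap.integral_comp_comm _ (hi₁ i),
      ← ContinuousLinearMap.integral_comp_comm _ (hi₂ i), map_zero] at h1
    simpa [hpr] using h1
  have hae : (fun p : ℝ × ℝ => ∑ i, (timeDeriv (Φ i) p * u p.1 p.2 i
      + spaceDeriv (Φ i) p * f (u p.1 p.2) i)) =ᵐ[volume.restrict (strip T)] fun p : ℝ × ℝ =>
        timeDeriv φ p * fderiv ℝ η (v p.1 p.2) (u p.1 p.2)
          + φ p.1 p.2 * fderiv ℝ (fderiv ℝ η) (v p.1 p.2) (timeDeriv v p) (u p.1 p.2)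
          + (spaceDeriv φ p * fderiv ℝ η (v p.1 p.2) (f (u p.1 p.2))
          + φ p.1 p.2 * fderiv ℝ (fderiv ℝ η) (v p.1 p.2) (spaceDeriv v p) (f (u p.1 p.2))) := by
    refine ae_restrict_of_ae ?_
    filter_upwards [hLφ.ae_differentiableAt, hv.ae_differentiableAt] with p hp1 hp2
    have ht : ∀ i, timeDeriv (Φ i) p = timeDeriv φ p * fderiv ℝ η (v p.1 p.2) (e i)
        + φ p.1 p.2 * fderiv ℝ (fderiv ℝ η) (v p.1 p.2) (timeDeriv v p) (e i) := fun i =>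
      (S.hasDerivAt_mul_fderiv (hasDerivAt_timeDeriv hp2) (hasDerivAt_timeDeriv hp1)
        (hvC _ _) (e i)).deriv
    have hx : ∀ i, spaceDeriv (Φ i) p = spaceDeriv φ p * fderiv ℝ η (v p.1 p.2) (e i)
        + φ p.1 p.2 * fderiv ℝ (fderiv ℝ η) (v p.1 p.2) (spaceDeriv v p) (e i) := fun i =>
      (S.hasDerivAt_mul_fderiv (hasDerivAt_spaceDeriv hp2) (hasDerivAt_spaceDeriv hp1)
        (hvC _ _) (e i)).deriv
    simp only [ht, hx, add_mul, mul_assoc, Finset.sum_add_distrib, ← Finset.mul_sum, he,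
      sum_apply_single]
  have hae₀ : ∀ x, ∑ i, Φ i 0 x * u₀ x i = φ 0 x * fderiv ℝ η (v 0 x) (u₀ x) := fun x => by
    simp only [hΦdef, mul_assoc, ← Finset.mul_sum, he, sum_apply_single]
  refine ⟨(integrable_finsetSum _ fun i _ => hj₁ i).congr hae, ?_, ?_⟩
  · simp_rw [← hae₀]
    exact integrable_finsetSum _ fun i _ => hj₂ i
  · rw [← integral_congr_ae hae]
    simp_rw [← hae₀]
    rw [integral_finsetSum _ fun i _ => hj₁ i, integral_finsetSum _ fun i _ => hj₂ i,
      ← Finset.sum_add_distrib]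
    exact Finset.sum_eq_zero fun i _ => hw i

/-- The identity obtained by integrating the divergence of
`(φ (η(v) - Dη(v) v), φ (q(v) - Dη(v) f(v)))` over the strip. -/
theorem IsTestFunction.divergence_identity (hT : 0 < T) (S : IsStateSet U f η q C Cf ηlow ηup)
    (hv : LipschitzWith L (fun p : ℝ × ℝ => v p.1 p.2)) (hvC : ∀ t x, v t x ∈ C)
    (hφ : IsTestFunction T φ) :
    Integrable (fun p : ℝ × ℝ =>
        timeDeriv φ p * (η (v p.1 p.2) - fderiv ℝ η (v p.1 p.2) (v p.1 p.2))
          - φ p.1 p.2 * fderiv ℝ (fderiv ℝ η) (v p.1 p.2) (timeDeriv v p) (v p.1 p.2)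
          + (spaceDeriv φ p * (q (v p.1 p.2) - fderiv ℝ η (v p.1 p.2) (f (v p.1 p.2)))
          - φ p.1 p.2 * fderiv ℝ (fderiv ℝ η) (v p.1 p.2) (spaceDeriv v p) (f (v p.1 p.2))))
        (volume.restrict (strip T)) ∧
    Integrable (fun x => φ 0 x * (η (v 0 x) - fderiv ℝ η (v 0 x) (v 0 x))) ∧
    (∫ p in strip T,
        (timeDeriv φ p * (η (v p.1 p.2) - fderiv ℝ η (v p.1 p.2) (v p.1 p.2))
          - φ p.1 p.2 * fderiv ℝ (fderiv ℝ η) (v p.1 p.2) (timeDeriv v p) (v p.1 p.2)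
          + (spaceDeriv φ p * (q (v p.1 p.2) - fderiv ℝ η (v p.1 p.2) (f (v p.1 p.2)))
          - φ p.1 p.2 * fderiv ℝ (fderiv ℝ η) (v p.1 p.2) (spaceDeriv v p) (f (v p.1 p.2)))))
      + ∫ x, φ 0 x * (η (v 0 x) - fderiv ℝ η (v 0 x) (v 0 x)) = 0 := by
  obtain ⟨Lφ, hLφ⟩ := hφ.lipschitz
  have hsub : ∀ {G : Vec m → ℝ} {g : Vec m → Vec m}, (∃ K : ℝ≥0, LipschitzOnWith K G C) →
      (∃ K : ℝ≥0, LipschitzOnWith K g C) →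
      ∃ K : ℝ≥0, LipschitzOnWith K (fun a => G a - fderiv ℝ η a (g a)) C := by
    rintro G g ⟨K, hK⟩ hg
    obtain ⟨K', hK'⟩ := S.exists_lipschitzOn_fderiv_comp hg
    rw [lipschitzOnWith_iff_restrict] at hK hK'
    exact ⟨K + K', lipschitzOnWith_iff_restrict.2 (hK.sub hK')⟩
  set Φ₁ : ℝ → ℝ → ℝ := fun t x => φ t x * (η (v t x) - fderiv ℝ η (v t x) (v t x)) with hΦ₁def
  set Φ₂ : ℝ → ℝ → ℝ := fun t x => φ t x * (q (v t x) - fderiv ℝ η (v t x) (f (v t x)))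
    with hΦ₂def
  have hΦ₁ : IsTestFunction T Φ₁ := by
    obtain ⟨K, hK⟩ := hsub (g := id) (S.exists_lipschitzOn fun c hc => S.contDiffAt_entropy hc)
      ⟨1, LipschitzWith.id.lipschitzOnWith⟩
    obtain ⟨K', B, hK', hB⟩ := S.comp_lipschitz hv hvC hK
    exact hφ.mul hK' hB
  have hΦ₂ : IsTestFunction T Φ₂ := by
    obtain ⟨K, hK⟩ := hsub (S.exists_lipschitzOn fun c hc => S.contDiffAt_entropyFlux hc)
      (S.exists_lipschitzOn fun c hc => S.contDiffAt_flux hc)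
    obtain ⟨K', B, hK', hB⟩ := S.comp_lipschitz hv hvC hK
    exact hφ.mul hK' hB
  have hae : (fun p : ℝ × ℝ => timeDeriv Φ₁ p + spaceDeriv Φ₂ p)
      =ᵐ[volume.restrict (strip T)] fun p : ℝ × ℝ =>
        timeDeriv φ p * (η (v p.1 p.2) - fderiv ℝ η (v p.1 p.2) (v p.1 p.2))
          - φ p.1 p.2 * fderiv ℝ (fderiv ℝ η) (v p.1 p.2) (timeDeriv v p) (v p.1 p.2)
          + (spaceDeriv φ p * (q (v p.1 p.2) - fderiv ℝ η (v p.1 p.2) (f (v p.1 p.2)))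
          - φ p.1 p.2 * fderiv ℝ (fderiv ℝ η) (v p.1 p.2) (spaceDeriv v p) (f (v p.1 p.2))) := by
    refine ae_restrict_of_ae ?_
    filter_upwards [hLφ.ae_differentiableAt, hv.ae_differentiableAt] with p hp1 hp2
    exact congrArg₂ (· + ·)
      (S.hasDerivAt_mul_entropy (hasDerivAt_timeDeriv hp2) (hasDerivAt_timeDeriv hp1)
        (hvC _ _)).deriv
      (S.hasDerivAt_mul_entropyFlux (hasDerivAt_spaceDeriv hp2) (hasDerivAt_spaceDeriv hp1)
        (hvC _ _)).deriv
  have hi₁ : Integrable (timeDeriv Φ₁) (volume.restrict (strip T)) :=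
    hΦ₁.integrable_timeDeriv.restrict
  have hi₂ : Integrable (spaceDeriv Φ₂) (volume.restrict (strip T)) :=
    hΦ₂.integrable_spaceDeriv.restrict
  refine ⟨(hi₁.add hi₂).congr hae, (hΦ₁.continuous_slice 0).integrable_of_hasCompactSupport
    (hΦ₁.hasCompactSupport_slice 0), ?_⟩
  rw [← integral_congr_ae hae, integral_add hi₁ hi₂, hΦ₁.setIntegral_timeDeriv hT,
    hΦ₂.setIntegral_spaceDeriv]
  ring

theorem integral_sub_sub {α : Type*} [MeasurableSpace α] {μ : Measure α} {a b c : α → ℝ}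
    (ha : Integrable a μ) (hb : Integrable b μ) (hc : Integrable c μ) :
    ∫ x, (a x - b x - c x) ∂μ = ∫ x, a x ∂μ - ∫ x, b x ∂μ - ∫ x, c x ∂μ := by
  have hab : Integrable (fun x => a x - b x) μ := ha.sub hb
  rw [integral_sub hab hc, integral_sub ha hb]

/-- The relative entropy inequality between an entropy solution `u` and a Lipschitz function `v`. -/
theorem IsEntropySolution.relEntropy_inequality (hT : 0 < T)
    (S : IsStateSet U f η q C Cf ηlow ηup) (hu : IsEntropySolution U f η q T u₀ u)
    (huC : ∀ᵐ p ∂(volume.restrict (strip T)), u p.1 p.2 ∈ C) (hu₀C : ∀ᵐ x, u₀ x ∈ C)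
    (hv : LipschitzWith L (fun p : ℝ × ℝ => v p.1 p.2)) (hvC : ∀ t x, v t x ∈ C)
    (hφ : IsTestFunction T φ) (hφ0 : ∀ t x, 0 ≤ φ t x) :
    Integrable (fun p : ℝ × ℝ =>
        timeDeriv φ p * relEntropy η (u p.1 p.2) (v p.1 p.2)
          + spaceDeriv φ p * relEntropyFlux f η q (u p.1 p.2) (v p.1 p.2)
          - φ p.1 p.2 * (fderiv ℝ (fderiv ℝ η) (v p.1 p.2) (timeDeriv v p)
              (u p.1 p.2 - v p.1 p.2)
            + fderiv ℝ (fderiv ℝ η) (v p.1 p.2) (spaceDeriv v p)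
              (f (u p.1 p.2) - f (v p.1 p.2)))) (volume.restrict (strip T)) ∧
    Integrable (fun x => φ 0 x * relEntropy η (u₀ x) (v 0 x)) ∧
    0 ≤ (∫ p in strip T,
        (timeDeriv φ p * relEntropy η (u p.1 p.2) (v p.1 p.2)
          + spaceDeriv φ p * relEntropyFlux f η q (u p.1 p.2) (v p.1 p.2)
          - φ p.1 p.2 * (fderiv ℝ (fderiv ℝ η) (v p.1 p.2) (timeDeriv v p)
              (u p.1 p.2 - v p.1 p.2)
            + fderiv ℝ (fderiv ℝ η) (v p.1 p.2) (spaceDeriv v p)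
              (f (u p.1 p.2) - f (v p.1 p.2)))))
      + ∫ x, φ 0 x * relEntropy η (u₀ x) (v 0 x) := by
  obtain ⟨hw₁, hw₂, hw⟩ := hu.weak_covector S huC hu₀C hv hvC hφ
  obtain ⟨hd₁, hd₂, hd⟩ := hφ.divergence_identity hT S hv hvC
  have hηc : ContinuousOn η C := fun c hc =>
    (S.contDiffAt_entropy hc).continuousAt.continuousWithinAt
  have hqc : ContinuousOn q C := fun c hc =>
    (S.contDiffAt_entropyFlux hc).continuousAt.continuousWithinAt
  obtain ⟨B₁, hB₁⟩ := ae_bounded_comp S hηc huC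
  obtain ⟨B₂, hB₂⟩ := ae_bounded_comp S hqc huC
  obtain ⟨B₃, hB₃⟩ := ae_bounded_comp S hηc hu₀C
  have he₁ : Integrable (fun p : ℝ × ℝ => timeDeriv φ p * η (u p.1 p.2)
      + spaceDeriv φ p * q (u p.1 p.2)) (volume.restrict (strip T)) :=
    (integrable_smul_of_ae_bounded hφ.integrable_timeDeriv.restrict
      hu.aestronglyMeasurable_entropy hB₁).add
    (integrable_smul_of_ae_bounded hφ.integrable_spaceDeriv.restrict
      hu.aestronglyMeasurable_entropyFlux hB₂)
  have he₂ : Integrable (fun x => φ 0 x * η (u₀ x)) :=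
    integrable_smul_of_ae_bounded ((hφ.continuous_slice 0).integrable_of_hasCompactSupport
      (hφ.hasCompactSupport_slice 0)) hu.locInt_entropy_init.aestronglyMeasurable hB₃
  have he := hu.entropy φ hφ hφ0
  have e₁ : ∀ p : ℝ × ℝ, timeDeriv φ p * relEntropy η (u p.1 p.2) (v p.1 p.2)
          + spaceDeriv φ p * relEntropyFlux f η q (u p.1 p.2) (v p.1 p.2)
          - φ p.1 p.2 * (fderiv ℝ (fderiv ℝ η) (v p.1 p.2) (timeDeriv v p)
              (u p.1 p.2 - v p.1 p.2)
            + fderiv ℝ (fderiv ℝ η) (v p.1 p.2) (spaceDeriv v p)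
              (f (u p.1 p.2) - f (v p.1 p.2)))
      = (timeDeriv φ p * η (u p.1 p.2) + spaceDeriv φ p * q (u p.1 p.2))
        - (timeDeriv φ p * fderiv ℝ η (v p.1 p.2) (u p.1 p.2)
          + φ p.1 p.2 * fderiv ℝ (fderiv ℝ η) (v p.1 p.2) (timeDeriv v p) (u p.1 p.2)
          + (spaceDeriv φ p * fderiv ℝ η (v p.1 p.2) (f (u p.1 p.2))
          + φ p.1 p.2 * fderiv ℝ (fderiv ℝ η) (v p.1 p.2) (spaceDeriv v p) (f (u p.1 p.2))))
        - (timeDeriv φ p * (η (v p.1 p.2) - fderiv ℝ η (v p.1 p.2) (v p.1 p.2))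
          - φ p.1 p.2 * fderiv ℝ (fderiv ℝ η) (v p.1 p.2) (timeDeriv v p) (v p.1 p.2)
          + (spaceDeriv φ p * (q (v p.1 p.2) - fderiv ℝ η (v p.1 p.2) (f (v p.1 p.2)))
          - φ p.1 p.2 * fderiv ℝ (fderiv ℝ η) (v p.1 p.2) (spaceDeriv v p)
            (f (v p.1 p.2)))) := fun p => by
    simp only [relEntropy, relEntropyFlux, map_sub]
    ring
  have e₂ : ∀ x, φ 0 x * relEntropy η (u₀ x) (v 0 x) = φ 0 x * η (u₀ x)
      - φ 0 x * fderiv ℝ η (v 0 x) (u₀ x)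
      - φ 0 x * (η (v 0 x) - fderiv ℝ η (v 0 x) (v 0 x)) := fun x => by
    simp only [relEntropy, map_sub]
    ring
  simp_rw [e₁, e₂]
  refine ⟨(he₁.sub hw₁).sub hd₁, (he₂.sub hw₂).sub hd₂, ?_⟩
  rw [integral_sub_sub he₁ hw₁ hd₁, integral_sub_sub he₂ hw₂ hd₂]
  linarith

end RelativeEntropyInequality

/-! ### The weights of the test function -/

/-- Truncation of a real number to `[0, 1]`. -/
def unitClamp (z : ℝ) : ℝ := max 0 (min 1 z)

theorem unitClamp_nonneg (z : ℝ) : 0 ≤ unitClamp z := le_max_left _ _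

theorem unitClamp_le_one (z : ℝ) : unitClamp z ≤ 1 := max_le zero_le_one (min_le_left _ _)

theorem abs_unitClamp_le (z : ℝ) : |unitClamp z| ≤ (1 : ℝ≥0) := by
  rw [abs_of_nonneg (unitClamp_nonneg z)]
  exact unitClamp_le_one z

theorem unitClamp_of_one_le {z : ℝ} (h : 1 ≤ z) : unitClamp z = 1 := by
  simp [unitClamp, min_eq_left h]

theorem unitClamp_of_nonpos {z : ℝ} (h : z ≤ 0) : unitClamp z = 0 := by
  rw [unitClamp, min_eq_right (h.trans zero_le_one), max_eq_left h]

theorem unitClamp_of_mem {z : ℝ} (h : z ∈ Icc (0 : ℝ) 1) : unitClamp z = z := by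
  rw [unitClamp, min_eq_right h.2, max_eq_right h.1]

theorem unitClamp_mono : Monotone unitClamp := fun _ _ h => max_le_max le_rfl (min_le_min le_rfl h)

theorem lipschitzWith_unitClamp : LipschitzWith 1 unitClamp :=
  (LipschitzWith.id.const_min 1).const_max 0

/-- A cut-off in time: it vanishes outside `[-1, σ']`, equals `1` on `[0, σ]` and is affine on
`[σ, σ']`. -/
def timeCutoff (σ σ' t : ℝ) : ℝ := unitClamp (t + 1) * unitClamp ((σ' - t) / (σ' - σ))

theorem timeCutoff_nonneg (σ σ' t : ℝ) : 0 ≤ timeCutoff σ σ' t :=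
  mul_nonneg (unitClamp_nonneg _) (unitClamp_nonneg _)

theorem timeCutoff_le_one (σ σ' t : ℝ) : timeCutoff σ σ' t ≤ 1 :=
  mul_le_one₀ (unitClamp_le_one _) (unitClamp_nonneg _) (unitClamp_le_one _)

theorem timeCutoff_of_le {σ σ' t : ℝ} (h : σ < σ') (ht : σ' ≤ t) : timeCutoff σ σ' t = 0 := by
  rw [timeCutoff, unitClamp_of_nonpos (z := (σ' - t) / (σ' - σ)), mul_zero]
  exact div_nonpos_of_nonpos_of_nonneg (by linarith) (by linarith)

theorem timeCutoff_of_le_neg_one {σ σ' t : ℝ} (ht : t ≤ -1) : timeCutoff σ σ' t = 0 := by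
  rw [timeCutoff, unitClamp_of_nonpos (z := t + 1) (by linarith), zero_mul]

theorem exists_lipschitzWith_timeCutoff {σ σ' : ℝ} :
    ∃ K : ℝ≥0, LipschitzWith K (timeCutoff σ σ') := by
  have h1 : LipschitzWith (1 * 1) (fun t : ℝ => unitClamp (t + 1)) :=
    lipschitzWith_unitClamp.comp (LipschitzWith.of_dist_le_mul fun a b => by simp)
  have h2 : LipschitzWith (1 * ‖(σ' - σ)⁻¹‖₊)
      (fun t : ℝ => unitClamp ((σ' - t) / (σ' - σ))) :=
    lipschitzWith_unitClamp.comp (LipschitzWith.of_dist_le_mul fun a b => by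
      rw [Real.dist_eq, Real.dist_eq, ← sub_div, div_eq_inv_mul, abs_mul, coe_nnnorm,
        Real.norm_eq_abs]
      rw [show σ' - a - (σ' - b) = -(a - b) by ring, abs_neg])
  exact ⟨_, lipschitzWith_mul_of_bounded h1 h2 (fun _ => abs_unitClamp_le _)
    (fun _ => abs_unitClamp_le _)⟩

theorem hasDerivAt_timeCutoff {σ σ' t : ℝ} (h : σ < σ') (ht0 : 0 < t) (ht : t ≠ σ)
    (ht' : t ≠ σ') :
    HasDerivAt (timeCutoff σ σ') ((Ioo σ σ').indicator (fun _ => -(σ' - σ)⁻¹) t) t := by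
  have hd : 0 < σ' - σ := by linarith
  have h1 : ∀ᶠ r in nhds t, unitClamp (r + 1) = 1 := by
    filter_upwards [lt_mem_nhds ht0] with r hr
    exact unitClamp_of_one_le (by linarith)
  rcases lt_or_gt_of_ne ht with hlt | hgt
  · rw [indicator_of_notMem (fun hm => absurd hm.1 (not_lt.2 hlt.le))]
    refine (hasDerivAt_const t (1 : ℝ)).congr_of_eventuallyEq ?_
    filter_upwards [h1, gt_mem_nhds hlt] with r hr hr'
    rw [timeCutoff, hr, unitClamp_of_one_le, one_mul]
    rw [le_div_iff₀ hd]
    linarith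
  rcases lt_or_gt_of_ne ht' with hlt' | hgt'
  · rw [indicator_of_mem (show t ∈ Ioo σ σ' from ⟨hgt, hlt'⟩)]
    have hlin : HasDerivAt (fun r : ℝ => (σ' - r) / (σ' - σ)) (-(σ' - σ)⁻¹) t := by
      have := ((hasDerivAt_id t).const_sub σ').div_const (σ' - σ)
      refine this.congr_deriv ?_
      rw [neg_div, one_div]
    refine hlin.congr_of_eventuallyEq ?_
    filter_upwards [h1, lt_mem_nhds hgt, gt_mem_nhds hlt'] with r hr hr1 hr2
    rw [timeCutoff, hr, one_mul, unitClamp_of_mem]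
    refine ⟨div_nonneg (by linarith) hd.le, ?_⟩
    rw [div_le_one hd]
    linarith
  · rw [indicator_of_notMem (fun hm => absurd hm.2 (not_lt.2 hgt'.le))]
    refine (hasDerivAt_const t (0 : ℝ)).congr_of_eventuallyEq ?_
    filter_upwards [lt_mem_nhds hgt'] with r hr
    exact timeCutoff_of_le h (le_of_lt hr)

/-- The weight of a backward cone of slope `s`: it equals `1` for `|x| ≤ ρ + s (τ - t)` and vanishes
for `|x| ≥ ρ + 1 + s (τ - t)`. -/
def coneWeight (s τ ρ t x : ℝ) : ℝ := unitClamp (ρ + 1 + s * (τ - t) - |x|)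

theorem coneWeight_eq_one {s τ ρ t x : ℝ} (hs : 0 ≤ s) (ht : t ≤ τ) (hx : |x| ≤ ρ) :
    coneWeight s τ ρ t x = 1 := by
  apply unitClamp_of_one_le
  have := mul_nonneg hs (sub_nonneg.2 ht)
  linarith

theorem lipschitzWith_coneWeight {s τ ρ : ℝ} (hs : 0 ≤ s) :
    LipschitzWith (1 * (⟨s, hs⟩ + 1)) (fun p : ℝ × ℝ => coneWeight s τ ρ p.1 p.2) := by
  refine lipschitzWith_unitClamp.comp (LipschitzWith.of_dist_le_mul fun a b => ?_)
  rw [Real.dist_eq]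
  have e : ρ + 1 + s * (τ - a.1) - |a.2| - (ρ + 1 + s * (τ - b.1) - |b.2|)
      = -(s * (a.1 - b.1)) - (|a.2| - |b.2|) := by ring
  have h1 : |a.1 - b.1| ≤ dist a b := by
    rw [← Real.dist_eq]
    exact le_max_left _ _
  have h2 : |a.2 - b.2| ≤ dist a b := by
    rw [← Real.dist_eq]
    exact le_max_right _ _
  rw [e]
  calc _ ≤ |-(s * (a.1 - b.1))| + |(|a.2| - |b.2|)| := norm_sub_le (-(s * (a.1 - b.1))) _
    _ ≤ s * |a.1 - b.1| + |a.2 - b.2| := by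
      rw [abs_neg, abs_mul, abs_of_nonneg hs]
      exact add_le_add le_rfl (abs_abs_sub_abs_le _ _)
    _ ≤ s * dist a b + dist a b := by gcongr
    _ = (s + 1) * dist a b := by ring

/-- The cone weight decreases along all rays of speed at most `s`. -/
theorem timeDeriv_coneWeight_add_le {s τ ρ : ℝ} (hs : 0 ≤ s) {p : ℝ × ℝ}
    (hp : DifferentiableAt ℝ (fun p : ℝ × ℝ => coneWeight s τ ρ p.1 p.2) p) :
    timeDeriv (coneWeight s τ ρ) p + s * |spaceDeriv (coneWeight s τ ρ) p| ≤ 0 := by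
  set D := fderiv ℝ (fun p : ℝ × ℝ => coneWeight s τ ρ p.1 p.2) p with hD
  have ht : timeDeriv (coneWeight s τ ρ) p = D (1, 0) := by
    have h1 : HasDerivAt (fun r : ℝ => ((r, p.2) : ℝ × ℝ)) (1, 0) p.1 :=
      (hasDerivAt_id _).prodMk (hasDerivAt_const _ _)
    exact (HasFDerivAt.comp_hasDerivAt (f := fun r : ℝ => ((r, p.2) : ℝ × ℝ)) p.1
      hp.hasFDerivAt h1).deriv
  have hx : spaceDeriv (coneWeight s τ ρ) p = D (0, 1) := by
    have h1 : HasDerivAt (fun z : ℝ => ((p.1, z) : ℝ × ℝ)) (0, 1) p.2 :=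
      (hasDerivAt_const _ _).prodMk (hasDerivAt_id _)
    exact (HasFDerivAt.comp_hasDerivAt (f := fun z : ℝ => ((p.1, z) : ℝ × ℝ)) p.2
      hp.hasFDerivAt h1).deriv
  have key : ∀ e : ℝ, |e| = 1 → D (1, 0) + s * e * D (0, 1) ≤ 0 := fun e he => by
    have h1 : HasDerivAt (fun r : ℝ => ((p.1 + r, p.2 + s * e * r) : ℝ × ℝ)) (1, s * e) 0 := by
      refine HasDerivAt.prodMk ?_ ?_
      · simpa using (hasDerivAt_id (0 : ℝ)).const_add p.1
      · simpa using ((hasDerivAt_id (0 : ℝ)).const_mul (s * e)).const_add p.2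
    have h2 : HasDerivAt (fun r : ℝ => coneWeight s τ ρ (p.1 + r) (p.2 + s * e * r))
        (D (1, s * e)) 0 := by
      have hp' : HasFDerivAt (fun p : ℝ × ℝ => coneWeight s τ ρ p.1 p.2) D
          (p.1 + 0, p.2 + s * e * 0) := by
        simpa using hp.hasFDerivAt
      exact HasFDerivAt.comp_hasDerivAt
        (f := fun r : ℝ => ((p.1 + r, p.2 + s * e * r) : ℝ × ℝ)) 0 hp' h1
    have hanti : Antitone (fun r : ℝ => coneWeight s τ ρ (p.1 + r) (p.2 + s * e * r)) := by
      intro r r' hr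
      apply unitClamp_mono
      have h3 : |p.2 + s * e * r| ≤ |p.2 + s * e * r'| + s * (r' - r) := by
        have h4 : p.2 + s * e * r = (p.2 + s * e * r') + (s * (r - r')) * e := by ring
        rw [h4]
        refine (abs_add_le _ _).trans ?_
        rw [abs_mul, he, mul_one, abs_mul, abs_of_nonneg hs, abs_sub_comm,
          abs_of_nonneg (sub_nonneg.2 hr)]
      linarith
    have h5 : D (1, s * e) ≤ 0 := by
      rw [← h2.deriv]
      exact hanti.deriv_nonpos
    have h6 : ((1, s * e) : ℝ × ℝ) = (1, 0) + (s * e) • ((0, 1) : ℝ × ℝ) := by simp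
    rw [h6, map_add, map_smul, smul_eq_mul] at h5
    exact h5
  rw [ht, hx]
  rcases abs_cases (D (0, 1)) with ⟨h, -⟩ | ⟨h, -⟩
  · rw [h]
    have := key 1 (by simp)
    linarith
  · rw [h]
    have := key (-1) (by simp)
    linarith

/-- The exponential weight `exp(-∫₀ᵗ a)`. -/
def expWeight (a : ℝ → ℝ) (t : ℝ) : ℝ := Real.exp (-∫ r in (0 : ℝ)..t, a r)

section ExpWeight

variable {a : ℝ → ℝ} {A : ℝ}

theorem expWeight_pos (t : ℝ) : 0 < expWeight a t := Real.exp_pos _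

theorem locallyIntegrable_of_bounded (ha : Measurable a) (ha0 : ∀ r, 0 ≤ a r)
    (haA : ∀ r, a r ≤ A) : LocallyIntegrable a := by
  refine (locallyIntegrable_const A).mono ha.aestronglyMeasurable
    (Filter.Eventually.of_forall fun r => ?_)
  rw [Real.norm_of_nonneg (ha0 r), Real.norm_of_nonneg ((ha0 r).trans (haA r))]
  exact haA r

theorem integral_nonneg_of_zero (ha0 : ∀ r, 0 ≤ a r) (hneg : ∀ r ≤ 0, a r = 0) (t : ℝ) :
    0 ≤ ∫ r in (0 : ℝ)..t, a r := by
  rcases le_total 0 t with h | h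
  · exact intervalIntegral.integral_nonneg h fun r _ => ha0 r
  · rw [intervalIntegral.integral_symm, intervalIntegral.integral_of_le h,
      setIntegral_eq_zero_of_forall_eq_zero fun r hr => hneg r hr.2, neg_zero]

theorem expWeight_le_one (ha0 : ∀ r, 0 ≤ a r) (hneg : ∀ r ≤ 0, a r = 0) (t : ℝ) :
    expWeight a t ≤ 1 :=
  Real.exp_le_one_iff.2 (neg_nonpos.2 (integral_nonneg_of_zero ha0 hneg t))

theorem lipschitzWith_expWeight (ha : Measurable a) (ha0 : ∀ r, 0 ≤ a r) (haA : ∀ r, a r ≤ A)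
    (hA : 0 ≤ A) (hneg : ∀ r ≤ 0, a r = 0) : LipschitzWith ⟨A, hA⟩ (expWeight a) := by
  have hli := locallyIntegrable_of_bounded ha ha0 haA
  have hint : ∀ b c : ℝ, IntervalIntegrable a volume b c := fun b c =>
    (hli.integrableOn_isCompact isCompact_uIcc).intervalIntegrable
  have hmono : ∀ b c : ℝ, b ≤ c → |expWeight a c - expWeight a b| ≤ A * (c - b) := by
    intro b c hbc
    have h1 : ∫ r in (0 : ℝ)..c, a r = (∫ r in (0 : ℝ)..b, a r) + ∫ r in b..c, a r :=
      (intervalIntegral.integral_add_adjacent_intervals (hint 0 b) (hint b c)).symm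
    have h2 : 0 ≤ ∫ r in b..c, a r := intervalIntegral.integral_nonneg hbc fun r _ => ha0 r
    have h3 : ∫ r in b..c, a r ≤ A * (c - b) := by
      calc _ ≤ ∫ r in b..c, A := intervalIntegral.integral_mono_on hbc (hint b c)
            (by simp) fun r _ => haA r
        _ = A * (c - b) := by simp [mul_comm]
    have h4 : expWeight a c = expWeight a b * Real.exp (-∫ r in b..c, a r) := by
      rw [expWeight, expWeight, ← Real.exp_add, h1]
      ring_nf
    have h5 := Real.add_one_le_exp (-∫ r in b..c, a r)
    have h6 : Real.exp (-∫ r in b..c, a r) ≤ 1 := Real.exp_le_one_iff.2 (by linarith)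
    have h7 := expWeight_le_one ha0 hneg b
    have h8 := expWeight_pos (a := a) b
    rw [h4, abs_sub_comm, abs_of_nonneg (by nlinarith)]
    nlinarith
  refine LipschitzWith.of_dist_le_mul fun b c => ?_
  rw [Real.dist_eq, Real.dist_eq]
  rcases le_total b c with h | h
  · rw [abs_sub_comm, abs_sub_comm b c, abs_of_nonneg (sub_nonneg.2 h)]
    exact hmono b c h
  · rw [abs_of_nonneg (sub_nonneg.2 h)]
    exact hmono c b h

theorem ae_hasDerivAt_expWeight (ha : Measurable a) (ha0 : ∀ r, 0 ≤ a r) (haA : ∀ r, a r ≤ A) :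
    ∀ᵐ t, HasDerivAt (expWeight a) (-(a t) * expWeight a t) t := by
  filter_upwards [LocallyIntegrable.ae_hasDerivAt_integral
    (locallyIntegrable_of_bounded ha ha0 haA)] with t ht
  refine (ht 0).neg.exp.congr_deriv ?_
  rw [mul_comm]
  rfl

end ExpWeight

/-- The test function of the stability estimate: a cut-off in time, the exponential weight that
absorbs the growth with rate `a`, and the weight of a backward cone that has radius `ρ` at time
`τ`. -/
def stabilityTest (a : ℝ → ℝ) (σ σ' s τ ρ t x : ℝ) : ℝ :=
  timeCutoff σ σ' t * expWeight a t * coneWeight s τ ρ t x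

section StabilityTest

variable {a : ℝ → ℝ} {A σ σ' s τ ρ T : ℝ}

theorem stabilityTest_nonneg (t x : ℝ) : 0 ≤ stabilityTest a σ σ' s τ ρ t x :=
  mul_nonneg (mul_nonneg (timeCutoff_nonneg _ _ _) (expWeight_pos _).le) (unitClamp_nonneg _)

theorem stabilityTest_le_one (ha0 : ∀ r, 0 ≤ a r) (hneg : ∀ r ≤ 0, a r = 0) (t x : ℝ) :
    stabilityTest a σ σ' s τ ρ t x ≤ 1 :=
  mul_le_one₀ (mul_le_one₀ (timeCutoff_le_one _ _ _) (expWeight_pos _).le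
    (expWeight_le_one ha0 hneg t)) (unitClamp_nonneg _) (unitClamp_le_one _)

theorem isTestFunction_stabilityTest (ha : Measurable a) (ha0 : ∀ r, 0 ≤ a r)
    (haA : ∀ r, a r ≤ A) (hA : 0 ≤ A) (hneg : ∀ r ≤ 0, a r = 0) (hs : 0 ≤ s) (hσ : σ < σ')
    (hσT : σ' < T) : IsTestFunction T (stabilityTest a σ σ' s τ ρ) := by
  obtain ⟨K, hK⟩ := exists_lipschitzWith_timeCutoff (σ := σ) (σ' := σ')
  have h1 := hK.comp (LipschitzWith.prod_fst (α := ℝ) (β := ℝ))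
  have h2 := (lipschitzWith_expWeight ha ha0 haA hA hneg).comp
    (LipschitzWith.prod_fst (α := ℝ) (β := ℝ))
  have h3 := lipschitzWith_coneWeight (τ := τ) (ρ := ρ) hs
  have b1 : ∀ p : ℝ × ℝ, |timeCutoff σ σ' p.1| ≤ (1 : ℝ≥0) := fun p => by
    rw [abs_of_nonneg (timeCutoff_nonneg _ _ _)]
    exact timeCutoff_le_one _ _ _
  have b2 : ∀ p : ℝ × ℝ, |expWeight a p.1| ≤ (1 : ℝ≥0) := fun p => by
    rw [abs_of_pos (expWeight_pos _)]
    exact expWeight_le_one ha0 hneg _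
  have b12 : ∀ p : ℝ × ℝ, |timeCutoff σ σ' p.1 * expWeight a p.1| ≤ (1 : ℝ≥0) := fun p => by
    rw [abs_mul]
    exact mul_le_one₀ (b1 p) (abs_nonneg _) (b2 p)
  refine ⟨⟨_, lipschitzWith_mul_of_bounded (lipschitzWith_mul_of_bounded h1 h2 b1 b2) h3 b12
    fun p => abs_unitClamp_le _⟩, ?_, ?_⟩
  · refine HasCompactSupport.intro ((isCompact_Icc (a := -1) (b := σ')).prod
      (isCompact_Icc (a := -(ρ + 1 + s * (τ + 1))) (b := ρ + 1 + s * (τ + 1)))) fun p hp => ?_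
    by_contra hne
    have ht : timeCutoff σ σ' p.1 ≠ 0 := fun h => hne (by simp [stabilityTest, h])
    have hx : coneWeight s τ ρ p.1 p.2 ≠ 0 := fun h => hne (by simp [stabilityTest, h])
    have ht1 : -1 < p.1 := by
      by_contra h
      exact ht (timeCutoff_of_le_neg_one (not_lt.1 h))
    have ht2 : p.1 < σ' := by
      by_contra h
      exact ht (timeCutoff_of_le hσ (not_lt.1 h))
    have hx1 : 0 < ρ + 1 + s * (τ - p.1) - |p.2| := by
      by_contra h
      exact hx (unitClamp_of_nonpos (not_lt.1 h))
    have : s * (τ - p.1) ≤ s * (τ + 1) := mul_le_mul_of_nonneg_left (by linarith) hs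
    exact hp ⟨⟨ht1.le, ht2.le⟩, abs_le.1 (by linarith)⟩
  · have hcl : IsClosed (Iic σ' ×ˢ (univ : Set ℝ)) := isClosed_Iic.prod isClosed_univ
    refine (closure_minimal ?_ hcl).trans (prod_mono (Iic_subset_Iio.2 hσT) subset_rfl)
    intro p hp
    refine ⟨?_, mem_univ _⟩
    by_contra h
    exact hp (by simp [stabilityTest, timeCutoff_of_le hσ (not_le.1 h).le])

/-- The partial derivatives of the test function. -/
theorem ae_deriv_stabilityTest (ha : Measurable a) (ha0 : ∀ r, 0 ≤ a r)
    (haA : ∀ r, a r ≤ A) (hs : 0 ≤ s) (hσ : σ < σ') :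
    ∀ᵐ p : ℝ × ℝ, 0 < p.1 →
      DifferentiableAt ℝ (fun p : ℝ × ℝ => coneWeight s τ ρ p.1 p.2) p ∧
      timeDeriv (stabilityTest a σ σ' s τ ρ) p
        = (Ioo σ σ').indicator (fun _ => -(σ' - σ)⁻¹) p.1
            * expWeight a p.1 * coneWeight s τ ρ p.1 p.2
          - a p.1 * stabilityTest a σ σ' s τ ρ p.1 p.2
          + timeCutoff σ σ' p.1 * expWeight a p.1 * timeDeriv (coneWeight s τ ρ) p ∧
      spaceDeriv (stabilityTest a σ σ' s τ ρ) p
        = timeCutoff σ σ' p.1 * expWeight a p.1 * spaceDeriv (coneWeight s τ ρ) p := by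
  have hfst := (Measure.quasiMeasurePreserving_fst (μ := (volume : Measure ℝ))
    (ν := (volume : Measure ℝ)))
  have hne : ∀ c : ℝ, ∀ᵐ t : ℝ, t ≠ c := fun c => Measure.ae_ne volume c
  filter_upwards [(lipschitzWith_coneWeight (τ := τ) (ρ := ρ) hs).ae_differentiableAt,
    hfst.ae (ae_hasDerivAt_expWeight ha ha0 haA), hfst.ae (hne σ), hfst.ae (hne σ')]
    with p hp he h1 h2 hp0
  refine ⟨hp, ?_, ?_⟩
  · have := ((hasDerivAt_timeCutoff hσ hp0 h1 h2).mul he).mul (hasDerivAt_timeDeriv hp)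
    refine this.deriv.trans ?_
    simp only [Pi.mul_apply, stabilityTest]
    ring
  · exact ((hasDerivAt_spaceDeriv hp).const_mul _).deriv

end StabilityTest

/-! ### The averaged stability estimate -/

section Estimate

variable {m : ℕ} {U : Set (Vec m)} {f : Vec m → Vec m} {η q : Vec m → ℝ} {C : Set (Vec m)}
  {Cf ηlow ηup T : ℝ} {u₀ : ℝ → Vec m} {u : ℝ → ℝ → Vec m} {v : ℝ → ℝ → Vec m} {L : ℝ≥0}

/-- The residual `∂ₜ v + ∂ₓ f(v)` at `p = (t, x)`. -/
def flowResidual (f : Vec m → Vec m) (v : ℝ → ℝ → Vec m) (p : ℝ × ℝ) : Vec m :=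
  timeDeriv v p + spaceDeriv (fun t x => f (v t x)) p

/-- The production terms of the relative entropy inequality are controlled by the residual and the
squared distance.  The symmetry of `Df(v)` with respect to `D²η(v)` turns
`D²η(v)(Df(v) ∂ₓv)(u - v) - D²η(v)(∂ₓv)(f(u) - f(v))` into `-D²η(v)(∂ₓv) f(u | v)`. -/
theorem IsStateSet.production_le (S : IsStateSet U f η q C Cf ηlow ηup) {a b vt vx : Vec m}
    (ha : a ∈ C) (hb : b ∈ C) {G : ℝ} (hG : ‖vx‖ ≤ G) :
    -(fderiv ℝ (fderiv ℝ η) b vt (a - b) + fderiv ℝ (fderiv ℝ η) b vx (f a - f b))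
      ≤ (‖vt + fderiv ℝ f b vx‖ ^ 2 + (ηup * Cf * G + ηup ^ 2) * ‖a - b‖ ^ 2) / 2 := by
  set r := vt + fderiv ℝ f b vx with hr
  have e : fderiv ℝ (fderiv ℝ η) b vt (a - b) + fderiv ℝ (fderiv ℝ η) b vx (f a - f b)
      = fderiv ℝ (fderiv ℝ η) b r (a - b) + fderiv ℝ (fderiv ℝ η) b vx (relFlux f a b) := by
    rw [relFlux, map_sub (fderiv ℝ (fderiv ℝ η) b vx) (f a - f b), ← S.hessian_flux_symm hb, hr,
      map_add, add_apply]
    ring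
  have h1 := (abs_le.1 (S.abs_hessian_le hb r (a - b))).1
  have h2 := (abs_le.1 (S.abs_hessian_le hb vx (relFlux f a b))).1
  have h3 : ηup * ‖vx‖ * ‖relFlux f a b‖ ≤ ηup * G * (Cf / 2 * ‖a - b‖ ^ 2) := by
    have := S.up_pos
    have hG0 : 0 ≤ G := (norm_nonneg _).trans hG
    gcongr
    exact S.norm_relFlux_le ha hb
  have h4 : 2 * (ηup * ‖r‖ * ‖a - b‖) ≤ ‖r‖ ^ 2 + ηup ^ 2 * ‖a - b‖ ^ 2 := by
    nlinarith [sq_nonneg (‖r‖ - ηup * ‖a - b‖)]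
  rw [e]
  linarith

theorem flowResidual_eq (S : IsStateSet U f η q C Cf ηlow ηup) (hvC : ∀ t x, v t x ∈ C) {p : ℝ × ℝ}
    (hp : DifferentiableAt ℝ (fun p : ℝ × ℝ => v p.1 p.2) p) :
    flowResidual f v p = timeDeriv v p + fderiv ℝ f (v p.1 p.2) (spaceDeriv v p) := by
  have h := ((S.contDiffAt_flux (hvC p.1 p.2)).differentiableAt (by norm_num)).hasFDerivAt
  rw [flowResidual]
  congr 1
  exact (h.comp_hasDerivAt p.2 (hasDerivAt_spaceDeriv hp)).deriv

/-- The growth rate of the stability estimate for the bound `G` of `∂ₓv`, extended by zero to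
nonpositive times. -/
def growthRate (Cf ηlow ηup : ℝ) (G : ℝ → ℝ) : ℝ → ℝ :=
  (Ioi (0 : ℝ)).indicator fun r => ηlow⁻¹ * (ηup * Cf * G r + ηup ^ 2)

theorem measurable_growthRate {G : ℝ → ℝ} (hG : Measurable G) :
    Measurable (growthRate Cf ηlow ηup G) :=
  (((hG.const_mul _).add_const _).const_mul _).indicator measurableSet_Ioi

theorem growthRate_nonneg (S : IsStateSet U f η q C Cf ηlow ηup) {G : ℝ → ℝ}
    (hG0 : ∀ r, 0 ≤ G r) (r : ℝ) : 0 ≤ growthRate Cf ηlow ηup G r := by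
  have h1 := S.low_pos
  have h2 := S.up_pos
  have h3 := S.Cf_nonneg
  refine indicator_nonneg (fun r _ => ?_) r
  have := hG0 r
  positivity

theorem growthRate_le (S : IsStateSet U f η q C Cf ηlow ηup) {G : ℝ → ℝ} {B : ℝ}
    (hG0 : ∀ r, 0 ≤ G r) (hGB : ∀ r, G r ≤ B) (r : ℝ) :
    growthRate Cf ηlow ηup G r ≤ ηlow⁻¹ * (ηup * Cf * B + ηup ^ 2) := by
  have h1 := S.low_pos
  have h2 := S.up_pos
  have h3 := S.Cf_nonneg
  have h4 := (hG0 0).trans (hGB 0)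
  rw [growthRate, indicator_apply]
  split_ifs
  · have := hGB r
    gcongr
  · positivity

theorem growthRate_of_nonpos {G : ℝ → ℝ} {r : ℝ} (hr : r ≤ 0) : growthRate Cf ηlow ηup G r = 0 :=
  indicator_of_notMem (by simpa using hr) _

/-- Pointwise form of the stability estimate: with the test function `χ e^{-A} ψ` the growth terms
are absorbed by the derivative of `e^{-A}`, and the flux terms by the derivative of the cone weight
`ψ`. -/
theorem pointwise_stability (S : IsStateSet U f η q C Cf ηlow ηup) {s : ℝ}
    (hs : ∀ a ∈ C, ∀ b ∈ C, |relEntropyFlux f η q a b| ≤ s * relEntropy η a b)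
    {a b vt vx : Vec m} (ha : a ∈ C) (hb : b ∈ C) {G : ℝ} (hG : ‖vx‖ ≤ G)
    {χ e ψ ψt ψx κ : ℝ} (hχ : 0 ≤ χ) (he : 0 ≤ e) (hψ : 0 ≤ ψ) (hψt : ψt + s * |ψx| ≤ 0) :
    (κ * e * ψ - ηlow⁻¹ * (ηup * Cf * G + ηup ^ 2) * (χ * e * ψ) + χ * e * ψt)
        * relEntropy η a b
      + χ * e * ψx * relEntropyFlux f η q a b
      - χ * e * ψ * (fderiv ℝ (fderiv ℝ η) b vt (a - b)
        + fderiv ℝ (fderiv ℝ η) b vx (f a - f b))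
      ≤ κ * e * ψ * relEntropy η a b + χ * e * ψ * (‖vt + fderiv ℝ f b vx‖ ^ 2 / 2) := by
  have hlow := S.low_pos
  have hup := S.up_pos
  have hCf := S.Cf_nonneg
  have hG0 : 0 ≤ G := (norm_nonneg _).trans hG
  have hrel := (S.relEntropy_bounds ha hb).1
  have hrel0 : 0 ≤ relEntropy η a b := le_trans (by positivity) hrel
  have hχe : 0 ≤ χ * e := mul_nonneg hχ he
  have h1 : ψt * relEntropy η a b + ψx * relEntropyFlux f η q a b ≤ 0 := by
    have h2 : ψx * relEntropyFlux f η q a b ≤ |ψx| * (s * relEntropy η a b) :=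
      (le_abs_self _).trans (by
        rw [abs_mul]
        exact mul_le_mul_of_nonneg_left (hs a ha b hb) (abs_nonneg _))
    nlinarith [mul_nonneg (neg_nonneg.2 hψt) hrel0]
  have h2 := mul_nonneg hχe (neg_nonneg.2 h1)
  have h3 := mul_le_mul_of_nonneg_left (S.production_le ha hb hG (vt := vt))
    (mul_nonneg hχe hψ)
  have h4 : (ηup * Cf * G + ηup ^ 2) * ‖a - b‖ ^ 2 / 2
      ≤ ηlow⁻¹ * (ηup * Cf * G + ηup ^ 2) * relEntropy η a b := by
    calc _ = ηlow⁻¹ * (ηup * Cf * G + ηup ^ 2) * (ηlow / 2 * ‖a - b‖ ^ 2) := by field_simp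
      _ ≤ _ := by gcongr
  have h5 := mul_le_mul_of_nonneg_left h4 (mul_nonneg hχe hψ)
  linarith

/-- `2 ⟨a, g⟩ - |g|²`, a lower bound for `|a|²` that is affine in `a`. -/
theorem two_inner_sub_le {E : Type*} [NormedAddCommGroup E] [InnerProductSpace ℝ E] (a g : E) :
    2 * inner ℝ a g - ‖g‖ ^ 2 ≤ ‖a‖ ^ 2 := by
  have := norm_sub_sq_real a g
  nlinarith [sq_nonneg ‖a - g‖]

/-- The stability estimate averaged over the time interval `(σ, σ')`, tested with `g`. -/
theorem IsEntropySolution.averaged_stability (hT : 0 < T) (S : IsStateSet U f η q C Cf ηlow ηup)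
    (hu : IsEntropySolution U f η q T u₀ u)
    (huC : ∀ᵐ p ∂(volume.restrict (strip T)), u p.1 p.2 ∈ C) (hu₀C : ∀ᵐ x, u₀ x ∈ C)
    (hv : LipschitzWith L (fun p : ℝ × ℝ => v p.1 p.2)) (hvC : ∀ t x, v t x ∈ C)
    {G : ℝ → ℝ} {B : ℝ} (hGm : Measurable G) (hG0 : ∀ r, 0 ≤ G r) (hGB : ∀ r, G r ≤ B)
    (hG : ∀ᵐ p ∂(volume.restrict (strip T)), ‖spaceDeriv v p‖ ≤ G p.1)
    {σ σ' τ : ℝ} (hσ0 : 0 ≤ σ) (hσ : σ < σ') (hσ' : σ' < τ) (hτ : τ ≤ T)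
    (hR : Integrable (fun p => ‖flowResidual f v p‖ ^ 2) (volume.restrict (strip τ)))
    (hI : Integrable (fun x => ‖u₀ x - v 0 x‖ ^ 2))
    {g : ℝ → Vec m} (hg : Continuous g) (hgc : HasCompactSupport g) :
    (σ' - σ)⁻¹ * ∫ t in Ioo σ σ', expWeight (growthRate Cf ηlow ηup G) t * (ηlow / 2)
        * ∫ x, (2 * inner ℝ (u t x - v t x) (g x) - ‖g x‖ ^ 2)
      ≤ ((∫ p in strip τ, ‖flowResidual f v p‖ ^ 2) + ηup * ∫ x, ‖u₀ x - v 0 x‖ ^ 2) / 2 := by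
  have hlow := S.low_pos
  have hup := S.up_pos
  obtain ⟨s, hs0, hs⟩ := S.exists_relEntropyFlux_le
  obtain ⟨ρ, hρ⟩ : ∃ ρ : ℝ, ∀ x, g x ≠ 0 → |x| ≤ ρ := by
    obtain ⟨ρ, hρ⟩ := hgc.isBounded.subset_closedBall 0
    exact ⟨ρ, fun x hx => by
      simpa [Real.norm_eq_abs] using hρ (subset_tsupport _ (show x ∈ Function.support g from hx))⟩
  set a := growthRate Cf ηlow ηup G with ha
  have ham : Measurable a := measurable_growthRate hGm
  have ha0 : ∀ r, 0 ≤ a r := growthRate_nonneg S hG0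
  have haB := growthRate_le S hG0 hGB
  have haneg : ∀ r ≤ 0, a r = 0 := fun r hr => growthRate_of_nonpos hr
  have hφ : IsTestFunction T (stabilityTest a σ σ' s τ ρ) :=
    isTestFunction_stabilityTest ham ha0 haB ((ha0 0).trans (haB 0)) haneg hs0 hσ
      (hσ'.trans_le hτ)
  obtain ⟨hi₁, hi₂, hineq⟩ := hu.relEntropy_inequality hT S huC hu₀C hv hvC hφ
    stabilityTest_nonneg
  set h : ℝ × ℝ → ℝ := fun p => expWeight a p.1 * (ηlow / 2)
    * (2 * inner ℝ (u p.1 p.2 - v p.1 p.2) (g p.2) - ‖g p.2‖ ^ 2) with hh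
  have hsub : strip τ ⊆ strip T := prod_mono (Ioo_subset_Ioo_right hτ) subset_rfl
  have hmeas : MeasurableSet (strip τ) := measurableSet_Ioo.prod MeasurableSet.univ
  have hmeasT : MeasurableSet (strip T) := measurableSet_Ioo.prod MeasurableSet.univ
  have hmeasσ : MeasurableSet (Ioo σ σ' ×ˢ (univ : Set ℝ)) :=
    measurableSet_Ioo.prod MeasurableSet.univ
  have hσsub : Ioo σ σ' ×ˢ (univ : Set ℝ) ⊆ strip T :=
    prod_mono (Ioo_subset_Ioo hσ0 (hσ'.le.trans hτ)) subset_rfl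
  -- integrability of the comparison functions
  have hhi : Integrable h (volume.restrict (strip T)) := by
    obtain ⟨Bc, hBc⟩ := S.compact.isBounded.exists_norm_le
    have hgi : Integrable (fun p : ℝ × ℝ => 4 * Bc * ‖g p.2‖ + ‖g p.2‖ ^ 2)
        (volume.restrict (strip T)) := by
      rw [restrict_strip]
      have h1 : Integrable (fun x => 4 * Bc * ‖g x‖ + ‖g x‖ ^ 2) := by
        refine Integrable.add ((hg.integrable_of_hasCompactSupport hgc).norm.const_mul _) ?_
        refine Continuous.integrable_of_hasCompactSupport (by fun_prop) ?_
        exact hgc.comp_left (g := fun z : Vec m => ‖z‖ ^ 2) (by simp)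
      exact h1.comp_snd _
    have hum := hu.aestronglyMeasurable
    have hvm : AEStronglyMeasurable (fun p : ℝ × ℝ => v p.1 p.2) (volume.restrict (strip T)) :=
      hv.continuous.aestronglyMeasurable
    have hgm : AEStronglyMeasurable (fun p : ℝ × ℝ => g p.2) (volume.restrict (strip T)) :=
      (hg.comp continuous_snd).aestronglyMeasurable
    have hem : AEStronglyMeasurable (fun p : ℝ × ℝ => expWeight a p.1)
        (volume.restrict (strip T)) :=
      ((lipschitzWith_expWeight ham ha0 haB ((ha0 0).trans (haB 0)) haneg).continuous.comp
        continuous_fst).aestronglyMeasurable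
    refine (hgi.const_mul (ηlow / 2)).mono' ((hem.mul_const _).mul
      ((((hum.sub hvm).inner hgm).const_mul 2).sub (hgm.norm.pow 2))) ?_
    filter_upwards [huC] with p hp
    have h1 : |inner ℝ (u p.1 p.2 - v p.1 p.2) (g p.2)| ≤ 2 * Bc * ‖g p.2‖ := by
      refine (abs_real_inner_le_norm _ _).trans ?_
      gcongr
      refine (norm_sub_le _ _).trans ?_
      linarith [hBc _ hp, hBc _ (hvC p.1 p.2)]
    have h2 : |2 * inner ℝ (u p.1 p.2 - v p.1 p.2) (g p.2) - ‖g p.2‖ ^ 2|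
        ≤ 4 * Bc * ‖g p.2‖ + ‖g p.2‖ ^ 2 := by
      have := abs_le.1 h1
      rw [abs_le]
      constructor <;> nlinarith [sq_nonneg ‖g p.2‖]
    rw [hh, Real.norm_eq_abs, abs_mul, abs_mul, abs_of_pos (expWeight_pos _),
      abs_of_pos (by positivity : 0 < ηlow / 2)]
    have h3 := expWeight_le_one ha0 haneg p.1
    have h4 := (expWeight_pos (a := a) p.1).le
    calc _ ≤ 1 * (ηlow / 2) * (4 * Bc * ‖g p.2‖ + ‖g p.2‖ ^ 2) := by gcongr
      _ = _ := by ring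
  have hRi : Integrable ((strip τ).indicator fun p => ‖flowResidual f v p‖ ^ 2 / 2)
      (volume.restrict (strip T)) := by
    rw [integrable_indicator_iff hmeas, IntegrableOn, Measure.restrict_restrict hmeas,
      inter_eq_self_of_subset_left hsub]
    exact hR.div_const 2
  have hhσ : Integrable ((Ioo σ σ' ×ˢ (univ : Set ℝ)).indicator h)
      (volume.restrict (strip T)) := hhi.indicator hmeasσ
  -- the pointwise estimate
  have hpt : ∀ᵐ p ∂(volume.restrict (strip T)),
      timeDeriv (stabilityTest a σ σ' s τ ρ) p * relEntropy η (u p.1 p.2) (v p.1 p.2)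
          + spaceDeriv (stabilityTest a σ σ' s τ ρ) p
            * relEntropyFlux f η q (u p.1 p.2) (v p.1 p.2)
          - stabilityTest a σ σ' s τ ρ p.1 p.2 *
            (fderiv ℝ (fderiv ℝ η) (v p.1 p.2) (timeDeriv v p) (u p.1 p.2 - v p.1 p.2)
            + fderiv ℝ (fderiv ℝ η) (v p.1 p.2) (spaceDeriv v p)
              (f (u p.1 p.2) - f (v p.1 p.2)))
        ≤ -(σ' - σ)⁻¹ * (Ioo σ σ' ×ˢ (univ : Set ℝ)).indicator h p
          + (strip τ).indicator (fun p => ‖flowResidual f v p‖ ^ 2 / 2) p := by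
    filter_upwards [huC, hG, ae_restrict_mem hmeasT,
      ae_restrict_of_ae (ae_deriv_stabilityTest (σ := σ) (σ' := σ') (τ := τ) (ρ := ρ)
        ham ha0 haB hs0 hσ),
      ae_restrict_of_ae hv.ae_differentiableAt] with p hpC hpG hpT hpd hpv
    have hp0 : 0 < p.1 := hpT.1.1
    obtain ⟨hψ, ht, hx⟩ := hpd hp0
    have hap : a p.1 = ηlow⁻¹ * (ηup * Cf * G p.1 + ηup ^ 2) :=
      indicator_of_mem (show p.1 ∈ Ioi (0 : ℝ) from hp0) _
    have key := pointwise_stability S hs hpC (hvC p.1 p.2) hpG (vt := timeDeriv v p)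
      (timeCutoff_nonneg σ σ' p.1) (expWeight_pos (a := a) p.1).le
      (unitClamp_nonneg (ρ + 1 + s * (τ - p.1) - |p.2|))
      (timeDeriv_coneWeight_add_le (τ := τ) (ρ := ρ) hs0 hψ)
      (κ := (Ioo σ σ').indicator (fun _ => -(σ' - σ)⁻¹) p.1)
    rw [← hap, ← flowResidual_eq S hvC hpv] at key
    rw [ht, hx]
    refine key.trans (add_le_add ?_ ?_)
    · by_cases hmem : p.1 ∈ Ioo σ σ'
      · rw [indicator_of_mem hmem, indicator_of_mem (show p ∈ Ioo σ σ' ×ˢ univ from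
          ⟨hmem, mem_univ _⟩)]
        have hrel := (S.relEntropy_bounds hpC (hvC p.1 p.2)).1
        have hrel0 : 0 ≤ relEntropy η (u p.1 p.2) (v p.1 p.2) := le_trans (by positivity) hrel
        have hle : ηlow / 2 * (2 * inner ℝ (u p.1 p.2 - v p.1 p.2) (g p.2) - ‖g p.2‖ ^ 2)
            ≤ coneWeight s τ ρ p.1 p.2 * relEntropy η (u p.1 p.2) (v p.1 p.2) := by
          by_cases hgx : g p.2 = 0
          · simp only [hgx, inner_zero_right, norm_zero]
            have := mul_nonneg (unitClamp_nonneg (ρ + 1 + s * (τ - p.1) - |p.2|)) hrel0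
            simpa [coneWeight] using this
          · rw [coneWeight_eq_one hs0 (hmem.2.trans hσ').le (hρ _ hgx), one_mul]
            refine le_trans ?_ hrel
            gcongr
            exact two_inner_sub_le _ _
        have h1 : 0 ≤ (σ' - σ)⁻¹ * expWeight a p.1 :=
          mul_nonneg (inv_nonneg.2 (by linarith)) (expWeight_pos _).le
        have h2 := mul_le_mul_of_nonneg_left hle h1
        change _ * expWeight a p.1 * coneWeight s τ ρ p.1 p.2 * _ ≤ _
        rw [hh]
        linarith
      · rw [indicator_of_notMem hmem, indicator_of_notMem (fun hp => hmem hp.1)]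
        simp
    · have hR0 : 0 ≤ ‖flowResidual f v p‖ ^ 2 / 2 := by positivity
      by_cases hmem : p ∈ strip τ
      · rw [indicator_of_mem hmem]
        exact mul_le_of_le_one_left hR0 (stabilityTest_le_one (σ := σ) (σ' := σ') (s := s)
          (τ := τ) (ρ := ρ) ha0 haneg p.1 p.2)
      · have : τ ≤ p.1 := by
          by_contra hlt
          exact hmem ⟨⟨hp0, not_le.1 hlt⟩, mem_univ _⟩
        rw [indicator_of_notMem hmem, timeCutoff_of_le hσ (hσ'.le.trans this)]
        simp
  -- integrate
  have hupper := integral_mono_ae hi₁ ((hhσ.const_mul (-(σ' - σ)⁻¹)).add hRi) hpt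
  have hinit : ∫ x, stabilityTest a σ σ' s τ ρ 0 x * relEntropy η (u₀ x) (v 0 x)
      ≤ ∫ x, ηup / 2 * ‖u₀ x - v 0 x‖ ^ 2 := by
    refine integral_mono_ae hi₂ (hI.const_mul _) ?_
    filter_upwards [hu₀C] with x hx
    obtain ⟨hb1, hb2⟩ := S.relEntropy_bounds hx (hvC 0 x)
    have hb0 : 0 ≤ relEntropy η (u₀ x) (v 0 x) := le_trans (by positivity) hb1
    exact (mul_le_of_le_one_left hb0 (stabilityTest_le_one ha0 haneg 0 x)).trans hb2
  simp only [Pi.add_apply] at hupper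
  rw [integral_add (hhσ.const_mul _) hRi, integral_const_mul, integral_indicator hmeas,
    Measure.restrict_restrict hmeas, inter_eq_self_of_subset_left hsub,
    integral_indicator hmeasσ, Measure.restrict_restrict hmeasσ,
    inter_eq_self_of_subset_left hσsub, integral_div] at hupper
  rw [integral_const_mul] at hinit
  have hfub : ∫ p in Ioo σ σ' ×ˢ (univ : Set ℝ), h p
      = ∫ t in Ioo σ σ', expWeight a t * (ηlow / 2)
        * ∫ x, (2 * inner ℝ (u t x - v t x) (g x) - ‖g x‖ ^ 2) := by
    have hhi' : Integrable h (volume.restrict (Ioo σ σ' ×ˢ (univ : Set ℝ))) :=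
      hhi.mono_measure (Measure.restrict_mono hσsub le_rfl)
    rw [Measure.volume_eq_prod, ← Measure.prod_restrict, Measure.restrict_univ] at hhi' ⊢
    rw [integral_prod _ hhi']
    congr 1
    ext t
    rw [← integral_const_mul]
  rw [hfub] at hupper
  linarith

end Estimate

/-! ### Time slices and initial values of entropy solutions -/

/-- Averages of a function with values in a closed convex set stay in the set. -/
theorem Convex.integral_smul_mem {m : ℕ} {C : Set (Vec m)} (hC : Convex ℝ C) (hCc : IsClosed C)
    {g : ℝ → ℝ} (hg : Measurable g) (hg0 : ∀ x, 0 ≤ g x) (hg1 : ∫ x, g x = 1) {w : ℝ → Vec m}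
    (hw : ∀ᵐ x, w x ∈ C) (hi : Integrable (fun x => g x • w x)) : ∫ x, g x • w x ∈ C := by
  set G : ℝ → ℝ≥0 := fun x => (g x).toNNReal with hG
  have hGm : Measurable G := hg.real_toNNReal
  have hGg : ∀ x, (G x : ℝ) = g x := fun x => Real.coe_toNNReal _ (hg0 x)
  set μ : Measure ℝ := volume.withDensity fun x => (G x : ℝ≥0∞) with hμ
  have hgi : Integrable g := by
    by_contra hni
    rw [integral_undef hni] at hg1
    exact zero_ne_one hg1
  have hprob : IsProbabilityMeasure μ := by
    refine ⟨?_⟩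
    rw [hμ, withDensity_apply _ MeasurableSet.univ, Measure.restrict_univ]
    change ∫⁻ x, ENNReal.ofReal (g x) = 1
    rw [← ofReal_integral_eq_lintegral_ofReal hgi (Filter.Eventually.of_forall hg0), hg1,
      ENNReal.ofReal_one]
  have hsm : (fun x => g x • w x) = fun x => G x • w x := by
    ext1 x
    rw [NNReal.smul_def, hGg]
  rw [hsm] at hi ⊢
  rw [← integral_withDensity_eq_integral_smul hGm]
  refine hC.integral_mem hCc (withDensity_absolutelyContinuous _ _ hw) ?_
  exact (integrable_withDensity_iff_integrable_smul hGm).2 hi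

theorem lipschitzWith_mul_slices {χ g : ℝ → ℝ} {K L : ℝ≥0} (hχ : LipschitzWith K χ)
    (hg : LipschitzWith L g) {A B : ℝ≥0} (hA : ∀ t, |χ t| ≤ A) (hB : ∀ x, |g x| ≤ B) :
    ∃ M : ℝ≥0, LipschitzWith M (fun p : ℝ × ℝ => χ p.1 * g p.2) :=
  ⟨_, lipschitzWith_mul_of_bounded (hχ.comp LipschitzWith.prod_fst)
    (hg.comp LipschitzWith.prod_snd) (fun p => hA p.1) (fun p => hB p.2)⟩

/-- A cut-off in time multiplied by a Lipschitz compactly supported function of space. -/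
theorem isTestFunction_timeCutoff_mul {T σ σ' : ℝ} (hσ : σ < σ') (hσ' : σ' < T) {g : ℝ → ℝ}
    {L : ℝ≥0} (hg : LipschitzWith L g) (hgc : HasCompactSupport g) :
    IsTestFunction T (fun t x => timeCutoff σ σ' t * g x) := by
  obtain ⟨K, hK⟩ := exists_lipschitzWith_timeCutoff (σ := σ) (σ' := σ')
  obtain ⟨B, hB⟩ := hgc.exists_bound_of_continuous hg.continuous
  refine ⟨lipschitzWith_mul_slices hK hg (A := 1) (B := ⟨max B 0, le_max_right _ _⟩)
    (fun t => ?_) (fun x => (hB x).trans (le_max_left _ _)), ?_, ?_⟩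
  · rw [abs_of_nonneg (timeCutoff_nonneg _ _ _)]
    exact timeCutoff_le_one _ _ _
  · refine HasCompactSupport.intro ((isCompact_Icc (a := -1) (b := σ')).prod hgc) fun p hp => ?_
    by_contra hne
    refine hp ⟨⟨?_, ?_⟩, ?_⟩
    · by_contra h
      exact hne (by simp [timeCutoff_of_le_neg_one (not_le.1 h).le])
    · by_contra h
      exact hne (by simp [timeCutoff_of_le hσ (not_le.1 h).le])
    · by_contra h
      exact hne (by simp [image_eq_zero_of_notMem_tsupport h])
  · have hcl : IsClosed (Iic σ' ×ˢ (univ : Set ℝ)) := isClosed_Iic.prod isClosed_univ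
    refine (closure_minimal ?_ hcl).trans (prod_mono (Iic_subset_Iio.2 hσ') subset_rfl)
    intro p hp
    refine ⟨?_, mem_univ _⟩
    by_contra h
    exact hp (by simp [timeCutoff_of_le hσ (not_le.1 h).le])

section Slices

variable {m : ℕ} {U : Set (Vec m)} {f : Vec m → Vec m} {η q : Vec m → ℝ} {C : Set (Vec m)}
  {Cf ηlow ηup T : ℝ} {u₀ : ℝ → Vec m} {u : ℝ → ℝ → Vec m}

/-- By weak continuity every time slice of the solution takes its values in `C`. -/
theorem IsEntropySolution.slice_mem (hT : 0 < T) (hCconv : Convex ℝ C) (hCc : IsClosed C)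
    (hu : IsEntropySolution U f η q T u₀ u)
    (huC : ∀ᵐ p ∂(volume.restrict (strip T)), u p.1 p.2 ∈ C) {t : ℝ} (ht : t ∈ Icc 0 T) :
    ∀ᵐ x, u t x ∈ C := by
  rw [restrict_strip] at huC
  have h1 : ∀ᵐ r : ℝ, r ∈ Ioo 0 T → ∀ᵐ x, u r x ∈ C :=
    (ae_restrict_iff' measurableSet_Ioo).1 (Measure.ae_ae_of_ae_prod huC)
  have hdense := Measure.dense_of_ae h1
  have hcl : t ∈ closure (Ioo 0 T ∩ {r | r ∈ Ioo 0 T → ∀ᵐ x, u r x ∈ C}) := by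
    have h2 := closure_minimal (hdense.open_subset_closure_inter (isOpen_Ioo (a := 0) (b := T)))
      isClosed_closure
    rw [closure_Ioo hT.ne] at h2
    exact h2 ht
  have havg : ∀ g : ℝ → ℝ, Continuous g → HasCompactSupport g → (∀ x, 0 ≤ g x) →
      ∫ x, g x = 1 → ∫ x, g x • u t x ∈ C := fun g hg hgc hg0 hg1 => by
    have hcont := (hu.weakCont g hg hgc t ht).mono
      (inter_subset_left.trans Ioo_subset_Icc_self : _ ∩ {r | r ∈ Ioo 0 T → ∀ᵐ x, u r x ∈ C} ⊆ _)
    have := hcont.mem_closure hcl (t := C) fun r hr =>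
      hCconv.integral_smul_mem hCc hg.measurable hg0 hg1 (hr.2 hr.1)
        ((hu.locInt_slice r (Ioo_subset_Icc_self hr.1)).integrable_smul_left_of_hasCompactSupport
          hg hgc)
    rwa [hCc.closure_eq] at this
  -- mollifiers of radius `2 / (n + 1)`
  set b : ℕ → ContDiffBump (0 : ℝ) := fun n =>
    ⟨1 / ((n : ℝ) + 1), 2 / ((n : ℝ) + 1), by positivity, by gcongr; norm_num⟩ with hb
  have hlim : Filter.Tendsto (fun n => (b n).rOut) Filter.atTop (nhds 0) := by
    have := (tendsto_one_div_add_atTop_nhds_zero_nat (𝕜 := ℝ)).const_mul 2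
    rw [mul_zero] at this
    refine this.congr fun n => ?_
    simp only [hb]
    ring
  filter_upwards [ContDiffBump.ae_convolution_tendsto_right_of_locallyIntegrable (K := 2) hlim
    (Filter.Eventually.of_forall fun n => le_of_eq (by simp only [hb]; ring))
    (hu.locInt_slice t ht)] with x hx
  refine hCc.mem_of_tendsto hx (Filter.Eventually.of_forall fun n => ?_)
  rw [convolution_lsmul_swap]
  refine havg (fun y => (b n).normed volume (x - y)) ?_ ?_ ?_ ?_
  · exact (b n).continuous_normed.comp (by fun_prop)
  · exact (b n).hasCompactSupport_normed.comp_homeomorph (Homeomorph.subLeft x)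
  · exact fun y => (b n).nonneg_normed _
  · rw [integral_sub_left_eq_self (fun y => (b n).normed volume y), (b n).integral_normed]

/-- The weakly continuous representative attains the initial datum. -/
theorem IsEntropySolution.init_eq (hT : 0 < T) (S : IsStateSet U f η q C Cf ηlow ηup)
    (hu : IsEntropySolution U f η q T u₀ u)
    (huC : ∀ᵐ p ∂(volume.restrict (strip T)), u p.1 p.2 ∈ C) : ∀ᵐ x, u₀ x = u 0 x := by
  have h0T : (0 : ℝ) ∈ Icc 0 T := left_mem_Icc.2 hT.le
  refine ae_eq_of_integral_contDiff_smul_eq hu.locInt_init (hu.locInt_slice 0 h0T)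
    fun g hg hgc => ?_
  obtain ⟨L, hL⟩ := ContDiff.lipschitzWith_of_hasCompactSupport hgc hg (by simp)
  set F : ℝ → Vec m := fun t => ∫ x, g x • u t x with hF
  have hFc : ContinuousOn F (Icc 0 T) := hu.weakCont g hg.continuous hgc
  obtain ⟨B, hB⟩ := S.compact.exists_bound_of_continuousOn
    (fun c hc => (S.contDiffAt_flux hc).continuousAt.continuousWithinAt : ContinuousOn f C)
  have hgi : Integrable g := hg.continuous.integrable_of_hasCompactSupport hgc
  have hdgi : Integrable (deriv g) :=
    (hg.continuous_deriv (by simp)).integrable_of_hasCompactSupport hgc.deriv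
  have hmeasT : MeasurableSet (strip T) := measurableSet_Ioo.prod MeasurableSet.univ
  have hgu : Integrable (fun p : ℝ × ℝ => g p.2 • u p.1 p.2) (volume.restrict (strip T)) := by
    obtain ⟨B', hB'⟩ := ae_bounded_comp S (g := id) continuousOn_id huC
    refine integrable_smul_of_ae_bounded ?_ hu.aestronglyMeasurable hB'
    rw [restrict_strip]
    exact hgi.comp_snd _
  set K := |B| * ∫ x, |deriv g x| with hK
  have hK0 : 0 ≤ K := mul_nonneg (abs_nonneg _) (integral_nonneg fun x => abs_nonneg _)
  -- the weak formulation with a cut-off in time on the scale `δ`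
  have key : ∀ δ : ℝ, 0 < δ → δ < T →
      ‖(∫ x, g x • u₀ x) - δ⁻¹ • ∫ t in Ioo 0 δ, F t‖ ≤ δ * K := by
    intro δ hδ hδT
    have hφ := isTestFunction_timeCutoff_mul hδ hδT hL hgc
    have hw := hu.weak _ hφ
    have hδsub : Ioo 0 δ ×ˢ (univ : Set ℝ) ⊆ strip T :=
      prod_mono (Ioo_subset_Ioo_right hδT.le) subset_rfl
    have hδm : MeasurableSet (Ioo 0 δ ×ˢ (univ : Set ℝ)) :=
      measurableSet_Ioo.prod MeasurableSet.univ
    have hχ0 : timeCutoff 0 δ 0 = 1 := by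
      rw [timeCutoff, unitClamp_of_one_le (by simp), unitClamp_of_one_le, one_mul]
      rw [sub_zero, div_self hδ.ne']
    have hfst := (Measure.quasiMeasurePreserving_fst (μ := (volume : Measure ℝ))
      (ν := (volume : Measure ℝ)))
    have hae : (fun p : ℝ × ℝ => timeDeriv (fun t x => timeCutoff 0 δ t * g x) p • u p.1 p.2
          + spaceDeriv (fun t x => timeCutoff 0 δ t * g x) p • f (u p.1 p.2))
        =ᵐ[volume.restrict (strip T)] fun p =>
          (-δ⁻¹) • (Ioo 0 δ ×ˢ (univ : Set ℝ)).indicator (fun p => g p.2 • u p.1 p.2) p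
            + (timeCutoff 0 δ p.1 * deriv g p.2) • f (u p.1 p.2) := by
      filter_upwards [ae_restrict_mem hmeasT,
        ae_restrict_of_ae (hfst.ae (Measure.ae_ne volume δ))] with p hp hne
      have h1 := ((hasDerivAt_timeCutoff hδ hp.1.1 hp.1.1.ne' hne).mul_const (g p.2)).deriv
      have h2 : spaceDeriv (fun t x => timeCutoff 0 δ t * g x) p
          = timeCutoff 0 δ p.1 * deriv g p.2 := deriv_const_mul_field _
      have h3 : timeDeriv (fun t x => timeCutoff 0 δ t * g x) p
          = (Ioo 0 δ).indicator (fun _ => -(δ - 0)⁻¹) p.1 * g p.2 := h1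
      rw [h2, h3]
      congr 1
      by_cases hm : p.1 ∈ Ioo 0 δ
      · rw [indicator_of_mem hm, indicator_of_mem (show p ∈ Ioo 0 δ ×ˢ univ from
          ⟨hm, mem_univ _⟩), sub_zero, mul_smul]
      · rw [indicator_of_notMem hm, indicator_of_notMem (fun h => hm h.1)]
        simp
    have hi₁ : Integrable (fun p => (-δ⁻¹) • (Ioo 0 δ ×ˢ (univ : Set ℝ)).indicator
        (fun p => g p.2 • u p.1 p.2) p) (volume.restrict (strip T)) :=
      (hgu.indicator hδm).smul (-δ⁻¹)
    have hbi : Integrable ((Ioo 0 δ ×ˢ (univ : Set ℝ)).indicator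
        fun p : ℝ × ℝ => |B| * |deriv g p.2|) (volume.restrict (strip T)) := by
      refine Integrable.indicator ?_ hδm
      rw [restrict_strip]
      exact (hdgi.abs.const_mul _).comp_snd _
    have hbound : ∀ᵐ p ∂(volume.restrict (strip T)),
        ‖(timeCutoff 0 δ p.1 * deriv g p.2) • f (u p.1 p.2)‖
          ≤ (Ioo 0 δ ×ˢ (univ : Set ℝ)).indicator
            (fun p : ℝ × ℝ => |B| * |deriv g p.2|) p := by
      filter_upwards [huC, ae_restrict_mem hmeasT] with p hp hpT
      by_cases hm : p.1 < δ
      · rw [indicator_of_mem (show p ∈ Ioo 0 δ ×ˢ univ from ⟨⟨hpT.1.1, hm⟩, mem_univ _⟩),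
          norm_smul, Real.norm_eq_abs, abs_mul, abs_of_nonneg (timeCutoff_nonneg _ _ _), mul_comm]
        refine mul_le_mul ((hB _ hp).trans (le_abs_self _)) ?_
          (mul_nonneg (timeCutoff_nonneg _ _ _) (abs_nonneg _)) (abs_nonneg _)
        exact mul_le_of_le_one_left (abs_nonneg _) (timeCutoff_le_one _ _ _)
      · rw [timeCutoff_of_le hδ (not_lt.1 hm), zero_mul, zero_smul, norm_zero]
        exact indicator_nonneg (fun _ _ => by positivity) _
    have hi₂ : Integrable (fun p : ℝ × ℝ => (timeCutoff 0 δ p.1 * deriv g p.2) • f (u p.1 p.2))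
        (volume.restrict (strip T)) := by
      refine hbi.mono' ?_ hbound
      obtain ⟨Kχ, hKχ⟩ := exists_lipschitzWith_timeCutoff (σ := 0) (σ' := δ)
      exact (((hKχ.continuous.comp continuous_fst).mul
        ((hg.continuous_deriv (by simp)).comp continuous_snd)).aestronglyMeasurable).smul
        hu.aestronglyMeasurable_flux
    change (∫ p in strip T, (timeDeriv (fun t x => timeCutoff 0 δ t * g x) p • u p.1 p.2
          + spaceDeriv (fun t x => timeCutoff 0 δ t * g x) p • f (u p.1 p.2)))
        + ∫ x, (timeCutoff 0 δ 0 * g x) • u₀ x = 0 at hw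
    rw [integral_congr_ae hae, integral_add hi₁ hi₂, integral_smul, integral_indicator hδm,
      Measure.restrict_restrict hδm, inter_eq_self_of_subset_left hδsub] at hw
    simp only [hχ0, one_mul] at hw
    have hfub : ∫ p in Ioo 0 δ ×ˢ (univ : Set ℝ), g p.2 • u p.1 p.2 = ∫ t in Ioo 0 δ, F t := by
      have h1 : Integrable (fun p : ℝ × ℝ => g p.2 • u p.1 p.2)
          (volume.restrict (Ioo 0 δ ×ˢ (univ : Set ℝ))) :=
        hgu.mono_measure (Measure.restrict_mono hδsub le_rfl)
      rw [Measure.volume_eq_prod, ← Measure.prod_restrict, Measure.restrict_univ] at h1 ⊢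
      rw [integral_prod _ h1]
    rw [hfub] at hw
    have heq : (∫ x, g x • u₀ x) - δ⁻¹ • ∫ t in Ioo 0 δ, F t
        = -∫ p in strip T, (timeCutoff 0 δ p.1 * deriv g p.2) • f (u p.1 p.2) := by
      rw [neg_smul] at hw
      rw [eq_neg_iff_add_eq_zero, ← hw]
      abel
    rw [heq, norm_neg]
    refine (norm_integral_le_of_norm_le hbi hbound).trans (le_of_eq ?_)
    rw [integral_indicator hδm, Measure.restrict_restrict hδm,
      inter_eq_self_of_subset_left hδsub, integral_const_mul]
    have h2 := setIntegral_prod_mul (μ := (volume : Measure ℝ)) (ν := (volume : Measure ℝ))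
      (fun _ : ℝ => (1 : ℝ)) (fun x => |deriv g x|) (Ioo 0 δ) univ
    simp only [one_mul] at h2
    rw [Measure.volume_eq_prod, h2]
    simp [hδ.le, hK]
    ring
  refine eq_of_forall_dist_le fun ε hε => ?_
  obtain ⟨δ₀, hδ₀, hδ₀F⟩ := Metric.continuousWithinAt_iff.1 (hFc 0 h0T) (ε / 2) (half_pos hε)
  set δ := min (min (δ₀ / 2) (T / 2)) (ε / 2 / (K + 1)) with hδdef
  have hδ : 0 < δ := by positivity
  have hδ1 : δ ≤ δ₀ / 2 := (min_le_left _ _).trans (min_le_left _ _)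
  have hδ2 : δ ≤ T / 2 := (min_le_left _ _).trans (min_le_right _ _)
  have hδ3 : δ * K ≤ ε / 2 := by
    have h1 : δ * (K + 1) ≤ ε / 2 := (le_div_iff₀ (by linarith)).1 (min_le_right _ _)
    nlinarith
  have h1 := key δ hδ (by linarith)
  have hFi : IntegrableOn F (Ioo 0 δ) :=
    ((hFc.mono (Icc_subset_Icc_right (by linarith))).integrableOn_Icc).mono_set
      Ioo_subset_Icc_self
  have h2 : ‖δ⁻¹ • (∫ t in Ioo 0 δ, F t) - F 0‖ ≤ ε / 2 := by
    have e : δ⁻¹ • (∫ t in Ioo 0 δ, F t) - F 0 = δ⁻¹ • ∫ t in Ioo 0 δ, (F t - F 0) := by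
      rw [integral_sub hFi (by simp), smul_sub]
      simp [hδ.le, smul_smul, inv_mul_cancel₀ hδ.ne']
    rw [e, norm_smul, norm_inv, Real.norm_of_nonneg hδ.le, inv_mul_le_iff₀ hδ]
    have h3 := norm_setIntegral_le_of_norm_le_const (μ := volume) (s := Ioo 0 δ)
      (f := fun t => F t - F 0) (C := ε / 2) (by simp) fun t ht => by
        rw [← dist_eq_norm]
        refine (hδ₀F ⟨ht.1.le, by linarith [ht.2]⟩ ?_).le
        rw [Real.dist_eq, sub_zero, abs_of_pos ht.1]
        linarith [ht.2]
    simpa [hδ.le, mul_comm] using h3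
  rw [dist_eq_norm]
  calc _ = ‖((∫ x, g x • u₀ x) - δ⁻¹ • ∫ t in Ioo 0 δ, F t)
        + (δ⁻¹ • (∫ t in Ioo 0 δ, F t) - F 0)‖ := by
        rw [sub_add_sub_cancel]
    _ ≤ _ := (norm_add_le _ _).trans (by linarith)

end Slices

/-! ### Duality in `L²` and stability at every time -/

theorem integrable_sq_norm_of_hasCompactSupport {m : ℕ} {g : ℝ → Vec m} (hg : Continuous g)
    (hgc : HasCompactSupport g) : Integrable (fun x => ‖g x‖ ^ 2) := by
  refine Continuous.integrable_of_hasCompactSupport (by fun_prop) ?_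
  exact hgc.comp_left (g := fun z : Vec m => ‖z‖ ^ 2) (by simp)

theorem integrable_sq_norm_smul {m : ℕ} {w : ℝ → Vec m} (hw : AEStronglyMeasurable w)
    {B : ℝ} (hB : ∀ᵐ x, ‖w x‖ ≤ B) {θ : ℝ → ℝ} (hθ : Continuous θ) (hθs : HasCompactSupport θ)
    (hθ0 : ∀ x, 0 ≤ θ x) (hθ1 : ∀ x, θ x ≤ 1) : Integrable (fun x => ‖θ x • w x‖ ^ 2) := by
  have h1 : Integrable (fun x => B ^ 2 * θ x) :=
    (hθ.integrable_of_hasCompactSupport hθs).const_mul _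
  refine h1.mono' ((hθ.aestronglyMeasurable.smul hw).norm.pow 2) ?_
  filter_upwards [hB] with x hx
  rw [Real.norm_of_nonneg (sq_nonneg _), norm_smul, Real.norm_of_nonneg (hθ0 x), mul_pow, mul_comm]
  have h2 : ‖w x‖ ^ 2 ≤ B ^ 2 := by gcongr
  have h3 : θ x ^ 2 ≤ θ x := by nlinarith [hθ0 x, hθ1 x]
  exact mul_le_mul h2 h3 (sq_nonneg _) (sq_nonneg _)

/-- Duality for the `L²` norm of a bounded function `w` localized by a cut-off `θ`: test with `θ g`
for `g` close to `θ w` in `L²`. -/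
theorem integral_sq_norm_smul_le {m : ℕ} {w : ℝ → Vec m} (hw : AEStronglyMeasurable w)
    {B : ℝ} (hB : ∀ᵐ x, ‖w x‖ ≤ B) {K : ℝ}
    (h : ∀ g : ℝ → Vec m, Continuous g → HasCompactSupport g →
      ∫ x, (2 * inner ℝ (w x) (g x) - ‖g x‖ ^ 2) ≤ K) {θ : ℝ → ℝ} (hθ : Continuous θ)
    (hθs : HasCompactSupport θ) (hθ0 : ∀ x, 0 ≤ θ x) (hθ1 : ∀ x, θ x ≤ 1) :
    ∫ x, ‖θ x • w x‖ ^ 2 ≤ K := by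
  have hwm : AEStronglyMeasurable (fun x => θ x • w x) := hθ.aestronglyMeasurable.smul hw
  have hwn := integrable_sq_norm_smul hw hB hθ hθs hθ0 hθ1
  have hmem : MemLp (fun x => θ x • w x) 2 := (memLp_two_iff_integrable_sq_norm hwm).2 hwn
  refine le_of_forall_pos_le_add fun ε hε => ?_
  have hmem' : MemLp (fun x => θ x • w x) (ENNReal.ofReal 2) := by
    rwa [ENNReal.ofReal_ofNat]
  obtain ⟨g, hgc, hgε, hg, hgm'⟩ :=
    hmem'.exists_hasCompactSupport_integral_rpow_sub_le (by norm_num) hε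
  have hgm : MemLp g 2 := by rwa [ENNReal.ofReal_ofNat] at hgm'
  simp only [Real.rpow_ofNat] at hgε
  have hdiff : Integrable (fun x => ‖θ x • w x - g x‖ ^ 2) :=
    (memLp_two_iff_integrable_sq_norm (hwm.sub hgm.1)).1 (hmem.sub hgm)
  have hθg : Continuous fun x => θ x • g x := hθ.smul hg
  have hθgc : HasCompactSupport fun x => θ x • g x := hθs.smul_right
  have h1 := h (fun x => θ x • g x) hθg hθgc
  have hgi := integrable_sq_norm_of_hasCompactSupport hθg hθgc
  have hin : Integrable (fun x => 2 * inner ℝ (w x) (θ x • g x)) := by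
    have h2 : Integrable (fun x => inner ℝ (θ x • w x) (g x)) := by
      obtain ⟨A, hA⟩ := hgc.exists_bound_of_continuous hg
      have h3 : Integrable (fun x => B * ‖g x‖) :=
        (hg.integrable_of_hasCompactSupport hgc).norm.const_mul B
      refine h3.mono' (hwm.inner hgm.1) ?_
      filter_upwards [hB] with x hx
      refine (norm_inner_le_norm _ _).trans ?_
      rw [norm_smul, Real.norm_of_nonneg (hθ0 x)]
      refine mul_le_mul_of_nonneg_right ?_ (norm_nonneg _)
      exact (mul_le_of_le_one_left (norm_nonneg _) (hθ1 x)).trans hx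
    refine (h2.const_mul 2).congr (Filter.Eventually.of_forall fun x => ?_)
    simp only [real_inner_smul_left, real_inner_smul_right]
  have h3 : ∫ x, (‖θ x • w x‖ ^ 2 - ‖θ x • w x - g x‖ ^ 2)
      ≤ ∫ x, (2 * inner ℝ (w x) (θ x • g x) - ‖θ x • g x‖ ^ 2) := by
    refine integral_mono (hwn.sub hdiff) (hin.sub hgi) fun x => ?_
    have e1 := norm_sub_sq_real (θ x • w x) (g x)
    have e2 : inner ℝ (θ x • w x) (g x) = inner ℝ (w x) (θ x • g x) := by
      rw [real_inner_smul_left, real_inner_smul_right]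
    have e3 : ‖θ x • g x‖ ≤ ‖g x‖ := by
      rw [norm_smul, Real.norm_of_nonneg (hθ0 x)]
      exact mul_le_of_le_one_left (norm_nonneg _) (hθ1 x)
    have e4 : ‖θ x • g x‖ ^ 2 ≤ ‖g x‖ ^ 2 := pow_le_pow_left₀ (norm_nonneg _) e3 2
    rw [← e2]
    linarith
  rw [integral_sub hwn hdiff] at h3
  linarith

/-- Duality characterization of the `L²` norm of a bounded function. -/
theorem lintegral_sq_le_of_forall_test {m : ℕ} {w : ℝ → Vec m} (hw : AEStronglyMeasurable w)
    {B : ℝ} (hB : ∀ᵐ x, ‖w x‖ ≤ B) {K : ℝ}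
    (h : ∀ g : ℝ → Vec m, Continuous g → HasCompactSupport g →
      ∫ x, (2 * inner ℝ (w x) (g x) - ‖g x‖ ^ 2) ≤ K) :
    ∫⁻ x, ‖w x‖ₑ ^ 2 ≤ ENNReal.ofReal K := by
  set θ : ℕ → ℝ → ℝ := fun n x => unitClamp (n + 1 - |x|) with hθ
  have hθc : ∀ n, Continuous (θ n) := fun n =>
    lipschitzWith_unitClamp.continuous.comp (by fun_prop)
  have hθs : ∀ n, HasCompactSupport (θ n) := fun n =>
    HasCompactSupport.intro (isCompact_Icc (a := -((n : ℝ) + 1)) (b := (n : ℝ) + 1))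
      fun x hx => unitClamp_of_nonpos (by
        by_contra hlt
        exact hx (abs_le.1 (by linarith)))
  have hθ0 : ∀ n x, 0 ≤ θ n x := fun n x => unitClamp_nonneg _
  have hθ1 : ∀ n x, θ n x ≤ 1 := fun n x => unitClamp_le_one _
  have hlint : ∀ n, ∫⁻ x, ‖θ n x • w x‖ₑ ^ 2 ≤ ENNReal.ofReal K := fun n => by
    refine le_trans (le_of_eq ?_) (ENNReal.ofReal_le_ofReal
      (integral_sq_norm_smul_le hw hB h (hθc n) (hθs n) (hθ0 n) (hθ1 n)))
    rw [ofReal_integral_eq_lintegral_ofReal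
      (integrable_sq_norm_smul hw hB (hθc n) (hθs n) (hθ0 n) (hθ1 n))
      (Filter.Eventually.of_forall fun x => sq_nonneg _)]
    refine lintegral_congr fun x => ?_
    rw [ENNReal.ofReal_pow (norm_nonneg _), ofReal_norm]
  have hlim : ∀ x, Filter.liminf (fun n => ‖θ n x • w x‖ₑ ^ 2) Filter.atTop = ‖w x‖ₑ ^ 2 := by
    intro x
    refine (tendsto_const_nhds.congr' ?_).liminf_eq
    obtain ⟨N, hN⟩ := exists_nat_ge |x|
    filter_upwards [Filter.eventually_ge_atTop N] with n hn
    have : (N : ℝ) ≤ n := by exact_mod_cast hn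
    rw [show θ n x = 1 from unitClamp_of_one_le (by linarith), one_smul]
  calc ∫⁻ x, ‖w x‖ₑ ^ 2
      = ∫⁻ x, Filter.liminf (fun n => ‖θ n x • w x‖ₑ ^ 2) Filter.atTop := by simp_rw [hlim]
    _ ≤ Filter.liminf (fun n => ∫⁻ x, ‖θ n x • w x‖ₑ ^ 2) Filter.atTop :=
      lintegral_liminf_le' fun n => ((hθc n).aestronglyMeasurable.smul hw).enorm.pow_const 2
    _ ≤ Filter.liminf (fun _ : ℕ => ENNReal.ofReal K) Filter.atTop :=
      Filter.liminf_le_liminf (Filter.Eventually.of_forall hlint)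
    _ = ENNReal.ofReal K := Filter.liminf_const _

section Stability

variable {m : ℕ} {U : Set (Vec m)} {f : Vec m → Vec m} {η q : Vec m → ℝ} {C : Set (Vec m)}
  {Cf ηlow ηup T : ℝ} {u₀ : ℝ → Vec m} {u : ℝ → ℝ → Vec m} {v : ℝ → ℝ → Vec m} {L : ℝ≥0}

theorem integrable_inner_of_locallyIntegrable {w g : ℝ → Vec m} (hw : LocallyIntegrable w)
    (hg : Continuous g) (hgc : HasCompactSupport g) :
    Integrable (fun x => inner ℝ (w x) (g x)) ∧
      ∫ x, inner ℝ (w x) (g x) = ∑ i, (∫ x, g x i • w x) i := by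
  have hgi : ∀ i, Continuous fun x => g x i := fun i => by fun_prop
  have hgci : ∀ i, HasCompactSupport fun x => g x i := fun i =>
    hgc.comp_left (g := fun z : Vec m => z i) rfl
  have hi : ∀ i, Integrable (fun x => g x i • w x) := fun i =>
    hw.integrable_smul_left_of_hasCompactSupport (hgi i) (hgci i)
  have hj : ∀ i, Integrable (fun x => g x i * w x i) := fun i =>
    (EuclideanSpace.proj (𝕜 := ℝ) i).integrable_comp (hi i)
  have e : ∀ x, inner ℝ (w x) (g x) = ∑ i, g x i * w x i := fun x => by
    simp [PiLp.inner_apply]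
  simp_rw [e]
  refine ⟨integrable_finsetSum _ fun i _ => hj i, ?_⟩
  rw [integral_finsetSum _ fun i _ => hj i]
  exact Finset.sum_congr rfl fun i _ =>
    (EuclideanSpace.proj (𝕜 := ℝ) i).integral_comp_comm (hi i)

/-- Weak continuity in time of the functional used to test the distance of `u` and `v`. -/
theorem IsEntropySolution.continuousOn_test (hu : IsEntropySolution U f η q T u₀ u)
    (hv : LipschitzWith L (fun p : ℝ × ℝ => v p.1 p.2)) {g : ℝ → Vec m} (hg : Continuous g)
    (hgc : HasCompactSupport g) :
    ContinuousOn (fun t => ∫ x, (2 * inner ℝ (u t x - v t x) (g x) - ‖g x‖ ^ 2)) (Icc 0 T) := by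
  have hvt : ∀ t, Continuous (v t) := fun t => (lipschitzWith_space hv t).continuous
  have hgn := integrable_sq_norm_of_hasCompactSupport hg hgc
  have hvi : ∀ t, Integrable (fun x => inner ℝ (v t x) (g x)) := fun t =>
    (integrable_inner_of_locallyIntegrable (hvt t).locallyIntegrable hg hgc).1
  have e : ∀ t ∈ Icc 0 T, ∫ x, (2 * inner ℝ (u t x - v t x) (g x) - ‖g x‖ ^ 2)
      = 2 * (∑ i, (∫ x, g x i • u t x) i) - 2 * (∫ x, inner ℝ (v t x) (g x))
        - ∫ x, ‖g x‖ ^ 2 := fun t ht => by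
    obtain ⟨h1, h2⟩ := integrable_inner_of_locallyIntegrable (hu.locInt_slice t ht) hg hgc
    rw [← h2, ← integral_const_mul, ← integral_const_mul,
      ← integral_sub_sub (h1.const_mul 2) ((hvi t).const_mul 2) hgn]
    congr 1
    ext x
    rw [inner_sub_left]
    ring
  refine ContinuousOn.congr ?_ e
  refine ((ContinuousOn.const_smul ?_ (2 : ℝ)).sub (Continuous.continuousOn ?_)).sub
    continuousOn_const
  · refine continuousOn_finsetSum _ fun i _ => ?_
    exact (EuclideanSpace.proj (𝕜 := ℝ) i).continuous.comp_continuousOn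
      (hu.weakCont (fun x => g x i) (by fun_prop)
        (hgc.comp_left (g := fun z : Vec m => z i) rfl))
  · refine Continuous.const_mul ?_ _
    refine LipschitzWith.continuous (K := ⟨L * ∫ x, ‖g x‖, mul_nonneg L.2
      (integral_nonneg fun x => norm_nonneg _)⟩) (LipschitzWith.of_dist_le_mul fun t t' => ?_)
    rw [dist_eq_norm, ← integral_sub (hvi t) (hvi t')]
    have h1 : Integrable (fun x => L * dist t t' * ‖g x‖) :=
      (hg.integrable_of_hasCompactSupport hgc).norm.const_mul _
    refine (norm_integral_le_of_norm_le h1 (Filter.Eventually.of_forall fun x => ?_)).trans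
      (le_of_eq ?_)
    · rw [← inner_sub_left]
      refine (norm_inner_le_norm _ _).trans ?_
      gcongr
      rw [← dist_eq_norm]
      exact (lipschitzWith_time hv x).dist_le_mul t t'
    · rw [integral_const_mul]
      change _ = (L * ∫ x, ‖g x‖) * dist t t'
      ring

/-- A continuous function whose averages over intervals approaching `τ` from the left are bounded
by `b` is bounded by `b` at `τ`. -/
theorem le_of_averages_le {H : ℝ → ℝ} {τ b : ℝ} (hτ : 0 < τ) (hH : ContinuousOn H (Icc 0 τ))
    (h : ∀ σ σ', 0 ≤ σ → σ < σ' → σ' < τ → (σ' - σ)⁻¹ * ∫ t in Ioo σ σ', H t ≤ b) : H τ ≤ b := by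
  by_contra! hlt
  obtain ⟨c, hbc, hcH⟩ := exists_between hlt
  have hev := (hH τ (right_mem_Icc.2 hτ.le)).eventually (lt_mem_nhds hcH)
  obtain ⟨δ, hδ, hδH⟩ := Metric.mem_nhdsWithin_iff.1 hev
  set r := min (δ / 3) (τ / 2) with hr
  have hr0 : 0 < r := by positivity
  have hr1 : r ≤ δ / 3 := min_le_left _ _
  have hr2 : r ≤ τ / 2 := min_le_right _ _
  have h1 := h (τ - 2 * r) (τ - r) (by linarith) (by linarith) (by linarith)
  have hlen : τ - r - (τ - 2 * r) = r := by ring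
  rw [hlen, inv_mul_le_iff₀ hr0] at h1
  have hint : IntegrableOn H (Ioo (τ - 2 * r) (τ - r)) :=
    ((hH.mono (Icc_subset_Icc (by linarith) (by linarith))).integrableOn_Icc (μ := volume)).mono_set
      Ioo_subset_Icc_self
  have h2 : ∫ _ in Ioo (τ - 2 * r) (τ - r), c ≤ ∫ t in Ioo (τ - 2 * r) (τ - r), H t := by
    refine setIntegral_mono_on (by simp) hint measurableSet_Ioo fun t ht => ?_
    refine (le_of_lt (hδH ⟨?_, ⟨?_, ?_⟩⟩) : c ≤ H t)
    · rw [Metric.mem_ball, Real.dist_eq, abs_lt]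
      constructor <;> linarith [ht.1, ht.2]
    · linarith [ht.1]
    · linarith [ht.2]
  have h3 : ∫ _ in Ioo (τ - 2 * r) (τ - r), c = r * c := by
    simp [hlen, hr0.le]
  rw [h3] at h2
  nlinarith

/-- Stability of an entropy solution `u` with respect to Lipschitz functions `v`, for finite
residual and initial error. -/
theorem IsEntropySolution.stability (hT : 0 < T) (S : IsStateSet U f η q C Cf ηlow ηup)
    (hu : IsEntropySolution U f η q T u₀ u)
    (huC : ∀ᵐ p ∂(volume.restrict (strip T)), u p.1 p.2 ∈ C)
    (hv : LipschitzWith L (fun p : ℝ × ℝ => v p.1 p.2)) (hvC : ∀ t x, v t x ∈ C)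
    {G : ℝ → ℝ} {B : ℝ} (hGm : Measurable G) (hG0 : ∀ r, 0 ≤ G r) (hGB : ∀ r, G r ≤ B)
    (hG : ∀ᵐ p ∂(volume.restrict (strip T)), ‖spaceDeriv v p‖ ≤ G p.1)
    {τ : ℝ} (hτ : τ ∈ Icc 0 T)
    (hR : Integrable (fun p => ‖flowResidual f v p‖ ^ 2) (volume.restrict (strip τ)))
    (hI : Integrable (fun x => ‖u₀ x - v 0 x‖ ^ 2)) :
    ∫⁻ x, ‖u τ x - v τ x‖ₑ ^ 2 ≤ ENNReal.ofReal
      (ηlow⁻¹ * ((∫ p in strip τ, ‖flowResidual f v p‖ ^ 2) + ηup * ∫ x, ‖u₀ x - v 0 x‖ ^ 2)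
        * Real.exp (∫ r in (0 : ℝ)..τ, growthRate Cf ηlow ηup G r)) := by
  have hlow := S.low_pos
  have hup := S.up_pos
  have hinit := hu.init_eq hT S huC
  have hslice := fun {t : ℝ} (ht : t ∈ Icc 0 T) =>
    hu.slice_mem hT S.convex S.compact.isClosed huC ht
  have hu₀C : ∀ᵐ x, u₀ x ∈ C := by
    filter_upwards [hinit, hslice (left_mem_Icc.2 hT.le)] with x h1 h2
    rwa [h1]
  rcases hτ.1.eq_or_lt with rfl | hτ0
  · -- at time zero only `ηup / ηlow ≥ 1` is needed
    have hs : strip 0 = ∅ := by simp [strip]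
    have h1 : ∫⁻ x, ‖u 0 x - v 0 x‖ₑ ^ 2 = ENNReal.ofReal (∫ x, ‖u₀ x - v 0 x‖ ^ 2) := by
      rw [ofReal_integral_eq_lintegral_ofReal hI
        (Filter.Eventually.of_forall fun x => sq_nonneg _)]
      refine lintegral_congr_ae ?_
      filter_upwards [hinit] with x hx
      rw [← hx, ENNReal.ofReal_pow (norm_nonneg _), ofReal_norm]
    rw [h1, hs]
    refine ENNReal.ofReal_le_ofReal ?_
    have h2 : 0 ≤ ∫ x, ‖u₀ x - v 0 x‖ ^ 2 := integral_nonneg fun x => sq_nonneg _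
    have h3 : 1 ≤ ηlow⁻¹ * ηup := by
      rw [inv_mul_eq_div, le_div_iff₀ hlow, one_mul]
      exact S.low_le_up
    simp only [Measure.restrict_empty, integral_zero_measure, intervalIntegral.integral_same,
      Real.exp_zero]
    nlinarith
  · obtain ⟨Bc, hBc⟩ := S.compact.isBounded.exists_norm_le
    have hB : ∀ᵐ x, ‖u τ x - v τ x‖ ≤ 2 * Bc := by
      filter_upwards [hslice hτ] with x hx
      refine (norm_sub_le _ _).trans ?_
      linarith [hBc _ hx, hBc _ (hvC τ x)]
    have hwm : AEStronglyMeasurable (fun x => u τ x - v τ x) :=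
      (hu.locInt_slice τ hτ).aestronglyMeasurable.sub
        (lipschitzWith_space hv τ).continuous.aestronglyMeasurable
    refine lintegral_sq_le_of_forall_test hwm hB fun g hg hgc => ?_
    have ham : Measurable (growthRate Cf ηlow ηup G) := measurable_growthRate hGm
    have ha0 := growthRate_nonneg S hG0
    have haB := growthRate_le S hG0 hGB
    have hec : Continuous (expWeight (growthRate Cf ηlow ηup G)) :=
      (lipschitzWith_expWeight ham ha0 haB ((ha0 0).trans (haB 0))
        fun r hr => growthRate_of_nonpos hr).continuous
    have hHc := (hec.mul continuous_const).continuousOn.mul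
      ((hu.continuousOn_test hv hg hgc).mono (Icc_subset_Icc_right hτ.2))
      (f := fun t => expWeight (growthRate Cf ηlow ηup G) t * (ηlow / 2))
    have key := le_of_averages_le hτ0 hHc fun σ σ' h1 h2 h3 =>
      hu.averaged_stability hT S huC hu₀C hv hvC hGm hG0 hGB hG h1 h2 h3 hτ.2 hR hI hg hgc
    set Q := ∫ x, (2 * inner ℝ (u τ x - v τ x) (g x) - ‖g x‖ ^ 2) with hQ
    set D := (∫ p in strip τ, ‖flowResidual f v p‖ ^ 2) + ηup * ∫ x, ‖u₀ x - v 0 x‖ ^ 2 with hD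
    set A := ∫ r in (0 : ℝ)..τ, growthRate Cf ηlow ηup G r with hA
    have h1 : Real.exp (-A) * (ηlow / 2) * Q ≤ D / 2 := key
    have h2 : Real.exp A * Real.exp (-A) = 1 := by rw [← Real.exp_add, add_neg_cancel, Real.exp_zero]
    have h3 := mul_le_mul_of_nonneg_left h1
      (mul_nonneg (inv_nonneg.2 hlow.le) (Real.exp_pos A).le)
    have h4 : ηlow⁻¹ * Real.exp A * (Real.exp (-A) * (ηlow / 2) * Q) = Q / 2 := by
      calc _ = (ηlow⁻¹ * ηlow) * (Real.exp A * Real.exp (-A)) * Q / 2 := by ring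
        _ = _ := by rw [h2, inv_mul_cancel₀ hlow.ne', one_mul, one_mul]
    rw [h4] at h3
    linarith

end Stability

/-! ### Stability as an inequality in `[0, ∞]` -/

/-- Extension of a function of time and space, constant in time outside `[0, T]`. -/
def clampTime {F : Type*} (T : ℝ) (v : ℝ → ℝ → F) (t x : ℝ) : F := v (max 0 (min T t)) x

section ClampTime

variable {F : Type*} {T : ℝ} {v : ℝ → ℝ → F}

theorem clamp_mem (hT : 0 ≤ T) (t : ℝ) : max 0 (min T t) ∈ Icc 0 T :=
  ⟨le_max_left _ _, max_le hT (min_le_left _ _)⟩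

theorem clampTime_of_mem {t : ℝ} (ht : t ∈ Icc 0 T) : clampTime T v t = v t := by
  ext1 x
  rw [clampTime, min_eq_right ht.2, max_eq_right ht.1]

theorem lipschitzWith_clampTime [PseudoEMetricSpace F] (hT : 0 ≤ T) {L : ℝ≥0}
    (hv : LipschitzOnWith L (fun p : ℝ × ℝ => v p.1 p.2) (Icc 0 T ×ˢ univ)) :
    LipschitzWith L (fun p : ℝ × ℝ => clampTime T v p.1 p.2) := by
  have h1 : LipschitzWith 1 (fun p : ℝ × ℝ => (max 0 (min T p.1), p.2)) := by
    have h2 : LipschitzWith 1 (fun t : ℝ => max 0 (min T t)) :=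
      (LipschitzWith.id.const_min T).const_max 0
    have h3 := (h2.comp (LipschitzWith.prod_fst (α := ℝ) (β := ℝ))).prodMk
      (LipschitzWith.prod_snd (α := ℝ) (β := ℝ))
    simpa using h3
  rw [← lipschitzOnWith_univ] at h1 ⊢
  have := hv.comp h1 (fun p _ => ⟨clamp_mem hT p.1, mem_univ _⟩)
  rwa [mul_one] at this

variable [NormedAddCommGroup F] [NormedSpace ℝ F]

theorem timeDeriv_clampTime {p : ℝ × ℝ} (hp : p ∈ strip T) :
    timeDeriv (clampTime T v) p = timeDeriv v p := by
  refine Filter.EventuallyEq.deriv_eq ?_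
  filter_upwards [Ioo_mem_nhds hp.1.1 hp.1.2] with s hs
  rw [clampTime_of_mem (Ioo_subset_Icc_self hs)]

theorem spaceDeriv_clampTime {p : ℝ × ℝ} (hp : p ∈ strip T) :
    spaceDeriv (clampTime T v) p = spaceDeriv v p := by
  rw [spaceDeriv, clampTime_of_mem (Ioo_subset_Icc_self hp.1)]

end ClampTime

section Stability

variable {m : ℕ} {U : Set (Vec m)} {f : Vec m → Vec m} {η q : Vec m → ℝ} {C : Set (Vec m)}
  {Cf ηlow ηup T : ℝ} {u₀ : ℝ → Vec m} {u : ℝ → ℝ → Vec m} {v : ℝ → ℝ → Vec m} {L : ℝ≥0}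

theorem flowResidual_clampTime {p : ℝ × ℝ} (hp : p ∈ strip T) :
    flowResidual f (clampTime T v) p = flowResidual f v p := by
  rw [flowResidual, flowResidual, timeDeriv_clampTime hp]
  congr 1
  exact spaceDeriv_clampTime (v := fun t x => f (v t x)) hp

theorem measurable_flowResidual (S : IsStateSet U f η q C Cf ηlow ηup)
    (hv : LipschitzWith L (fun p : ℝ × ℝ => v p.1 p.2)) (hvC : ∀ t x, v t x ∈ C) :
    Measurable (flowResidual f v) := by
  have hfv : Continuous (fun p : ℝ × ℝ => f (v p.1 p.2)) := by
    refine continuous_iff_continuousAt.2 fun p => ?_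
    exact ContinuousAt.comp (f := fun p : ℝ × ℝ => v p.1 p.2)
      (S.contDiffAt_flux (hvC p.1 p.2)).continuousAt hv.continuous.continuousAt
  exact (measurable_timeDeriv hv.continuous).add
    (measurable_spaceDeriv (g := fun t x => f (v t x)) hfv)

theorem integrable_sq_norm_of_lintegral_ne_top {α : Type*} [MeasurableSpace α] {μ : Measure α}
    {g : α → Vec m} (hg : AEStronglyMeasurable g μ) (h : ∫⁻ a, ‖g a‖ₑ ^ 2 ∂μ ≠ ⊤) :
    Integrable (fun a => ‖g a‖ ^ 2) μ ∧
      ENNReal.ofReal (∫ a, ‖g a‖ ^ 2 ∂μ) = ∫⁻ a, ‖g a‖ₑ ^ 2 ∂μ := by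
  have e : ∀ a, ‖g a‖ₑ ^ 2 = ENNReal.ofReal (‖g a‖ ^ 2) := fun a => by
    rw [ENNReal.ofReal_pow (norm_nonneg _), ofReal_norm]
  simp_rw [e] at h ⊢
  have hi : Integrable (fun a => ‖g a‖ ^ 2) μ := by
    refine ⟨hg.norm.pow 2, ?_⟩
    rw [hasFiniteIntegral_iff_ofReal (Filter.Eventually.of_forall fun a => sq_nonneg _)]
    exact h.lt_top
  exact ⟨hi, ofReal_integral_eq_lintegral_ofReal hi
    (Filter.Eventually.of_forall fun a => sq_nonneg _)⟩

/-- The growth rate integrates to at most the exponent of the stability estimate. -/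
theorem ofReal_integral_growthRate_le (S : IsStateSet U f η q C Cf ηlow ηup) {G : ℝ → ℝ} {B : ℝ}
    (hGm : Measurable G) (hG0 : ∀ r, 0 ≤ G r) (hGB : ∀ r, G r ≤ B) {g : ℝ → ℝ≥0∞}
    (hGg : ∀ r, ENNReal.ofReal (G r) ≤ g r) {τ : ℝ} (hτ : 0 ≤ τ) :
    ENNReal.ofReal (∫ r in (0 : ℝ)..τ, growthRate Cf ηlow ηup G r)
      ≤ ENNReal.ofReal ηlow⁻¹ * ∫⁻ s in Ioo 0 τ,
          (ENNReal.ofReal (ηup * Cf) * g s + ENNReal.ofReal (ηup ^ 2)) := by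
  have hlow := S.low_pos
  have hup := S.up_pos
  have hCf := S.Cf_nonneg
  have hi : IntegrableOn (growthRate Cf ηlow ηup G) (Ioo 0 τ) :=
    ((locallyIntegrable_of_bounded (measurable_growthRate hGm) (growthRate_nonneg S hG0)
      (growthRate_le S hG0 hGB)).integrableOn_isCompact (isCompact_Icc (a := 0) (b := τ))).mono_set
        Ioo_subset_Icc_self
  rw [intervalIntegral.integral_of_le hτ, integral_Ioc_eq_integral_Ioo,
    ofReal_integral_eq_lintegral_ofReal hi
      (Filter.Eventually.of_forall fun r => growthRate_nonneg S hG0 r),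
    ← lintegral_const_mul' _ _ ENNReal.ofReal_ne_top]
  refine setLIntegral_mono' measurableSet_Ioo fun r hr => ?_
  rw [growthRate, indicator_of_mem (show r ∈ Ioi (0 : ℝ) from hr.1),
    ENNReal.ofReal_mul (inv_nonneg.2 hlow.le)]
  gcongr
  have h0 := hG0 r
  rw [ENNReal.ofReal_add (by positivity) (by positivity), ENNReal.ofReal_mul (by positivity)]
  gcongr
  exact hGg r

/-- Stability of an entropy solution `u` on `[0, T]` with respect to Lipschitz functions `v`, as an
inequality in `[0, ∞]`. -/
theorem IsEntropySolution.stability_ennreal (hT : 0 < T) (S : IsStateSet U f η q C Cf ηlow ηup)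
    (hu : IsEntropySolution U f η q T u₀ u)
    (huC : ∀ᵐ p ∂(volume.restrict (strip T)), u p.1 p.2 ∈ C)
    (hv : LipschitzOnWith L (fun p : ℝ × ℝ => v p.1 p.2) (Icc 0 T ×ˢ univ))
    (hvC : ∀ t ∈ Icc 0 T, ∀ x, v t x ∈ C) {g : ℝ → ℝ≥0∞} (hgm : Measurable g)
    (hg : ∀ᵐ p ∂(volume.restrict (strip T)), ‖spaceDeriv v p‖ₑ ≤ g p.1)
    {τ : ℝ} (hτ : τ ∈ Icc 0 T) :
    ∫⁻ x, ‖u τ x - v τ x‖ₑ ^ 2 ≤ ENNReal.ofReal ηlow⁻¹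
      * ((∫⁻ p in strip τ, ‖flowResidual f v p‖ₑ ^ 2)
        + ENNReal.ofReal ηup * ∫⁻ x, ‖u₀ x - v 0 x‖ₑ ^ 2)
      * EReal.exp ((ENNReal.ofReal ηlow⁻¹ * ∫⁻ s in Ioo 0 τ,
          (ENNReal.ofReal (ηup * Cf) * g s + ENNReal.ofReal (ηup ^ 2)) : ℝ≥0∞) : EReal) := by
  have hlow := S.low_pos
  have hup := S.up_pos
  have h0T : (0 : ℝ) ∈ Icc 0 T := left_mem_Icc.2 hT.le
  set X := ENNReal.ofReal ηlow⁻¹ * ∫⁻ s in Ioo 0 τ,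
    (ENNReal.ofReal (ηup * Cf) * g s + ENNReal.ofReal (ηup ^ 2)) with hX
  have hexp : 1 ≤ EReal.exp (X : EReal) :=
    EReal.one_le_exp_iff.2 (EReal.coe_ennreal_nonneg X)
  have hexp0 : EReal.exp (X : EReal) ≠ 0 := (zero_lt_one.trans_le hexp).ne'
  have hc0 : ENNReal.ofReal ηlow⁻¹ ≠ 0 := (ENNReal.ofReal_pos.2 (inv_pos.2 hlow)).ne'
  set w := clampTime T v with hw
  have hwL : LipschitzWith L (fun p : ℝ × ℝ => w p.1 p.2) := lipschitzWith_clampTime hT.le hv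
  have hwC : ∀ t x, w t x ∈ C := fun t x => hvC _ (clamp_mem hT.le t) x
  have hmeas : ∀ r, MeasurableSet (strip r) := fun r =>
    measurableSet_Ioo.prod MeasurableSet.univ
  have hsub : strip τ ⊆ strip T := prod_mono (Ioo_subset_Ioo_right hτ.2) subset_rfl
  have hRw : ∫⁻ p in strip τ, ‖flowResidual f v p‖ₑ ^ 2
      = ∫⁻ p in strip τ, ‖flowResidual f w p‖ₑ ^ 2 :=
    setLIntegral_congr_fun (hmeas τ) fun p hp => by
      simp only [hw, flowResidual_clampTime (hsub hp)]
  rw [hRw, ← clampTime_of_mem (v := v) hτ, ← clampTime_of_mem (v := v) h0T, ← hw]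
  by_cases hR : ∫⁻ p in strip τ, ‖flowResidual f w p‖ₑ ^ 2 = ⊤
  · rw [hR, top_add, ENNReal.mul_top hc0, ENNReal.top_mul hexp0]
    exact le_top
  by_cases hI : ∫⁻ x, ‖u₀ x - w 0 x‖ₑ ^ 2 = ⊤
  · rw [hI, ENNReal.mul_top (ENNReal.ofReal_pos.2 hup).ne', add_top, ENNReal.mul_top hc0,
      ENNReal.top_mul hexp0]
    exact le_top
  obtain ⟨hRi, hRe⟩ := integrable_sq_norm_of_lintegral_ne_top
    (measurable_flowResidual S hwL hwC).aestronglyMeasurable hR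
  have hIm : AEStronglyMeasurable (fun x => u₀ x - w 0 x) :=
    hu.locInt_init.aestronglyMeasurable.sub
      (lipschitzWith_space hwL 0).continuous.aestronglyMeasurable
  obtain ⟨hIi, hIe⟩ := integrable_sq_norm_of_lintegral_ne_top hIm hI
  set G : ℝ → ℝ := fun r => (min (g r) L).toReal with hG
  have hne : ∀ r, min (g r) (L : ℝ≥0∞) ≠ ⊤ := fun r =>
    ((min_le_right _ _).trans_lt ENNReal.coe_lt_top).ne
  have hGm : Measurable G := (hgm.min measurable_const).ennreal_toReal
  have hG0 : ∀ r, 0 ≤ G r := fun r => ENNReal.toReal_nonneg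
  have hGB : ∀ r, G r ≤ L := fun r =>
    ENNReal.toReal_mono ENNReal.coe_ne_top (min_le_right (g r) (L : ℝ≥0∞))
  have hGbound : ∀ᵐ p ∂(volume.restrict (strip T)), ‖spaceDeriv w p‖ ≤ G p.1 := by
    filter_upwards [hg, ae_restrict_mem (hmeas T)] with p hp hpT
    rw [← spaceDeriv_clampTime hpT, ← hw] at hp
    rw [← toReal_enorm]
    refine ENNReal.toReal_mono (hne _) (le_min hp ?_)
    rw [enorm_le_coe]
    exact norm_spaceDeriv_le hwL p
  refine (hu.stability hT S huC hwL hwC hGm hG0 hGB hGbound hτ hRi hIi).trans ?_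
  have hR0 : 0 ≤ ∫ p in strip τ, ‖flowResidual f w p‖ ^ 2 := integral_nonneg fun p => sq_nonneg _
  have hI0 : 0 ≤ ∫ x, ‖u₀ x - w 0 x‖ ^ 2 := integral_nonneg fun x => sq_nonneg _
  rw [ENNReal.ofReal_mul (by positivity), ENNReal.ofReal_mul (by positivity),
    ENNReal.ofReal_add hR0 (by positivity), ENNReal.ofReal_mul hup.le, hRe, hIe]
  gcongr
  rw [← EReal.exp_coe, EReal.exp_le_exp_iff]
  have h1 := ofReal_integral_growthRate_le S hGm hG0 hGB (g := g)
    (fun r => by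
      rw [ENNReal.ofReal_toReal (hne r)]
      exact min_le_left _ _) hτ.1
  refine le_trans ?_ (EReal.coe_ennreal_le_coe_ennreal_iff.2 h1)
  rw [EReal.coe_ennreal_ofReal]
  exact_mod_cast le_max_left _ _

end Stability

/-! ### Measurability and integration in the random parameter -/

section EssentialSupremum

variable {H : ℝ × ℝ × ℝ → ℝ≥0∞} {μ : Measure ℝ}

theorem essSup_essSup_le_iff [SFinite μ] (hH : Measurable H) (s : ℝ) (c : ℝ≥0∞) :
    essSup (fun y => essSup (fun x => H (s, x, y)) volume) μ ≤ c
      ↔ ∀ᵐ p ∂((volume : Measure ℝ).prod μ), H (s, p) ≤ c := by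
  have hm : MeasurableSet {p : ℝ × ℝ | H (s, p.1, p.2) ≤ c} :=
    measurableSet_le (hH.comp (by fun_prop)) measurable_const
  have h1 := (Measure.ae_prod_iff_ae_ae (μ := (volume : Measure ℝ)) (ν := μ) hm).trans
    (Measure.ae_ae_comm (p := fun x y => H (s, x, y) ≤ c) hm)
  refine Iff.trans ⟨fun h => ?_, fun h => ?_⟩ h1.symm
  · filter_upwards [ae_le_essSup (f := fun y => essSup (fun x => H (s, x, y)) volume) (μ := μ)]
      with y hy
    filter_upwards [ae_le_essSup (f := fun x => H (s, x, y)) (μ := volume)] with x hx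
    exact hx.trans (hy.trans h)
  · refine essSup_le_of_ae_le c ?_
    filter_upwards [h] with y hy
    exact essSup_le_of_ae_le c hy

theorem measurable_essSup_essSup [SFinite μ] (hH : Measurable H) :
    Measurable (fun s => essSup (fun y => essSup (fun x => H (s, x, y)) volume) μ) := by
  refine measurable_of_Iic fun c => ?_
  have hm : MeasurableSet {p : ℝ × ℝ × ℝ | ¬ H p ≤ c} :=
    (measurableSet_le hH measurable_const).compl
  have h1 := measurable_measure_prodMk_left (ν := (volume : Measure ℝ).prod μ) hm
  convert h1 (measurableSet_singleton 0) using 1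
  ext s
  exact essSup_essSup_le_iff hH s c

/-- Almost surely, the double essential supremum is a bound at almost every time and place. -/
theorem ae_le_essSup_essSup [SFinite μ] (hH : Measurable H) (ν : Measure ℝ) [SFinite ν] :
    ∀ᵐ y ∂μ, ∀ᵐ p ∂(ν.prod volume),
      H (p.1, p.2, y) ≤ essSup (fun y => essSup (fun x => H (p.1, x, y)) volume) μ := by
  set g := fun s => essSup (fun y => essSup (fun x => H (s, x, y)) volume) μ with hg
  have hgm : Measurable g := measurable_essSup_essSup hH
  have hm : MeasurableSet {z : (ℝ × ℝ) × ℝ | H (z.1.1, z.1.2, z.2) ≤ g z.1.1} :=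
    measurableSet_le (hH.comp (by fun_prop)) (hgm.comp (by fun_prop))
  rw [← Measure.ae_ae_comm (p := fun (p : ℝ × ℝ) (y : ℝ) => H (p.1, p.2, y) ≤ g p.1) hm]
  have hm' : MeasurableSet {p : ℝ × ℝ | ∀ᵐ y ∂μ, H (p.1, p.2, y) ≤ g p.1} :=
    (measurable_measure_prodMk_left (ν := μ) hm.compl) (measurableSet_singleton 0)
  rw [Measure.ae_prod_iff_ae_ae hm']
  refine Filter.Eventually.of_forall fun s => ?_
  have hms : MeasurableSet {p : ℝ × ℝ | H (s, p.1, p.2) ≤ g s} :=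
    measurableSet_le (hH.comp (by fun_prop)) measurable_const
  exact Measure.ae_ae_of_ae_prod ((essSup_essSup_le_iff hH s (g s)).1 le_rfl)

end EssentialSupremum

section Expansion

variable {m R : ℕ} {M : ℕ} {Ψ : ℕ → ℝ → ℝ} {yq wq : Fin (R + 1) → ℝ} {T : ℝ}
  {ust : Fin (R + 1) → ℝ → ℝ → Vec m}

/-- The truncated expansion with the coefficients `a i` in place of the values `Ψ i y`.  It is
jointly continuous in `(a, t, x)`, which yields joint measurability of the expansion and of its
partial derivatives in `(t, x, y)` although the `Ψ i` are only measurable. -/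
def coeffExpansion (M : ℕ) (Ψ : ℕ → ℝ → ℝ) (yq wq : Fin (R + 1) → ℝ)
    (v : Fin (R + 1) → ℝ → ℝ → Vec m) (a : ℕ → ℝ) (t x : ℝ) : Vec m :=
  ∑ i ∈ Finset.range (M + 1), a i • nispMode Ψ yq wq (fun l => v l t x) i

theorem exists_lipschitzOn_sum_smul {α ι E : Type*} [PseudoMetricSpace α]
    [NormedAddCommGroup E] [NormedSpace ℝ E] {s : Set α} {g : ι → α → E} (I : Finset ι)
    (c : ι → ℝ) (hg : ∀ i ∈ I, ∃ K : ℝ≥0, LipschitzOnWith K (g i) s) :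
    ∃ K : ℝ≥0, LipschitzOnWith K (fun a => ∑ i ∈ I, c i • g i a) s := by
  classical
  induction I using Finset.induction_on with
  | empty => exact ⟨0, by simp⟩
  | insert i I hi ih =>
    obtain ⟨K, hK⟩ := ih fun j hj => hg j (Finset.mem_insert_of_mem hj)
    obtain ⟨K', hK'⟩ := hg i (Finset.mem_insert_self i I)
    have h1 : LipschitzOnWith (‖c i‖₊ * K') (fun a => c i • g i a) s :=
      LipschitzOnWith.of_dist_le_mul fun a ha b hb => by
        rw [dist_smul₀, NNReal.coe_mul, coe_nnnorm, mul_assoc]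
        exact mul_le_mul_of_nonneg_left (hK'.dist_le_mul a ha b hb) (norm_nonneg _)
    refine ⟨‖c i‖₊ * K' + K, ?_⟩
    simp only [Finset.sum_insert hi]
    exact h1.add hK

theorem exists_lipschitzOn_coeffExpansion (a : ℕ → ℝ) {s : Set (ℝ × ℝ)}
    (h : ∀ l, ∃ K : ℝ≥0, LipschitzOnWith K (fun p : ℝ × ℝ => ust l p.1 p.2) s) :
    ∃ K : ℝ≥0, LipschitzOnWith K (fun p : ℝ × ℝ => coeffExpansion M Ψ yq wq ust a p.1 p.2) s :=
  exists_lipschitzOn_sum_smul _ _ fun _ _ => exists_lipschitzOn_sum_smul _ _ fun l _ => h l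

theorem continuous_coeffExpansion (h : ∀ l, Continuous (fun p : ℝ × ℝ => ust l p.1 p.2)) :
    Continuous (fun z : (ℕ → ℝ) × ℝ × ℝ => coeffExpansion M Ψ yq wq ust z.1 z.2.1 z.2.2) := by
  refine continuous_finsetSum _ fun i _ => Continuous.fun_smul ?_ ?_
  · exact (continuous_apply i).comp continuous_fst
  · exact continuous_finsetSum _ fun l _ => ((h l).comp continuous_snd).fun_const_smul _

theorem measurable_coeffExpansion (h : ∀ l, Continuous (fun p : ℝ × ℝ => ust l p.1 p.2))
    (hΨ : ∀ i, Measurable (Ψ i)) :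
    Measurable (fun z : ℝ × ℝ × ℝ =>
      coeffExpansion M Ψ yq wq ust (fun i => Ψ i z.2.2) z.1 z.2.1) := by
  have h1 : Measurable (fun z : ℝ × ℝ × ℝ => ((fun i => Ψ i z.2.2, z.1, z.2.1) :
      (ℕ → ℝ) × ℝ × ℝ)) :=
    (measurable_pi_lambda _ fun i => (hΨ i).comp (by fun_prop)).prodMk (by fun_prop)
  exact (continuous_coeffExpansion h).measurable.comp h1

theorem measurable_timeDeriv_coeffExpansion
    (h : ∀ l, Continuous (fun p : ℝ × ℝ => ust l p.1 p.2)) (hΨ : ∀ i, Measurable (Ψ i)) :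
    Measurable (fun z : ℝ × ℝ × ℝ =>
      timeDeriv (coeffExpansion M Ψ yq wq ust (fun i => Ψ i z.2.2)) (z.1, z.2.1)) := by
  have hc : Continuous (fun z : ((ℕ → ℝ) × ℝ) × ℝ =>
      coeffExpansion M Ψ yq wq ust z.1.1 z.2 z.1.2) :=
    (continuous_coeffExpansion h).comp
      (by fun_prop : Continuous fun z : ((ℕ → ℝ) × ℝ) × ℝ => (z.1.1, z.2, z.1.2))
  have h1 := measurable_deriv_with_param
    (f := fun (b : (ℕ → ℝ) × ℝ) s => coeffExpansion M Ψ yq wq ust b.1 s b.2) hc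
  have h2 : Measurable (fun z : ℝ × ℝ × ℝ => (((fun i => Ψ i z.2.2), z.2.1), z.1) :
      ℝ × ℝ × ℝ → ((ℕ → ℝ) × ℝ) × ℝ) :=
    ((measurable_pi_lambda _ fun i => (hΨ i).comp (by fun_prop)).prodMk (by fun_prop)).prodMk
      (by fun_prop)
  exact h1.comp h2

theorem measurable_spaceDeriv_coeffExpansion
    (h : ∀ l, Continuous (fun p : ℝ × ℝ => ust l p.1 p.2)) (hΨ : ∀ i, Measurable (Ψ i)) :
    Measurable (fun z : ℝ × ℝ × ℝ =>
      spaceDeriv (coeffExpansion M Ψ yq wq ust (fun i => Ψ i z.2.2)) (z.1, z.2.1)) := by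
  have hc : Continuous (fun z : ((ℕ → ℝ) × ℝ) × ℝ =>
      coeffExpansion M Ψ yq wq ust z.1.1 z.1.2 z.2) :=
    (continuous_coeffExpansion h).comp
      (by fun_prop : Continuous fun z : ((ℕ → ℝ) × ℝ) × ℝ => (z.1.1, z.1.2, z.2))
  have h1 := measurable_deriv_with_param
    (f := fun (b : (ℕ → ℝ) × ℝ) s => coeffExpansion M Ψ yq wq ust b.1 b.2 s) hc
  have h2 : Measurable (fun z : ℝ × ℝ × ℝ => (((fun i => Ψ i z.2.2), z.1), z.2.1) :
      ℝ × ℝ × ℝ → ((ℕ → ℝ) × ℝ) × ℝ) :=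
    ((measurable_pi_lambda _ fun i => (hΨ i).comp (by fun_prop)).prodMk (by fun_prop)).prodMk
      (by fun_prop)
  exact h1.comp h2

end Expansion

/-- Measurability in `y` of the residual, for a field `v` that is measurable together with its
partial derivatives and almost surely Lipschitz in `(t, x)` with values in `C`.  The chain rule
expresses the residual through the partial derivatives of `v` and the Jacobian of `f`, which is
continuous only on `U` and therefore replaced by zero outside `U`. -/
theorem IsStateSet.aemeasurable_lintegral_flowResidual {m : ℕ} {U : Set (Vec m)}
    {f : Vec m → Vec m} {η q : Vec m → ℝ} {C : Set (Vec m)} {Cf ηlow ηup : ℝ}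
    (S : IsStateSet U f η q C Cf ηlow ηup) {μ : Measure ℝ} {v : ℝ → ℝ → ℝ → Vec m}
    (hv : Measurable (fun z : ℝ × ℝ × ℝ => v z.2.2 z.1 z.2.1))
    (hvt : Measurable (fun z : ℝ × ℝ × ℝ => timeDeriv (v z.2.2) (z.1, z.2.1)))
    (hvx : Measurable (fun z : ℝ × ℝ × ℝ => spaceDeriv (v z.2.2) (z.1, z.2.1)))
    (hL : ∀ y, ∃ L : ℝ≥0, LipschitzWith L (fun p : ℝ × ℝ => v y p.1 p.2))
    (hC : ∀ᵐ y ∂μ, ∀ t x, v y t x ∈ C) (τ : ℝ) :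
    AEMeasurable (fun y => ∫⁻ p in strip τ, ‖flowResidual f (v y) p‖ₑ ^ 2) μ := by
  classical
  set e : Fin m → Vec m := fun j => EuclideanSpace.single j 1 with he
  have hJ : ∀ j, Measurable (U.piecewise (fun a => fderiv ℝ f a (e j)) fun _ => 0) := fun j => by
    refine ContinuousOn.measurable_piecewise ?_ continuousOn_const S.isOpen.measurableSet
    exact (S.contDiff.continuousOn_fderiv_of_isOpen S.isOpen (by norm_num)).clm_apply
      continuousOn_const
  set r : ℝ × ℝ × ℝ → Vec m := fun z => timeDeriv (v z.2.2) (z.1, z.2.1)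
    + ∑ j, spaceDeriv (v z.2.2) (z.1, z.2.1) j
      • U.piecewise (fun a => fderiv ℝ f a (e j)) (fun _ => 0) (v z.2.2 z.1 z.2.1) with hr
  have hrm : Measurable r := by
    refine hvt.add (Finset.measurable_sum _ fun j _ => Measurable.fun_smul ?_ ((hJ j).comp hv))
    exact (EuclideanSpace.proj (𝕜 := ℝ) j).continuous.measurable.comp hvx
  have hmeas : Measurable fun y : ℝ => ∫⁻ p in strip τ, ‖r (p.1, p.2, y)‖ₑ ^ 2 := by
    have h1 : Measurable (fun z : ℝ × (ℝ × ℝ) => ‖r (z.2.1, z.2.2, z.1)‖ₑ ^ 2) :=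
      ((hrm.comp (by fun_prop)).enorm).pow_const 2
    exact h1.lintegral_prod_right'
  refine ⟨_, hmeas, ?_⟩
  filter_upwards [hC] with y hy
  obtain ⟨L, hLy⟩ := hL y
  refine lintegral_congr_ae (ae_restrict_of_ae ?_)
  filter_upwards [hLy.ae_differentiableAt] with p hp
  rw [flowResidual_eq S hy hp, hr]
  simp only [piecewise_eq_of_mem _ _ _ (S.subset (hy p.1 p.2))]
  congr 3
  have h1 : spaceDeriv (v y) p = ∑ j, spaceDeriv (v y) p j • e j := by
    ext k
    simp [he, Pi.single_apply]
  conv_lhs => rw [h1]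
  rw [map_sum]
  simp only [map_smul]

theorem enorm_sub_sq_le {E : Type*} [NormedAddCommGroup E] (a b c : E) :
    ‖a - c‖ₑ ^ 2 ≤ 2 * ‖b - c‖ₑ ^ 2 + 2 * ‖a - b‖ₑ ^ 2 := by
  have h : ‖a - c‖₊ ≤ ‖b - c‖₊ + ‖a - b‖₊ := by
    rw [add_comm, ← sub_add_sub_cancel a b c]
    exact nnnorm_add_le _ _
  have h2 : ‖a - c‖₊ ^ 2 ≤ 2 * ‖b - c‖₊ ^ 2 + 2 * ‖a - b‖₊ ^ 2 := by
    rw [← mul_add]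
    exact (pow_le_pow_left₀ zero_le h 2).trans add_sq_le
  simp only [enorm_eq_nnnorm]
  exact_mod_cast h2

theorem lintegral_mul_add_mul {α : Type*} [MeasurableSpace α] {μ : Measure α} {a b : α → ℝ≥0∞}
    (ha : AEMeasurable a μ) (hb : Measurable b) {c : ℝ≥0∞} (hc : c ≠ ⊤) (d X : ℝ≥0∞) :
    ∫⁻ y, c * (a y + d * b y) * X ∂μ = c * (∫⁻ y, a y ∂μ + d * ∫⁻ y, b y ∂μ) * X := by
  have hm : AEMeasurable (fun y => c * (a y + d * b y)) μ :=
    (ha.add (hb.aemeasurable.const_mul d)).const_mul c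
  rw [lintegral_mul_const'' X hm, lintegral_const_mul' _ _ hc,
    lintegral_add_right _ (hb.const_mul d), lintegral_const_mul _ hb]

/-- The triangle inequality for squared norms.  Only the difference `a - b` has to be measurable;
nothing is asked of `c`. -/
theorem sqNormL2_sub_le {α : Type*} [MeasurableSpace α] {m : ℕ} (μ : Measure ℝ) (ν : Measure α)
    [SFinite ν] {a b : α → ℝ → Vec m} (c : α → ℝ → Vec m)
    (hab : Measurable fun z : ℝ × α => ‖a z.2 z.1 - b z.2 z.1‖ₑ ^ 2) :
    sqNormL2 μ ν (fun x y => a x y - c x y) ≤ 2 * sqNormL2 μ ν (fun x y => b x y - c x y)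
      + 2 * sqNormL2 μ ν (fun x y => a x y - b x y) := by
  have hy : ∀ y, ∫⁻ x, ‖a x y - c x y‖ₑ ^ 2 ∂ν ≤ 2 * ∫⁻ x, ‖b x y - c x y‖ₑ ^ 2 ∂ν
      + 2 * ∫⁻ x, ‖a x y - b x y‖ₑ ^ 2 ∂ν := fun y => by
    have hp : Measurable fun x : α => (y, x) := measurable_prodMk_left
    have h0 := hab.comp hp
    have h1 : Measurable fun x => ‖a x y - b x y‖ₑ ^ 2 := h0
    rw [← lintegral_const_mul' _ _ ENNReal.ofNat_ne_top, ← lintegral_const_mul _ h1,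
      ← lintegral_add_right _ (h1.const_mul _)]
    exact lintegral_mono fun x => enorm_sub_sq_le (a x y) (b x y) (c x y)
  have hm : Measurable fun y => ∫⁻ x, ‖a x y - b x y‖ₑ ^ 2 ∂ν := hab.lintegral_prod_right'
  unfold sqNormL2
  rw [← lintegral_const_mul' _ _ ENNReal.ofNat_ne_top, ← lintegral_const_mul _ hm,
    ← lintegral_add_right _ (hm.const_mul _)]
  exact lintegral_mono hy

end

/-! ### The error estimate -/

theorem theorem1
    -- the random variable, its range and density
    {Ω : Type*} [MeasurableSpace Ω] (P : Measure Ω) [IsProbabilityMeasure P]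
    (Ξ : Set ℝ) (hΞ : MeasurableSet Ξ) (ξ : Ω → ℝ) (hξ : Measurable ξ) (hξΞ : ∀ ω, ξ ω ∈ Ξ)
    (w : ℝ → ℝ) (hw : Measurable w) (hw0 : ∀ y ∈ Ξ, 0 ≤ w y)
    (hlaw : P.map ξ = (volume.restrict Ξ).withDensity (fun y => ENNReal.ofReal (w y)))
    -- the system of conservation laws and its entropy pair
    (m : ℕ) (U : Set (Vec m)) (hU : IsOpen U) (f : Vec m → Vec m) (hf : ContDiffOn ℝ 2 f U)
    (hyp : StrictlyHyperbolic U f) (η q : Vec m → ℝ) (hηq : IsEntropyPair U f η q)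
    (T : ℝ) (hT : 0 < T)
    -- the random entropy solution
    (u₀ : ℝ → ℝ → Vec m) (u : ℝ → ℝ → ℝ → Vec m)
    (hu : IsRandomEntropySolution (P.map ξ) U f η q T u₀ u)
    -- polynomial chaos basis and quadrature rule
    (Ψ : ℕ → ℝ → ℝ) (hΨ : IsOrthonormalBasisL2 (P.map ξ) Ψ)
    (M R : ℕ) (yq wq : Fin (R + 1) → ℝ) (hyq : ∀ l, yq l ∈ Ξ)
    -- mesh, time levels, numerical solutions and reconstructions at the quadrature points
    (x₀ h : ℝ) (hh : 0 < h) (p : ℕ)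
    (N : ℕ) (t : Fin (N + 1) → ℝ) (ht : StrictMono t) (htT : ∀ n, t n ∈ Icc 0 T)
    (uh : Fin (R + 1) → Fin (N + 1) → ℝ → Vec m) (huh : ∀ l n, IsDG x₀ h p (uh l n))
    (ust : Fin (R + 1) → ℝ → ℝ → Vec m) (hust : ∀ l, IsReconstruction T x₀ h (p + 1) (ust l))
    -- the convex compact set of states and the bounds for the second derivatives on it
    (C : Set (Vec m)) (hCU : C ⊆ U) (hCconv : Convex ℝ C) (hCcomp : IsCompact C)
    (hCu : ∀ᵐ y ∂(P.map ξ), ∀ᵐ z ∂(volume.restrict (strip T)), u z.1 z.2 y ∈ C)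
    (hCsts : ∀ᵐ y ∂(P.map ξ), ∀ s ∈ Icc 0 T, ∀ x, stsReconstruction M Ψ yq wq ust s x y ∈ C)
    (Cf ηlow ηup : ℝ) (hCf0 : 0 ≤ Cf) (hηlow : 0 < ηlow) (hηup : ηlow ≤ ηup)
    (hCf : ∀ a ∈ C, ∀ v, ‖fderiv ℝ (fderiv ℝ f) a v v‖ ≤ Cf * ‖v‖ ^ 2)
    (hη_lower : ∀ a ∈ C, ∀ v, ηlow * ‖v‖ ^ 2 ≤ fderiv ℝ (fderiv ℝ η) a v v)
    (hη_upper : ∀ a ∈ C, ∀ v, fderiv ℝ (fderiv ℝ η) a v v ≤ ηup * ‖v‖ ^ 2)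
    (n : Fin (N + 1)) :
    sqNormL2 (P.map ξ) volume (fun x y => u (t n) x y - numSolution M Ψ yq wq uh n x y)
      ≤ 2 * sqNormL2 (P.map ξ) volume
            (fun x y => stsReconstruction M Ψ yq wq ust (t n) x y
              - numSolution M Ψ yq wq uh n x y)
        + 2 * ENNReal.ofReal ηlow⁻¹
          * (sqNormL2 (P.map ξ) (volume.restrict (strip (t n)))
                (fun z y => stsResidual f (stsReconstruction M Ψ yq wq ust) z.1 z.2 y)
              + ENNReal.ofReal ηup * sqNormL2 (P.map ξ) volume
                  (fun x y => u₀ x y - stsReconstruction M Ψ yq wq ust 0 x y))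
          * EReal.exp ((ENNReal.ofReal ηlow⁻¹
              * ∫⁻ s in Ioo 0 (t n),
                  (ENNReal.ofReal (ηup * Cf)
                      * normLinfty (P.map ξ) (fun x y =>
                          deriv (fun z => stsReconstruction M Ψ yq wq ust s z y) x)
                    + ENNReal.ofReal (ηup ^ 2)) : ℝ≥0∞) : EReal) := by
  have hprob : IsProbabilityMeasure (P.map ξ) := Measure.isProbabilityMeasure_map hξ.aemeasurable
  set μ := P.map ξ with hμ
  have S : IsStateSet U f η q C Cf ηlow ηup :=
    ⟨hU, hf, hηq, hCU, hCconv, hCcomp, hCf0, hηlow, hηup, hCf, hη_lower, hη_upper⟩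
  set τ := t n with hτdef
  have hτ : τ ∈ Icc 0 T := htT n
  have h0T : (0 : ℝ) ∈ Icc 0 T := left_mem_Icc.2 hT.le
  have hmeas : ∀ r, MeasurableSet (strip r) := fun r => measurableSet_Ioo.prod MeasurableSet.univ
  have hsub : strip τ ⊆ strip T := prod_mono (Ioo_subset_Ioo_right hτ.2) subset_rfl
  -- the reconstruction at `y`, and its extension to all times
  set v : ℝ → ℝ → ℝ → Vec m := fun y s x => stsReconstruction M Ψ yq wq ust s x y with hv
  set W : ℝ → ℝ → ℝ → Vec m := fun y =>
    coeffExpansion M Ψ yq wq (fun l => clampTime T (ust l)) fun i => Ψ i y with hW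
  have hWv : ∀ y, W y = clampTime T (v y) := fun y => rfl
  have hvL : ∀ y, ∃ L : ℝ≥0,
      LipschitzOnWith L (fun p : ℝ × ℝ => v y p.1 p.2) (Icc 0 T ×ˢ univ) := fun y =>
    exists_lipschitzOn_coeffExpansion (fun i => Ψ i y) fun l => (hust l).lipschitz
  have hustc : ∀ l, Continuous (fun p : ℝ × ℝ => clampTime T (ust l) p.1 p.2) := fun l => by
    obtain ⟨L, hL⟩ := (hust l).lipschitz
    exact (lipschitzWith_clampTime hT.le hL).continuous
  have hWL : ∀ y, ∃ L : ℝ≥0, LipschitzWith L (fun p : ℝ × ℝ => W y p.1 p.2) := fun y => by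
    obtain ⟨L, hL⟩ := hvL y
    exact ⟨L, lipschitzWith_clampTime hT.le hL⟩
  have hWm := measurable_coeffExpansion (M := M) (yq := yq) (wq := wq) hustc hΨ.measurable
  have hWt := measurable_timeDeriv_coeffExpansion (M := M) (yq := yq) (wq := wq) hustc
    hΨ.measurable
  have hWx := measurable_spaceDeriv_coeffExpansion (M := M) (yq := yq) (wq := wq) hustc
    hΨ.measurable
  have hWC : ∀ᵐ y ∂μ, ∀ s x, W y s x ∈ C := by
    filter_upwards [hCsts] with y hy s x
    exact hy _ (clamp_mem hT.le s) x
  -- the space derivative is bounded by its norm in `L^∞(μ; L^∞(ℝ))`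
  set H : ℝ × ℝ × ℝ → ℝ≥0∞ := fun z => ‖spaceDeriv (W z.2.2) (z.1, z.2.1)‖ₑ with hH
  have hHm : Measurable H := hWx.enorm
  set g : ℝ → ℝ≥0∞ := fun s => essSup (fun y => essSup (fun x => H (s, x, y)) volume) μ with hg
  have hgm : Measurable g := measurable_essSup_essSup hHm
  have hgbound : ∀ᵐ y ∂μ, ∀ᵐ p ∂(volume.restrict (strip T)), ‖spaceDeriv (v y) p‖ₑ ≤ g p.1 := by
    filter_upwards [ae_le_essSup_essSup hHm (volume.restrict (Ioo 0 T))] with y hy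
    rw [← restrict_strip] at hy
    filter_upwards [hy, ae_restrict_mem (hmeas T)] with p hp hpT
    rwa [← spaceDeriv_clampTime hpT]
  have hgnorm : ∀ s ∈ Ioo 0 τ, g s = normLinfty μ (fun x y =>
      deriv (fun z => stsReconstruction M Ψ yq wq ust s z y) x) := fun s hs => by
    have hs' : ∀ x, ((s, x) : ℝ × ℝ) ∈ strip T := fun x => hsub ⟨hs, mem_univ x⟩
    have h1 : ∀ x y, H (s, x, y) = ‖spaceDeriv (v y) (s, x)‖ₑ := fun x y => by
      rw [← spaceDeriv_clampTime (hs' x), ← hWv]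
    simp only [hg, h1]
    rfl
  have hexp : ∫⁻ s in Ioo 0 τ, (ENNReal.ofReal (ηup * Cf) * normLinfty μ (fun x y =>
        deriv (fun z => stsReconstruction M Ψ yq wq ust s z y) x) + ENNReal.ofReal (ηup ^ 2))
      = ∫⁻ s in Ioo 0 τ, (ENNReal.ofReal (ηup * Cf) * g s + ENNReal.ofReal (ηup ^ 2)) :=
    setLIntegral_congr_fun measurableSet_Ioo fun s hs => by
      simp only [hgnorm s hs]
  rw [hexp]
  set X := EReal.exp ((ENNReal.ofReal ηlow⁻¹ * ∫⁻ s in Ioo 0 τ,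
    (ENNReal.ofReal (ηup * Cf) * g s + ENNReal.ofReal (ηup ^ 2)) : ℝ≥0∞) : EReal) with hX
  -- the stability estimate for almost every `y`
  have hstab : ∀ᵐ y ∂μ, ∫⁻ x, ‖u τ x y - v y τ x‖ₑ ^ 2 ≤ ENNReal.ofReal ηlow⁻¹
      * ((∫⁻ p in strip τ, ‖flowResidual f (v y) p‖ₑ ^ 2)
        + ENNReal.ofReal ηup * ∫⁻ x, ‖u₀ x y - v y 0 x‖ₑ ^ 2) * X := by
    filter_upwards [hu.path, hCu, hCsts, hgbound] with y hy1 hy2 hy3 hy4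
    obtain ⟨L, hL⟩ := hvL y
    exact hy1.stability_ennreal hT S hy2 hL hy3 hgm hy4 hτ
  -- measurability in `y`
  have hslice : ∀ {s : ℝ}, s ∈ Icc 0 T → Measurable fun z : ℝ × ℝ => v z.1 s z.2 := fun {s} hs => by
    have h1 : Measurable fun z : ℝ × ℝ => W z.1 s z.2 :=
      hWm.comp (by fun_prop : Measurable fun z : ℝ × ℝ => ((s, z.2, z.1) : ℝ × ℝ × ℝ))
    simpa only [hWv, clampTime_of_mem hs] using h1
  have hd : Measurable fun z : ℝ × ℝ => ‖u τ z.2 z.1 - v z.1 τ z.2‖ₑ ^ 2 :=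
    (((hu.measurable.comp (by fun_prop :
      Measurable fun z : ℝ × ℝ => ((τ, z.2, z.1) : ℝ × ℝ × ℝ))).sub (hslice hτ)).enorm).pow_const 2
  have hd₀ : Measurable fun z : ℝ × ℝ => ‖u₀ z.2 z.1 - v z.1 0 z.2‖ₑ ^ 2 :=
    (((hu.measurable_init.comp measurable_swap).sub (hslice h0T)).enorm).pow_const 2
  have hd₀m : Measurable fun y => ∫⁻ x, ‖u₀ x y - v y 0 x‖ₑ ^ 2 := hd₀.lintegral_prod_right'
  have hRm : AEMeasurable (fun y => ∫⁻ p in strip τ, ‖flowResidual f (v y) p‖ₑ ^ 2) μ := by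
    have h1 := S.aemeasurable_lintegral_flowResidual (μ := μ) (v := W) hWm hWt hWx hWL hWC τ
    refine h1.congr (Filter.Eventually.of_forall fun y => ?_)
    refine setLIntegral_congr_fun (hmeas τ) fun p hp => ?_
    simp only [hWv, flowResidual_clampTime (hsub hp)]
  -- integration over `y`
  have hint : sqNormL2 μ volume (fun x y => u τ x y - v y τ x) ≤ ENNReal.ofReal ηlow⁻¹
      * (sqNormL2 μ (volume.restrict (strip τ)) (fun p y => flowResidual f (v y) p)
        + ENNReal.ofReal ηup * sqNormL2 μ volume (fun x y => u₀ x y - v y 0 x)) * X := by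
    exact (lintegral_mono_ae hstab).trans
      (lintegral_mul_add_mul hRm hd₀m ENNReal.ofReal_ne_top (ENNReal.ofReal ηup) X).le
  refine (sqNormL2_sub_le (a := fun x y => u τ x y) (b := fun x y => v y τ x) μ volume
    (fun x y => numSolution M Ψ yq wq uh n x y) hd).trans (add_le_add le_rfl ?_)
  refine (mul_le_mul_right hint 2).trans (le_of_eq ?_)
  rw [← mul_assoc, ← mul_assoc]
  rfl
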